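/- Let $\mathcal X=\{0,1,\dots,N\}$ with $N\in\mathbb Z_{\ge0}$, or $\mathcal X=\mathbb Z_{\ge 0}$ (in this case put $N=\infty$). Let $B,D:\mathcal X\to\mathbb R$ be birth and death rates, i.e. $B(x)>0$ for $x\ne N$, $D(x)>0$ for $x\neq 0$, $D(0)=0$, and $B(N)=0$ in the finite case. Define matrices on $\mathcal X$, with all entries not listed equal to $0$: * $\widetilde{\mathcal H}_{x,x+1}=-B(x)$, $\widetilde{\mathcal H}_{x,x-1}=-D(x)$, $\widetilde{\mathcal H}_{x,x}=B(x)+D(x)$; * $\mathcal H=\Phi\widetilde{\mathcal H}\Phi^{-1}$, where $\Phi=\mathrm{diag}(\phi_0)$ and $\phi_0(x)=\big(\prod_{y=0}^{x-1}B(y)/D(y+1)\big)^{1/2}$; * $L_{BD}$ with $(L_{BD})_{x+1,x}=B(x)$, $(L_{BD})_{x-1,x}=D(x)$, $(L_{BD})_{x,x}=-B(x)-D(x)$ (continuous time process $\partial_t\mathcal P=L_{BD}\mathcal P$); * for $t_S>0$ with $t_S\,(B(x)+D(x))<1$ for all $x\in\mathcal X$, and with $\bar B=t_SB$, $\bar D=t_SD$: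 $L_{x+1,x}=\bar B(x)$, $L_{x-1,x}=\bar D(x)$, $L_{x,x}=1-\bar B(x)-\bar D(x)$ (discrete time process $\mathcal P(\cdot\,;\ell+1)=L\mathcal P(\cdot\,;\ell)$). Notation: $0<q<1$ throughout, $(a)_k=\prod_{i<k}(a+i)$, $(a;q)_k=\prod_{i<k}(1-aq^i)$, $(a_1,\dots,a_r;q)_k=\prod_j(a_j;q)_k$ and likewise $(a_1,\dots,a_r)_k=\prod_j(a_j)_k$; ${}_rF_s$ is the hypergeometric series, and ${}_r\phi_s\big({a_1,\dots,a_r\atop b_1,\dots,b_s}\big|q;z\big)=\sum_{k\ge 0}\frac{(a_1,\dots,a_r;q)_k}{(b_1,\dots,b_s;q)_k}\big((-1)^kq^{k(k-1)/2}\big)^{1+s-r}\frac{z^k}{(q;q)_k}$; all series are terminating (summed over $0\le k\le n$). $\binom Nx_q=\frac{(q;q)_N}{(q;q)_x(q;q)_{N-x}}$. The normalisation constants are written as $d_n^2=(d_n^2/d_0^2)\times d_0^2$. Quotients which are $0/0$ for special parameter values at $x=0$ or $n=0$ ($a+b=1$, $\tilde d=0$, $ab=q$ or $\tilde d=1$)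 stand for their limit values. Consider the following data. The lattice is $\{0,\dots,N\}$ in 1–10 and $\mathbb Z_{\ge0}$ in 11. 1. Krawtchouk, $0<p<1$: $B=p(N-x)$, $D=(1-p)x$, $\mathcal E(n)=n$, $\eta=x$, $\phi_0^2=\binom Nx(\frac p{1-p})^x$, $d_n^2=\binom Nn(\frac p{1-p})^n\times(1-p)^N$, $\check P_n={}_2F_1\big({-n,-x\atop -N}\big|p^{-1}\big)$. 2. Hahn, $a,b>0$: $B=(x+a)(N-x)$, $D=x(b+N-x)$, $\mathcal E(n)=n(n+a+b-1)$, $\eta=x$, $\phi_0^2=\binom Nx\frac{(a)_x(b)_{N-x}}{(b)_N}$, $d_n^2=\binom Nn\frac{(a)_n(2n+a+b-1)(a+b)_N}{(b)_n(n+a+b-1)_{N+1}}\times\frac{(b)_N}{(a+b)_N}$, $\check P_n={}_3F_2\big({-n,n+a+b-1,-x\atop a,-N}\big|1\big)$. 3. Dual Hahn, $a,b>0$: $B=\frac{(x+a)(x+a+b-1)(N-x)}{(2x-1+a+b)(2x+a+b)}$, $D=\frac{x(x+b-1)(x+a+b+N-1)}{(2x-2+a+b)(2x-1+a+b)}$ ($D(0)=0$),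 $\mathcal E(n)=n$, $\eta=x(x+a+b-1)$, $\phi_0^2=\binom Nx\frac{(a)_x(2x+a+b-1)(a+b)_N}{(b)_x(x+a+b-1)_{N+1}}$, $d_n^2=\binom Nn\frac{(a)_n(b)_{N-n}}{(b)_N}\times\frac{(b)_N}{(a+b)_N}$, $\check P_n={}_3F_2\big({-n,x+a+b-1,-x\atop a,-N}\big|1\big)$. 4. Racah, $c=-N$, $a\ge b$, $d>0$, $a>N+d$, $0<b<1+d$, $\tilde d=a+b+c-d-1$: $B=-\frac{(x+a)(x+b)(x+c)(x+d)}{(2x+d)(2x+1+d)}$, $D=-\frac{(x+d-a)(x+d-b)(x+d-c)x}{(2x-1+d)(2x+d)}$ ($D(0)=0$), $\mathcal E(n)=n(n+\tilde d)$, $\eta=x(x+d)$, $\phi_0^2=\frac{(a,b,c,d)_x}{(1+d-a,1+d-b,1+d-c,1)_x}\frac{2x+d}d$, $d_n^2=\frac{(a,b,c,\tilde d)_n}{(1+\tilde d-a,1+\tilde d-b,1+\tilde d-c,1)_n}\frac{2n+\tilde d}{\tilde d}\times\frac{(-1)^N(1+d-a,1+d-b,1+d-c)_N}{(\tilde d+1)_N(d+1)_{2N}}$,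 $\check P_n={}_4F_3\big({-n,n+\tilde d,-x,x+d\atop a,b,c}\big|1\big)$. 5. Affine $q$-Krawtchouk, $0<p<q^{-1}$: $B=(q^{x-N}-1)(1-pq^{x+1})$, $D=pq^{x-N}(1-q^x)$, $\mathcal E(n)=q^{-n}-1$, $\eta=q^{-x}-1$, $\phi_0^2=\binom Nx_q\frac{(pq;q)_x}{(pq)^x}$, $d_n^2=\binom Nn_q\frac{(pq;q)_n}{(pq)^n}\times(pq)^N$, $\check P_n={}_3\phi_2\big({q^{-n},q^{-x},0\atop pq,q^{-N}}\big|q;q\big)$. 6. $q$-Krawtchouk, $p>0$: $B=q^{x-N}-1$, $D=p(1-q^x)$, $\mathcal E(n)=(q^{-n}-1)(1+pq^n)$, $\eta=q^{-x}-1$, $\phi_0^2=\binom Nx_qp^{-x}q^{\frac12x(x-1)-xN}$, $d_n^2=\binom Nn_q\frac{(-p;q)_n}{(-pq^{N+1};q)_np^nq^{\frac12n(n+1)}}\frac{1+pq^{2n}}{1+p}\times\frac{p^Nq^{\frac12N(N+1)}}{(-pq;q)_N}$, $\check P_n={}_3\phi_2\big({q^{-n},q^{-x},-pq^n\atop q^{-N},0}\big|q;q\big)$.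 7. Quantum $q$-Krawtchouk, $p>q^{-N}$: $B=p^{-1}q^x(q^{x-N}-1)$, $D=(1-q^x)(1-p^{-1}q^{x-N-1})$, $\mathcal E(n)=1-q^n$, $\eta=q^{-x}-1$, $\phi_0^2=\binom Nx_q\frac{p^{-x}q^{x(x-1-N)}}{(p^{-1}q^{-N};q)_x}$, $d_n^2=\binom Nn_q\frac{p^{-n}q^{-Nn}}{(p^{-1}q^{-n};q)_n}\times(p^{-1}q^{-N};q)_N$, $\check P_n={}_2\phi_1\big({q^{-n},q^{-x}\atop q^{-N}}\big|q;pq^{n+1}\big)$. 8. $q$-Hahn, $0<a,b<1$: $B=(1-aq^x)(q^{x-N}-1)$, $D=aq^{-1}(1-q^x)(q^{x-N}-b)$, $\mathcal E(n)=(q^{-n}-1)(1-abq^{n-1})$, $\eta=q^{-x}-1$, $\phi_0^2=\binom Nx_q\frac{(a;q)_x(b;q)_{N-x}}{(b;q)_Na^x}$, $d_n^2=\binom Nn_q\frac{(a,abq^{-1};q)_n}{(abq^N,b;q)_na^n}\frac{1-abq^{2n-1}}{1-abq^{-1}}\times\frac{(b;q)_Na^N}{(ab;q)_N}$, $\check P_n={}_3\phi_2\big({q^{-n},abq^{n-1},q^{-x}\atop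 a,q^{-N}}\big|q;q\big)$. 9. Dual $q$-Hahn, $0<a,b<1$: $B=\frac{(q^{x-N}-1)(1-aq^x)(1-abq^{x-1})}{(1-abq^{2x-1})(1-abq^{2x})}$, $D=aq^{x-N-1}\frac{(1-q^x)(1-abq^{x+N-1})(1-bq^{x-1})}{(1-abq^{2x-2})(1-abq^{2x-1})}$ ($D(0)=0$), $\mathcal E(n)=q^{-n}-1$, $\eta=(q^{-x}-1)(1-abq^{x-1})$, $\phi_0^2=\binom Nx_q\frac{(a,abq^{-1};q)_x}{(abq^N,b;q)_xa^x}\frac{1-abq^{2x-1}}{1-abq^{-1}}$, $d_n^2=\binom Nn_q\frac{(a;q)_n(b;q)_{N-n}}{(b;q)_Na^n}\times\frac{(b;q)_Na^N}{(ab;q)_N}$, $\check P_n={}_3\phi_2\big({q^{-n},abq^{x-1},q^{-x}\atop a,q^{-N}}\big|q;q\big)$. 10. $q$-Racah, $c=q^{-N}$, $a\le b$, $0<d<1$, $0<a<q^Nd$, $qd<b<1$, $\tilde d=abcd^{-1}q^{-1}$: $B=-\frac{(1-aq^x)(1-bq^x)(1-cq^x)(1-dq^x)}{(1-dq^{2x})(1-dq^{2x+1})}$,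 $D=-\tilde d\frac{(1-a^{-1}dq^x)(1-b^{-1}dq^x)(1-c^{-1}dq^x)(1-q^x)}{(1-dq^{2x-1})(1-dq^{2x})}$ ($D(0)=0$), $\mathcal E(n)=(q^{-n}-1)(1-\tilde dq^n)$, $\eta=(q^{-x}-1)(1-dq^x)$, $\phi_0^2=\frac{(a,b,c,d;q)_x}{(a^{-1}dq,b^{-1}dq,c^{-1}dq,q;q)_x\tilde d^x}\frac{1-dq^{2x}}{1-d}$, $d_n^2=\frac{(a,b,c,\tilde d;q)_n}{(a^{-1}\tilde dq,b^{-1}\tilde dq,c^{-1}\tilde dq,q;q)_nd^n}\frac{1-\tilde dq^{2n}}{1-\tilde d}\times\frac{(-1)^N(a^{-1}dq,b^{-1}dq,c^{-1}dq;q)_N\tilde d^Nq^{\frac12N(N+1)}}{(\tilde dq;q)_N(dq;q)_{2N}}$, $\check P_n={}_4\phi_3\big({q^{-n},\tilde dq^n,q^{-x},dq^x\atop a,b,c}\big|q;q\big)$. 11. Al-Salam–Carlitz II, $0<a<q^{-1}$: $B=aq^{2x+1}$, $D=(1-q^x)(1-aq^x)$, $\mathcal E(n)=1-q^n$, $\eta=q^{-x}-1$,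 $\phi_0^2=\frac{a^xq^{x^2}}{(q,aq;q)_x}$, $d_n^2=\frac{(aq)^n}{(q;q)_n}\times(aq;q)_\infty$, $\check P_n={}_2\phi_0\big({q^{-n},q^{-x}\atop -}\big|q;a^{-1}q^n\big)$. Then in each of these cases (with $x,y,n,m$ ranging over $\mathcal X$): (i) $B$ and $D$ are birth and death rates in the above sense, and $B+D$ is bounded; $\eta(0)=0$ and $\check P_n(x)=P_n(\eta(x))$ for a polynomial $P_n$ of degree $n$; $\check P_n(0)=1$; and $$B(x)\big(\check P_n(x)-\check P_n(x+1)\big)+D(x)\big(\check P_n(x)-\check P_n(x-1)\big)=\mathcal E(n)\check P_n(x).$$ The numbers $\mathcal E(n)$ are distinct, $\mathcal E(0)=0$ and $\mathcal E(n)>0$ for $n\ne0$. The function $\phi_0^2$ and the constants $d_n^2>0$ are as listed: $\phi_0(x)^2=\prod_{y<x}B(y)/D(y+1)$, $\sum_x\phi_0(x)^2=1/d_0^2$ and $\sum_x\phi_0(x)^2\check P_n(x)\check P_m(x)=\delta_{nm}/d_n^2$. (ii) Put $\hat\phi_n=d_n\phi_0\check P_n$ ($d_n>0$), $\pi=\hat\phi_0^2=d_0^2\phi_0^2$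 and $\kappa(n)=1-t_S\mathcal E(n)$. The vectors $\check P_n$ with the eigenvalues $\mathcal E(n)$ are a complete eigensystem of $\widetilde{\mathcal H}$, the vectors $\hat\phi_n$ with $\mathcal E(n)$ of $\mathcal H$, the vectors $\hat\phi_0\hat\phi_n$ with $-\mathcal E(n)$ of $L_{BD}$, and the vectors $\hat\phi_0\hat\phi_n$ with $\kappa(n)$ of $L$, in the space of all real $u$ on $\mathcal X$ with $\sum_xw(x)u(x)^2<\infty$, where $w=\phi_0^2$ for $\widetilde{\mathcal H}$, $w=1$ for $\mathcal H$, and $w=\phi_0^{-2}$ for $L_{BD}$ and $L$. That is: they are eigenvectors in that space, orthogonal and total in it, the eigenvalues are distinct, and the matrix has no other eigenvalues in that space, and no other eigenvectors than multiples of these. The $\hat\phi_n$ are orthonormal. (iii) $\pi$ is a probability distribution, $L_{BD}\pi=0$ and $L\pi=\pi$. Let $p$ be a probability distribution on $\mathcal X$ with $\sum_xp(x)^2/\pi(x)<\infty$ (no restriction if $\mathcal X$ is finite), and put $c_n=\sum_x\hat\phi_n(x)\hat\phi_0(x)^{-1}p(x)$. Then these sums converge, $c_0=1$ and $p(x)=\hat\phi_0(x)\sum_nc_n\hat\phi_n(x)$.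 (iv) Continuous time. Every initial probability distribution $p$ admits a solution $\mathcal P(x;t)$, $t\ge0$, of the initial value problem (probability distributions with $\partial_t\mathcal P=L_{BD}\mathcal P$ and $\mathcal P(\cdot\,;0)=p$), and every solution tends to $\pi$: $\lim_{t\to\infty}\mathcal P(x;t)=\pi(x)$. If $\sum_xp(x)^2/\pi(x)<\infty$, every solution is given by $\mathcal P(x;t)=\hat\phi_0(x)\sum_nc_ne^{-\mathcal E(n)t}\hat\phi_n(x)$. The transition probability from $y$ to $x$ (the solution started in the point $y$) is $\hat\phi_0(x)\hat\phi_0(y)^{-1}\sum_ne^{-\mathcal E(n)t}\hat\phi_n(x)\hat\phi_n(y)$. (v) Discrete time, for each $t_S$ as above. $\bar B$ and $\bar D$ are again positive with the same boundary conditions, $L_{xy}\ge0$, $\sum_xL_{xy}=1$ and $L=\mathrm{Id}+t_SL_{BD}$. For every initial probability distribution $p$ the distribution after $\ell$ steps is a probability distribution, it is $\mathcal P(x;\ell)=\sum_y(L^\ell)_{xy}p(y)$, and $\lim_{\ell\to\infty}\mathcal P(x;\ell)=\pi(x)$. If $\sum_xp(x)^2/\pi(x)<\infty$, then $\mathcal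 P(x;\ell)=\hat\phi_0(x)\sum_nc_n\kappa(n)^\ell\hat\phi_n(x)$. The $\ell$ step transition probabilities are $(L^\ell)_{xy}=\hat\phi_0(x)\hat\phi_0(y)^{-1}\sum_n\kappa(n)^\ell\hat\phi_n(x)\hat\phi_n(y)$, and $\lim_{\ell\to\infty}(L^\ell)_{xy}=\pi(x)$. (vi) Spectral representations: $$\mathcal H_{xy}=\sum_n\mathcal E(n)\hat\phi_n(x)\hat\phi_n(y),$$ $$(L_{BD})_{xy}=-\hat\phi_0(x)\sum_n\mathcal E(n)\hat\phi_n(x)\hat\phi_n(y)\hat\phi_0(y)^{-1}=-\pi(x)\sum_n\mathcal E(n)\frac{d_n^2}{d_0^2}\check P_n(x)\check P_n(y),$$ $$L_{xy}=\hat\phi_0(x)\sum_n\kappa(n)\hat\phi_n(x)\hat\phi_n(y)\hat\phi_0(y)^{-1}=\pi(x)\sum_n\kappa(n)\frac{d_n^2}{d_0^2}\check P_n(x)\check P_n(y).$$ -/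

import Mathlib

open Filter Topology

noncomputable section

namespace BD

/-! ### Hypergeometric and basic hypergeometric series -/

/-- The shifted factorial `(a)_k = a (a+1) ⋯ (a+k-1)`. -/
def poch (a : ℝ) (k : ℕ) : ℝ := (ascPochhammer ℝ k).eval a

/-- The `q`-shifted factorial `(a;q)_k = ∏_{i<k} (1 - a q^i)`. -/
def qpoch (a q : ℝ) (k : ℕ) : ℝ := ∏ i ∈ Finset.range k, (1 - a * q ^ i)

/-- `(a;q)_∞`, an absolutely convergent product for `0 < q < 1`. -/
def qpochInf (a q : ℝ) : ℝ := ∏' i : ℕ, (1 - a * q ^ i)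

/-- The generalised hypergeometric series with upper parameters `as`, lower parameters `bs` and
argument `z`, summed up to the term of order `m`. It is only used with `-m` among the upper
parameters, where the series terminates at that term. -/
def hyp (as bs : List ℝ) (z : ℝ) (m : ℕ) : ℝ :=
  ∑ k ∈ Finset.range (m + 1),
    (as.map fun a => poch a k).prod / (bs.map fun b => poch b k).prod * z ^ k / (k.factorial : ℝ)

/-- The basic hypergeometric series `_rφ_s` with upper parameters `as` (`r` of them), lower
parameters `bs` (`s` of them), base `q` and argument `z`, summed up to the term of order `m`.
It is only used with `q^{-m}` among the upper parameters, where the series terminates at that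
term. -/
def qhyp (as bs : List ℝ) (q z : ℝ) (m : ℕ) : ℝ :=
  ∑ k ∈ Finset.range (m + 1),
    (as.map fun a => qpoch a q k).prod / (bs.map fun b => qpoch b q k).prod *
      ((-1) ^ k * q ^ (k * (k - 1) / 2)) ^ (1 + (bs.length : ℤ) - (as.length : ℤ)) *
      z ^ k / qpoch q q k

/-- The binomial coefficient `N! / (x! (N-x)!)`. -/
def binom (N x : ℕ) : ℝ := (N.factorial : ℝ) / (x.factorial * (N - x).factorial)

/-- The `q`-binomial coefficient `(q;q)_N / ((q;q)_x (q;q)_{N-x})`. -/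
def qbinom (q : ℝ) (N x : ℕ) : ℝ := qpoch q q N / (qpoch q q x * qpoch q q (N - x))

/-- The quotient `(x + s) / (2x + s)`, given its limit value `1` at `x = 0` also if `s = 0`. -/
def quot (s : ℝ) (x : ℕ) : ℝ := if x = 0 then 1 else (x + s) / (2 * x + s)

/-- The quotient `(1 - s q^x) / (1 - s q^{2x})`, given its limit value `1` at `x = 0` also if
`s = 1`. -/
def qquot (s q : ℝ) (x : ℕ) : ℝ :=
  if x = 0 then 1 else (1 - s * q ^ x) / (1 - s * q ^ (2 * x))

/-! ### Matrices on the lattice -/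

/-- The lattice `{0, …, N}`, which is all of `ℕ` for `N = ⊤`. -/
abbrev Lattice (N : ℕ∞) : Type := {x : ℕ // (x : ℕ∞) ≤ N}

section Matrices

variable {N : ℕ∞}

/-- The action of a matrix on a vector. Only used for matrices with finitely many non-zero
entries in each row, so that the sum is a finite one. -/
def act (A : Matrix (Lattice N) (Lattice N) ℝ) (v : Lattice N → ℝ) : Lattice N → ℝ :=
  fun x => ∑' y, A x y * v y

/-- The powers `A^ℓ` of a matrix with finitely many non-zero entries in each row. -/
def matPow (A : Matrix (Lattice N) (Lattice N) ℝ) : ℕ → Matrix (Lattice N) (Lattice N) ℝ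
  | 0 => 1
  | ℓ + 1 => fun x y => ∑' z, A x z * matPow A ℓ z y

/-- `v n` (`n` in the lattice) is a complete system of eigenvectors of `A` with simple eigenvalues
`ev n` in the space of real functions `u` on the lattice with `∑ wt(x) u(x)² < ∞`:
the `v n` are eigenvectors, mutually orthogonal and total in that space, the `ev n` are distinct,
and `A` has no other eigenvalues or eigenvectors in that space. -/
structure IsCompleteEigensystem (A : Matrix (Lattice N) (Lattice N) ℝ) (wt : Lattice N → ℝ)
    (ev : Lattice N → ℝ) (v : Lattice N → Lattice N → ℝ) : Prop where
  ne_zero : ∀ n, v n ≠ 0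
  mem : ∀ n, Summable fun x => wt x * v n x ^ 2
  eigen : ∀ n, act A (v n) = ev n • v n
  simple : Function.Injective ev
  orthogonal : ∀ n m, n ≠ m → HasSum (fun x => wt x * v n x * v m x) 0
  total : ∀ u : Lattice N → ℝ, (Summable fun x => wt x * u x ^ 2) →
    (∀ n, ∑' x, wt x * v n x * u x = 0) → u = 0
  all : ∀ (ev' : ℝ) (u : Lattice N → ℝ), u ≠ 0 → (Summable fun x => wt x * u x ^ 2) →
    act A u = ev' • u → ∃ n, ev' = ev n ∧ ∃ c : ℝ, u = c • v n

/-- A probability distribution on the lattice. -/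
structure IsProb (p : Lattice N → ℝ) : Prop where
  nonneg : ∀ x, 0 ≤ p x
  sum_eq_one : HasSum p 1

/-- The entry from `y` to `x` of the generator of the continuous time birth and death process with
birth rates `B` and death rates `D`. -/
def gen (N : ℕ∞) (B D : ℕ → ℝ) : Matrix (Lattice N) (Lattice N) ℝ := fun x y =>
  if x.1 = y.1 + 1 then B y
  else if x.1 + 1 = y.1 then D y
  else if x = y then -B y - D y
  else 0

/-- The transition matrix of the discrete time birth and death process: the entry `x, y` is the
probability to go from `y` to `x` in one step, for the birth and death probabilities `B`, `D`. -/
def trans (N : ℕ∞) (B D : ℕ → ℝ) : Matrix (Lattice N) (Lattice N) ℝ := fun x y =>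
  if x.1 = y.1 + 1 then B y
  else if x.1 + 1 = y.1 then D y
  else if x = y then 1 - B y - D y
  else 0

/-- The tri-diagonal matrix `H̃` of the difference operator
`f ↦ B(x) (f(x) - f(x+1)) + D(x) (f(x) - f(x-1))`. -/
def Htilde (N : ℕ∞) (B D : ℕ → ℝ) : Matrix (Lattice N) (Lattice N) ℝ := fun x y =>
  if y.1 = x.1 + 1 then -B x
  else if y.1 + 1 = x.1 then -D x
  else if x = y then B x + D x
  else 0

/-- `φ₀(x) = √(∏_{y<x} B(y) / D(y+1))`. -/
def phi0 (B D : ℕ → ℝ) (x : ℕ) : ℝ := √(∏ y ∈ Finset.range x, B y / D (y + 1))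

/-- The symmetric matrix `H = Φ H̃ Φ⁻¹`, where `Φ` is the diagonal matrix of `φ₀`. -/
def Hsymm (N : ℕ∞) (B D : ℕ → ℝ) : Matrix (Lattice N) (Lattice N) ℝ := fun x y =>
  phi0 B D x * Htilde N B D x y * (phi0 B D y)⁻¹

/-- Positive birth and death rates with the boundary conditions `D(0) = 0`, and `B(N) = 0` on the
finite lattice. -/
structure IsBirthDeath (N : ℕ∞) (B D : ℕ → ℝ) : Prop where
  birth_pos : ∀ x : Lattice N, (x.1 : ℕ∞) ≠ N → 0 < B x
  birth_end : ∀ x : Lattice N, (x.1 : ℕ∞) = N → B x = 0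
  death_pos : ∀ x : Lattice N, x.1 ≠ 0 → 0 < D x
  death_zero : D 0 = 0

/-- `P t x` is a solution (for times `t ≥ 0`) of the initial value problem of the continuous time
birth and death process, with initial distribution `p`. -/
structure IsContinuousSolution (N : ℕ∞) (B D : ℕ → ℝ) (p : Lattice N → ℝ)
    (P : ℝ → Lattice N → ℝ) : Prop where
  init : P 0 = p
  prob : ∀ t, 0 ≤ t → IsProb (P t)
  evol : ∀ t, 0 ≤ t → ∀ x,
    HasDerivWithinAt (fun s => P s x) (act (gen N B D) (P t) x) (Set.Ici 0) t

/-- The distribution after `ℓ` steps of the discrete time process with transition matrix `L` and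
initial distribution `p`. -/
def evolve (L : Matrix (Lattice N) (Lattice N) ℝ) (p : Lattice N → ℝ) : ℕ → Lattice N → ℝ
  | 0 => p
  | ℓ + 1 => act L (evolve L p ℓ)

end Matrices

/-! ### Data of an explicit example -/

/-- The data listed for one polynomial: the lattice `{0, …, N}`, the birth and death rates, the
eigenvalues, the sinusoidal coordinate, the eigenvectors (`P n x` is the `n`-th one at `x`), the
formula for `φ₀²`, the formula for `d_n² / d_0²` and the formula for `d_0²`. Only the values at
points `x`, `n` of the lattice matter. -/
structure Data where
  N : ℕ∞
  B : ℕ → ℝ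
  D : ℕ → ℝ
  E : ℕ → ℝ
  eta : ℕ → ℝ
  P : ℕ → ℕ → ℝ
  phi0sq : ℕ → ℝ
  dratio : ℕ → ℝ
  d0sq : ℝ

namespace Data

variable (S : Data)

/-- `d_n² = (d_n² / d_0²) × d_0²`. -/
def dsq (n : ℕ) : ℝ := S.dratio n * S.d0sq

/-- `φ̂_n(x) = d_n φ₀(x) P̌_n(x)`, with `d_n > 0`. -/
def phihat (n x : ℕ) : ℝ := √(S.dsq n) * phi0 S.B S.D x * S.P n x

/-- The stationary distribution `π(x) = d_0² φ₀(x)²`. -/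
def stat (x : ℕ) : ℝ := S.d0sq * phi0 S.B S.D x ^ 2

/-- The expansion coefficients `c_n = ∑_x φ̂_n(x) φ̂_0(x)⁻¹ p(x)`. -/
def coeff (p : Lattice S.N → ℝ) (n : ℕ) : ℝ :=
  ∑' x : Lattice S.N, S.phihat n x * (S.phihat 0 x)⁻¹ * p x

/-- The eigenvalues `κ(n) = 1 - t E(n)` of the discrete time process. -/
def kappa (t : ℝ) (n : ℕ) : ℝ := 1 - t * S.E n

/-- The generator of the continuous time process. -/
def LBD : Matrix (Lattice S.N) (Lattice S.N) ℝ := gen S.N S.B S.D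

/-- The transition matrix of the discrete time process with birth and death probabilities
`t B(x)` and `t D(x)`. -/
def L (t : ℝ) : Matrix (Lattice S.N) (Lattice S.N) ℝ :=
  trans S.N (fun x => t * S.B x) (fun x => t * S.D x)

/-- The initial distributions that can be expanded: `p / φ̂_0` is square summable. On a finite
lattice every function has this property. -/
def Expandable (p : Lattice S.N → ℝ) : Prop :=
  Summable fun x : Lattice S.N => (p x / S.phihat 0 x) ^ 2

/-- The listed data are correct: the rates are admissible and bounded, the `P̌_n` are polynomials of
degree `n` in the sinusoidal coordinate and form a complete system of eigenvectors of `H̃`, i.e.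
solve the difference equation, and `φ₀²` and the norms are as listed. -/
structure IsSpectralData : Prop where
  isBirthDeath : IsBirthDeath S.N S.B S.D
  bounded : ∃ M : ℝ, ∀ x : Lattice S.N, S.B x + S.D x ≤ M
  eta_zero : S.eta 0 = 0
  polynomial : ∀ n : Lattice S.N, ∃ p : Polynomial ℝ, p.degree = (n.1 : WithBot ℕ) ∧
    ∀ x : Lattice S.N, S.P n x = p.eval (S.eta x)
  P_at_zero : ∀ n : Lattice S.N, S.P n 0 = 1
  difference_eq : ∀ n x : Lattice S.N,
    S.B x * (S.P n x - S.P n (x.1 + 1)) + S.D x * (S.P n x - S.P n (x.1 - 1)) = S.E n * S.P n x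
  E_zero : S.E 0 = 0
  E_pos : ∀ n : Lattice S.N, n.1 ≠ 0 → 0 < S.E n
  phi0_sq : ∀ x : Lattice S.N, 0 < S.phi0sq x ∧ phi0 S.B S.D x ^ 2 = S.phi0sq x
  d0_sq : 0 < S.d0sq ∧ S.dratio 0 = 1 ∧
    HasSum (fun x : Lattice S.N => phi0 S.B S.D x ^ 2) (1 / S.d0sq)
  d_sq_pos : ∀ n : Lattice S.N, 0 < S.dsq n
  norm : ∀ n m : Lattice S.N, HasSum (fun x : Lattice S.N => S.phi0sq x * S.P n x * S.P m x)
    (if n = m then 1 / S.dsq n else 0)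
  eigensystem : IsCompleteEigensystem (Htilde S.N S.B S.D) (fun x => S.phi0sq x)
    (fun n => S.E n) (fun n x => S.P n x)
  eigensystem_symm : IsCompleteEigensystem (Hsymm S.N S.B S.D) (fun _ => 1)
    (fun n => S.E n) (fun n x => S.phihat n x)
  orthonormal : ∀ n m : Lattice S.N,
    HasSum (fun x : Lattice S.N => S.phihat n x * S.phihat m x) (if n = m then 1 else 0)
  spectral_symm : ∀ x y : Lattice S.N,
    HasSum (fun n : Lattice S.N => S.E n * S.phihat n x * S.phihat n y) (Hsymm S.N S.B S.D x y)
  stat_prob : IsProb fun x : Lattice S.N => S.stat x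
  /-- The eigenfunction expansion of an initial distribution. -/
  expansion : ∀ p : Lattice S.N → ℝ, IsProb p → S.Expandable p →
    (∀ n : Lattice S.N,
      Summable fun x : Lattice S.N => S.phihat n x * (S.phihat 0 x)⁻¹ * p x) ∧
    S.coeff p 0 = 1 ∧
    ∀ x : Lattice S.N,
      HasSum (fun n : Lattice S.N => S.phihat 0 x * (S.coeff p n * S.phihat n x)) (p x)

/-- The solution of the continuous time process. -/
structure SolvesContinuous : Prop where
  eigensystem : IsCompleteEigensystem S.LBD (fun x => (S.phi0sq x)⁻¹)
    (fun n => -S.E n) (fun n x => S.phihat 0 x * S.phihat n x)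
  stationary : act S.LBD (fun x => S.stat x) = 0
  exists_solution : ∀ p, IsProb p → ∃ P, IsContinuousSolution S.N S.B S.D p P
  /-- The initial value problem. -/
  initial_value : ∀ p P, IsProb p → S.Expandable p → IsContinuousSolution S.N S.B S.D p P →
    ∀ t, 0 ≤ t → ∀ x : Lattice S.N,
      HasSum (fun n : Lattice S.N =>
        S.phihat 0 x * (S.coeff p n * Real.exp (-S.E n * t) * S.phihat n x)) (P t x)
  /-- The transition probability from `y` to `x` after time `t`. -/
  transition : ∀ (y : Lattice S.N) (P : ℝ → Lattice S.N → ℝ),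
    IsContinuousSolution S.N S.B S.D (Pi.single y 1) P → ∀ t, 0 ≤ t → ∀ x : Lattice S.N,
      HasSum (fun n : Lattice S.N => S.phihat 0 x * (S.phihat 0 y)⁻¹ *
        (Real.exp (-S.E n * t) * S.phihat n x * S.phihat n y)) (P t x)
  /-- The approach to the stationary distribution, from every initial distribution and in
  particular from a point. -/
  limit : ∀ p P, IsProb p → IsContinuousSolution S.N S.B S.D p P →
    ∀ x : Lattice S.N, Tendsto (fun t => P t x) atTop (𝓝 (S.stat x))
  /-- The spectral representation of the generator, in two forms. -/
  spectral : ∀ x y : Lattice S.N,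
    HasSum (fun n : Lattice S.N =>
      -(S.phihat 0 x * (S.E n * S.phihat n x * S.phihat n y) * (S.phihat 0 y)⁻¹)) (S.LBD x y) ∧
    HasSum (fun n : Lattice S.N =>
      -(S.stat x * (S.E n * (S.dsq n / S.dsq 0) * S.P n x * S.P n y))) (S.LBD x y)

/-- The solution of the discrete time process with time scale `t`. -/
structure SolvesDiscrete (t : ℝ) : Prop where
  isBirthDeath : IsBirthDeath S.N (fun x => t * S.B x) (fun x => t * S.D x)
  nonneg : ∀ x y, 0 ≤ S.L t x y
  sum_eq_one : ∀ y, HasSum (fun x => S.L t x y) 1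
  eq_one_add : S.L t = 1 + t • S.LBD
  eigensystem : IsCompleteEigensystem (S.L t) (fun x => (S.phi0sq x)⁻¹)
    (fun n => S.kappa t n) (fun n x => S.phihat 0 x * S.phihat n x)
  stationary : act (S.L t) (fun x => S.stat x) = fun x : Lattice S.N => S.stat x
  /-- The distribution after `ℓ` steps is given by the power of the transition matrix. -/
  steps : ∀ p, IsProb p → ∀ ℓ, IsProb (evolve (S.L t) p ℓ) ∧ ∀ x : Lattice S.N,
    HasSum (fun y => matPow (S.L t) ℓ x y * p y) (evolve (S.L t) p ℓ x)
  /-- The initial value problem. -/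
  initial_value : ∀ p, IsProb p → S.Expandable p → ∀ ℓ, ∀ x : Lattice S.N,
    HasSum (fun n : Lattice S.N =>
      S.phihat 0 x * (S.coeff p n * S.kappa t n ^ ℓ * S.phihat n x)) (evolve (S.L t) p ℓ x)
  /-- The `ℓ` step transition probability from `y` to `x`. -/
  transition : ∀ ℓ, ∀ x y : Lattice S.N,
    HasSum (fun n : Lattice S.N => S.phihat 0 x * (S.phihat 0 y)⁻¹ *
      (S.kappa t n ^ ℓ * S.phihat n x * S.phihat n y)) (matPow (S.L t) ℓ x y)
  /-- The approach to the stationary distribution. -/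
  limit : ∀ p, IsProb p → ∀ x : Lattice S.N,
    Tendsto (fun ℓ => evolve (S.L t) p ℓ x) atTop (𝓝 (S.stat x))
  limit_transition : ∀ x y : Lattice S.N,
    Tendsto (fun ℓ => matPow (S.L t) ℓ x y) atTop (𝓝 (S.stat x))
  /-- The spectral representation of the transition matrix, in two forms. -/
  spectral : ∀ x y : Lattice S.N,
    HasSum (fun n : Lattice S.N =>
      S.phihat 0 x * (S.kappa t n * S.phihat n x * S.phihat n y) * (S.phihat 0 y)⁻¹)
      (S.L t x y) ∧
    HasSum (fun n : Lattice S.N =>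
      S.stat x * (S.kappa t n * (S.dsq n / S.dsq 0) * S.P n x * S.P n y)) (S.L t x y)

end Data

/-! ### The examples -/

/-- Krawtchouk. -/
def krawtchouk (N : ℕ) (p : ℝ) : Data where
  N := N
  B x := p * (N - x)
  D x := (1 - p) * x
  E n := n
  eta x := x
  P n x := hyp [-n, -x] [-N] p⁻¹ n
  phi0sq x := binom N x * (p / (1 - p)) ^ x
  dratio n := binom N n * (p / (1 - p)) ^ n
  d0sq := (1 - p) ^ N

/-- Hahn. With `s = a + b - 1`, the factor `(2n+s) / (n+s)_{N+1}` of `d_n²` is written as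
`1 / (quot s n * (n+s+1)_N)`. -/
def hahn (N : ℕ) (a b : ℝ) : Data where
  N := N
  B x := (x + a) * (N - x)
  D x := x * (b + N - x)
  E n := n * (n + a + b - 1)
  eta x := x
  P n x := hyp [-n, n + a + b - 1, -x] [a, -N] 1 n
  phi0sq x := binom N x * (poch a x * poch b (N - x) / poch b N)
  dratio n := binom N n * (poch a n * poch (a + b) N /
    (poch b n * (quot (a + b - 1) n * poch (n + a + b) N)))
  d0sq := poch b N / poch (a + b) N

/-- Dual Hahn. With `s = a + b - 1`, the factor `(x+s) / (2x+s)` of `B(x)` is `quot s x`, and the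
factor `(2x+s) / (x+s)_{N+1}` of `φ₀(x)²` is written as `1 / (quot s x * (x+s+1)_N)`. -/
def dualHahn (N : ℕ) (a b : ℝ) : Data where
  N := N
  B x := quot (a + b - 1) x * ((x + a) * (N - x) / (2 * x + a + b))
  D x := x * (x + b - 1) * (x + a + b + N - 1) / ((2 * x - 2 + a + b) * (2 * x - 1 + a + b))
  E n := n
  eta x := x * (x + a + b - 1)
  P n x := hyp [-n, x + a + b - 1, -x] [a, -N] 1 n
  phi0sq x := binom N x * (poch a x * poch (a + b) N /
    (poch b x * (quot (a + b - 1) x * poch (x + a + b) N)))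
  dratio n := binom N n * (poch a n * poch b (N - n) / poch b N)
  d0sq := poch b N / poch (a + b) N

/-- Racah, with `c = -N` and `d' = a + b + c - d - 1`. The factor
`(d')_n (2n+d') / d'` of `d_n²` is written as `(d'+1)_n / quot d' n`. -/
def racah (N : ℕ) (a b d : ℝ) : Data :=
  let c : ℝ := -N
  let d' : ℝ := a + b + c - d - 1
  { N := N
    B := fun x => -((x + a) * (x + b) * (x + c) * (x + d) / ((2 * x + d) * (2 * x + 1 + d)))
    D := fun x =>
      -((x + d - a) * (x + d - b) * (x + d - c) * x / ((2 * x - 1 + d) * (2 * x + d)))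
    E := fun n => n * (n + d')
    eta := fun x => x * (x + d)
    P := fun n x => hyp [-n, n + d', -x, x + d] [a, b, c] 1 n
    phi0sq := fun x => poch a x * poch b x * poch c x * poch d x /
      (poch (1 + d - a) x * poch (1 + d - b) x * poch (1 + d - c) x * poch 1 x) *
      ((2 * x + d) / d)
    dratio := fun n => poch a n * poch b n * poch c n * (poch (d' + 1) n / quot d' n) /
      (poch (1 + d' - a) n * poch (1 + d' - b) n * poch (1 + d' - c) n * poch 1 n)
    d0sq := (-1) ^ N * (poch (1 + d - a) N * poch (1 + d - b) N * poch (1 + d - c) N) /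
      (poch (d' + 1) N * poch (d + 1) (2 * N)) }

/-- Affine `q`-Krawtchouk. -/
def affineQKrawtchouk (N : ℕ) (q p : ℝ) : Data where
  N := N
  B x := (q ^ ((x : ℤ) - N) - 1) * (1 - p * q ^ (x + 1))
  D x := p * q ^ ((x : ℤ) - N) * (1 - q ^ x)
  E n := q ^ (-(n : ℤ)) - 1
  eta x := q ^ (-(x : ℤ)) - 1
  P n x := qhyp [q ^ (-(n : ℤ)), q ^ (-(x : ℤ)), 0] [p * q, q ^ (-(N : ℤ))] q q n
  phi0sq x := qbinom q N x * (qpoch (p * q) q x / (p * q) ^ x)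
  dratio n := qbinom q N n * (qpoch (p * q) q n / (p * q) ^ n)
  d0sq := (p * q) ^ N

/-- `q`-Krawtchouk. -/
def qKrawtchouk (N : ℕ) (q p : ℝ) : Data where
  N := N
  B x := q ^ ((x : ℤ) - N) - 1
  D x := p * (1 - q ^ x)
  E n := (q ^ (-(n : ℤ)) - 1) * (1 + p * q ^ n)
  eta x := q ^ (-(x : ℤ)) - 1
  P n x := qhyp [q ^ (-(n : ℤ)), q ^ (-(x : ℤ)), -p * q ^ n] [q ^ (-(N : ℤ)), 0] q q n
  phi0sq x := qbinom q N x * (p ^ (-(x : ℤ)) * q ^ ((x : ℤ) * (x - 1) / 2 - x * N))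
  dratio n := qbinom q N n *
    (qpoch (-p) q n / (qpoch (-p * q ^ (N + 1)) q n * p ^ n * q ^ (n * (n + 1) / 2))) *
    ((1 + p * q ^ (2 * n)) / (1 + p))
  d0sq := p ^ N * q ^ (N * (N + 1) / 2) / qpoch (-p * q) q N

/-- Quantum `q`-Krawtchouk. -/
def quantumQKrawtchouk (N : ℕ) (q p : ℝ) : Data where
  N := N
  B x := p⁻¹ * q ^ x * (q ^ ((x : ℤ) - N) - 1)
  D x := (1 - q ^ x) * (1 - p⁻¹ * q ^ ((x : ℤ) - N - 1))
  E n := 1 - q ^ n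
  eta x := q ^ (-(x : ℤ)) - 1
  P n x := qhyp [q ^ (-(n : ℤ)), q ^ (-(x : ℤ))] [q ^ (-(N : ℤ))] q (p * q ^ (n + 1)) n
  phi0sq x := qbinom q N x *
    (p ^ (-(x : ℤ)) * q ^ ((x : ℤ) * (x - 1 - N)) / qpoch (p⁻¹ * q ^ (-(N : ℤ))) q x)
  dratio n := qbinom q N n *
    (p ^ (-(n : ℤ)) * q ^ (-(N : ℤ) * n) / qpoch (p⁻¹ * q ^ (-(n : ℤ))) q n)
  d0sq := qpoch (p⁻¹ * q ^ (-(N : ℤ))) q N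

/-- `q`-Hahn. With `s = a b q⁻¹`, the factor `(s;q)_n (1 - s q^{2n}) / (1 - s)` of `d_n²` is
written as `(s q;q)_n / qquot s q n`. -/
def qHahn (N : ℕ) (q a b : ℝ) : Data where
  N := N
  B x := (1 - a * q ^ x) * (q ^ ((x : ℤ) - N) - 1)
  D x := a * q⁻¹ * (1 - q ^ x) * (q ^ ((x : ℤ) - N) - b)
  E n := (q ^ (-(n : ℤ)) - 1) * (1 - a * b * q ^ ((n : ℤ) - 1))
  eta x := q ^ (-(x : ℤ)) - 1
  P n x := qhyp [q ^ (-(n : ℤ)), a * b * q ^ ((n : ℤ) - 1), q ^ (-(x : ℤ))]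
    [a, q ^ (-(N : ℤ))] q q n
  phi0sq x := qbinom q N x * (qpoch a q x * qpoch b q (N - x) / (qpoch b q N * a ^ x))
  dratio n := qbinom q N n *
    (qpoch a q n * (qpoch (a * b) q n / qquot (a * b * q⁻¹) q n) /
      (qpoch (a * b * q ^ N) q n * qpoch b q n * a ^ n))
  d0sq := qpoch b q N * a ^ N / qpoch (a * b) q N

/-- Dual `q`-Hahn. With `s = a b q⁻¹`, the factor `(1 - s q^x) / (1 - s q^{2x})` of `B(x)` is
`qquot s q x`, and the factor `(s;q)_x (1 - s q^{2x}) / (1 - s)` of `φ₀(x)²` is written as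
`(s q;q)_x / qquot s q x`. -/
def dualQHahn (N : ℕ) (q a b : ℝ) : Data where
  N := N
  B x := qquot (a * b * q⁻¹) q x *
    ((q ^ ((x : ℤ) - N) - 1) * (1 - a * q ^ x) / (1 - a * b * q ^ (2 * x)))
  D x := a * q ^ ((x : ℤ) - N - 1) *
    ((1 - q ^ x) * (1 - a * b * q ^ ((x : ℤ) + N - 1)) * (1 - b * q ^ ((x : ℤ) - 1)) /
      ((1 - a * b * q ^ (2 * (x : ℤ) - 2)) * (1 - a * b * q ^ (2 * (x : ℤ) - 1))))
  E n := q ^ (-(n : ℤ)) - 1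
  eta x := (q ^ (-(x : ℤ)) - 1) * (1 - a * b * q ^ ((x : ℤ) - 1))
  P n x := qhyp [q ^ (-(n : ℤ)), a * b * q ^ ((x : ℤ) - 1), q ^ (-(x : ℤ))]
    [a, q ^ (-(N : ℤ))] q q n
  phi0sq x := qbinom q N x *
    (qpoch a q x * (qpoch (a * b) q x / qquot (a * b * q⁻¹) q x) /
      (qpoch (a * b * q ^ N) q x * qpoch b q x * a ^ x))
  dratio n := qbinom q N n * (qpoch a q n * qpoch b q (N - n) / (qpoch b q N * a ^ n))
  d0sq := qpoch b q N * a ^ N / qpoch (a * b) q N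

/-- `q`-Racah, with `c = q^{-N}` and `d' = a b c d⁻¹ q⁻¹`. The factor
`(d';q)_n (1 - d' q^{2n}) / (1 - d')` of `d_n²` is written as `(d' q;q)_n / qquot d' q n`. -/
def qRacah (N : ℕ) (q a b d : ℝ) : Data :=
  let c : ℝ := q ^ (-(N : ℤ))
  let d' : ℝ := a * b * c * d⁻¹ * q⁻¹
  { N := N
    B := fun x => -((1 - a * q ^ x) * (1 - b * q ^ x) * (1 - c * q ^ x) * (1 - d * q ^ x) /
      ((1 - d * q ^ (2 * x)) * (1 - d * q ^ (2 * x + 1))))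
    D := fun x => -d' *
      ((1 - a⁻¹ * d * q ^ x) * (1 - b⁻¹ * d * q ^ x) * (1 - c⁻¹ * d * q ^ x) * (1 - q ^ x) /
        ((1 - d * q ^ (2 * (x : ℤ) - 1)) * (1 - d * q ^ (2 * x))))
    E := fun n => (q ^ (-(n : ℤ)) - 1) * (1 - d' * q ^ n)
    eta := fun x => (q ^ (-(x : ℤ)) - 1) * (1 - d * q ^ x)
    P := fun n x => qhyp [q ^ (-(n : ℤ)), d' * q ^ n, q ^ (-(x : ℤ)), d * q ^ x] [a, b, c] q q n
    phi0sq := fun x => qpoch a q x * qpoch b q x * qpoch c q x * qpoch d q x /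
      (qpoch (a⁻¹ * d * q) q x * qpoch (b⁻¹ * d * q) q x * qpoch (c⁻¹ * d * q) q x *
        qpoch q q x * d' ^ x) * ((1 - d * q ^ (2 * x)) / (1 - d))
    dratio := fun n => qpoch a q n * qpoch b q n * qpoch c q n *
      (qpoch (d' * q) q n / qquot d' q n) /
      (qpoch (a⁻¹ * d' * q) q n * qpoch (b⁻¹ * d' * q) q n * qpoch (c⁻¹ * d' * q) q n *
        qpoch q q n * d ^ n)
    d0sq := (-1) ^ N *
      (qpoch (a⁻¹ * d * q) q N * qpoch (b⁻¹ * d * q) q N * qpoch (c⁻¹ * d * q) q N) *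
      d' ^ N * q ^ (N * (N + 1) / 2) / (qpoch (d' * q) q N * qpoch (d * q) q (2 * N)) }

/-- Al-Salam–Carlitz II, on the semi-infinite lattice. -/
def alSalamCarlitzII (q a : ℝ) : Data where
  N := ⊤
  B x := a * q ^ (2 * x + 1)
  D x := (1 - q ^ x) * (1 - a * q ^ x)
  E n := 1 - q ^ n
  eta x := q ^ (-(x : ℤ)) - 1
  P n x := qhyp [q ^ (-(n : ℤ)), q ^ (-(x : ℤ))] [] q (a⁻¹ * q ^ n) n
  phi0sq x := a ^ x * q ^ (x ^ 2) / (qpoch q q x * qpoch (a * q) q x)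
  dratio n := (a * q) ^ n / qpoch q q n
  d0sq := qpochInf (a * q) q

/-- The list of the examples, with the ranges of their parameters. -/
inductive Listed : Data → Prop
  | krawtchouk (N : ℕ) (p : ℝ) (hp : 0 < p ∧ p < 1) : Listed (BD.krawtchouk N p)
  | hahn (N : ℕ) (a b : ℝ) (ha : 0 < a) (hb : 0 < b) : Listed (BD.hahn N a b)
  | dualHahn (N : ℕ) (a b : ℝ) (ha : 0 < a) (hb : 0 < b) : Listed (BD.dualHahn N a b)
  | racah (N : ℕ) (a b d : ℝ) (hab : b ≤ a) (hd : 0 < d) (ha : N + d < a)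
      (hb : 0 < b ∧ b < 1 + d) : Listed (BD.racah N a b d)
  | affineQKrawtchouk (N : ℕ) (q p : ℝ) (hq : 0 < q ∧ q < 1) (hp : 0 < p ∧ p < q⁻¹) :
      Listed (BD.affineQKrawtchouk N q p)
  | qKrawtchouk (N : ℕ) (q p : ℝ) (hq : 0 < q ∧ q < 1) (hp : 0 < p) :
      Listed (BD.qKrawtchouk N q p)
  | quantumQKrawtchouk (N : ℕ) (q p : ℝ) (hq : 0 < q ∧ q < 1) (hp : q ^ (-(N : ℤ)) < p) :
      Listed (BD.quantumQKrawtchouk N q p)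
  | qHahn (N : ℕ) (q a b : ℝ) (hq : 0 < q ∧ q < 1) (ha : 0 < a ∧ a < 1) (hb : 0 < b ∧ b < 1) :
      Listed (BD.qHahn N q a b)
  | dualQHahn (N : ℕ) (q a b : ℝ) (hq : 0 < q ∧ q < 1) (ha : 0 < a ∧ a < 1)
      (hb : 0 < b ∧ b < 1) : Listed (BD.dualQHahn N q a b)
  | qRacah (N : ℕ) (q a b d : ℝ) (hq : 0 < q ∧ q < 1) (hab : a ≤ b) (hd : 0 < d ∧ d < 1)
      (ha : 0 < a ∧ a < q ^ N * d) (hb : q * d < b ∧ b < 1) : Listed (BD.qRacah N q a b d)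
  | alSalamCarlitzII (q a : ℝ) (hq : 0 < q ∧ q < 1) (ha : 0 < a ∧ a < q⁻¹) :
      Listed (BD.alSalamCarlitzII q a)

end BD

end

/-!
All eleven families have a common algebraic form. The polynomials are

`P_n(x) = ∑_k ∏_{i<k} (E(n) - E(i)) (η(x) - η(i)) / φ_i`,

which is symmetric under the exchange of `(n, E)` and `(x, η)`, and on the Newton basis
`∏_{i<k} (η(x) - η(i))` the difference operator is bidiagonal, with the diagonal entries `E(k)` and
the off-diagonal entries `φ_k` (`IsLadder`). The difference equation is a formal consequence
(`IsLadder.diffOp_splitPoly`). By the symmetry the three term recurrence relation in `n` is again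
such a difference equation, with the two spectra exchanged and with other rates, those of the dual
family. Two computations provide all the bidiagonal operators and their duals: `isLadder_quad` for
spectra quadratic in the index, and `isLadder_q` for spectra of the form
`(q^{-x} - 1) (h₀ - h₁ q^x)`.

Orthogonality is summation by parts (`sum_diffOp_sub`). The three term recurrence relation gives
the quotients of the squared norms (`norm_recurrence`), and on a finite lattice the moments with
respect to the Newton basis satisfy a two term recurrence relation, which gives the total mass as a
product (`IsLadder.total_mass`). This reduces a finite family to elementary identities for its
rates and weights (`Data.isSolved_of_ladder`). For the Al-Salam–Carlitz II polynomials completeness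
is at stake: the columns of the matrix `φ̂_n(x)` have to be orthogonal as well. The dual rates are
unbounded, but the boundary term in the summation by parts over `n` still vanishes, as the
polynomials are Lipschitz functions of `q^n` (`asc_dual_orthogonal`). The columns are normalised by
Euler's product (`hasSum_pow_div_qpoch`); then so are the rows, since an infinite matrix with
orthogonal rows of norm `α` and orthogonal columns of norm `β` has `α = β` (`eq_of_hasSum_mul`).

Everything else follows for every birth and death process whose matrix `φ̂_n(x)` has orthonormal
rows and columns (`Data.IsDiagonalized`). Square summable functions are then the sums of their
expansions (`hasSum_expansion`), so that the eigensystem is complete, and those of `H`, `L_BD` and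
`L` arise from that of `H̃` by conjugation with a diagonal matrix (`IsCompleteEigensystem.conj`). In
discrete time the `ℓ¹` bound for a stochastic matrix, and the positive probability to stay in a
point, give `-1 < κ(n)` (`neg_one_lt_kappa`), and the limit is dominated convergence. In continuous
time the Poisson mixture of a discrete process is a solution, the solution is unique by the Picard
iteration of an `ℓ¹` bound (`IsStochastic.eq_zero_of_hasDerivWithinAt`), and its limit is that of
the discrete process, as Borel summation is regular (`tendsto_poissonMean`).
-/

noncomputable section

namespace BD

/-! ### Polynomials in split form -/

/-- The Newton basis `∏_{i<k} (η(x) - η(i))` of the polynomials in `η(x)`. -/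
def newton (η : ℕ → ℝ) (k x : ℕ) : ℝ := ∏ i ∈ Finset.range k, (η x - η i)

/-- The operator `f ↦ B(x) (f(x) - f(x+1)) + D(x) (f(x) - f(x-1))` on functions on `ℕ`. -/
def diffOp (B D : ℕ → ℝ) (f : ℕ → ℝ) (x : ℕ) : ℝ :=
  B x * (f x - f (x + 1)) + D x * (f x - f (x - 1))

/-- The difference operator with coefficients `B`, `D` acts on the Newton basis of `η` as a
bidiagonal matrix with diagonal `E` and off-diagonal `φ`. -/
structure IsLadder (B D η E φ : ℕ → ℝ) : Prop where
  death_zero : D 0 = 0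
  ev_zero : E 0 = 0
  ladder : ∀ k x, diffOp B D (newton η (k + 1)) x =
    E (k + 1) * newton η (k + 1) x + φ k * newton η k x

/-- The `n`-th polynomial in split form,
`∑_k ∏_{i<k} (E(n) - E(i)) (η(x) - η(i)) / φ_i`. It is symmetric under the exchange of
`(n, E)` and `(x, η)`. -/
def splitPoly (η E φ : ℕ → ℝ) (n x : ℕ) : ℝ :=
  ∑ k ∈ Finset.range (n + 1), newton E k n / (∏ j ∈ Finset.range k, φ j) * newton η k x

@[simp] lemma newton_zero (η : ℕ → ℝ) (x : ℕ) : newton η 0 x = 1 := by simp [newton]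

lemma newton_succ (η : ℕ → ℝ) (k x : ℕ) :
    newton η (k + 1) x = newton η k x * (η x - η k) := by
  simp [newton, Finset.prod_range_succ]

lemma newton_eq_zero (η : ℕ → ℝ) {k x : ℕ} (h : x < k) : newton η k x = 0 :=
  Finset.prod_eq_zero (Finset.mem_range.2 h) (sub_self _)

lemma newton_ne_zero {η : ℕ → ℝ} (hη : StrictMono η) {k x : ℕ} (h : k ≤ x) :
    newton η k x ≠ 0 := by
  refine Finset.prod_ne_zero_iff.2 fun i hi => sub_ne_zero.2 fun he => ?_
  have := hη.injective he
  have := Finset.mem_range.1 hi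
  omega

lemma splitPoly_eq_sum (η E φ : ℕ → ℝ) {n x M : ℕ} (h : min n x ≤ M) :
    splitPoly η E φ n x = ∑ k ∈ Finset.range (M + 1),
      newton E k n / (∏ j ∈ Finset.range k, φ j) * newton η k x := by
  have key : ∀ M' M'', min n x ≤ M' → M' ≤ M'' → ∑ k ∈ Finset.range (M' + 1),
      newton E k n / (∏ j ∈ Finset.range k, φ j) * newton η k x =
      ∑ k ∈ Finset.range (M'' + 1),
      newton E k n / (∏ j ∈ Finset.range k, φ j) * newton η k x := by
    intro M' M'' h1 h2
    refine Finset.sum_subset (Finset.range_mono (by omega)) fun k _ hk => ?_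
    rw [Finset.mem_range, not_lt] at hk
    rcases min_le_iff.1 h1 with h | h
    · rw [newton_eq_zero E (by omega)]; simp
    · rw [newton_eq_zero η (by omega)]; simp
  rw [splitPoly, key n (max n M) (min_le_left _ _) (le_max_left _ _),
    key M (max n M) h (le_max_right _ _)]

lemma splitPoly_symm (η E φ : ℕ → ℝ) (n x : ℕ) :
    splitPoly η E φ n x = splitPoly E η φ x n := by
  rw [splitPoly_eq_sum η E φ (M := n) (min_le_left _ _),
    splitPoly_eq_sum E η φ (M := n) (min_le_right _ _)]
  exact Finset.sum_congr rfl fun k _ => by ring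

lemma splitPoly_at_zero (η E φ : ℕ → ℝ) (n : ℕ) : splitPoly η E φ n 0 = 1 := by
  rw [splitPoly_eq_sum η E φ (M := 0) (min_le_right _ _)]
  simp

/-- A series whose consecutive terms have the right quotients is the polynomial in split form. -/
lemma sum_eq_splitPoly {η E φ t : ℕ → ℝ} {n x : ℕ} (h0 : t 0 = 1)
    (hφ : ∀ k < n, φ k ≠ 0)
    (ht : ∀ k < n, t (k + 1) * φ k = t k * ((E n - E k) * (η x - η k))) :
    ∑ k ∈ Finset.range (n + 1), t k = splitPoly η E φ n x := by
  refine Finset.sum_congr rfl fun k hk => ?_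
  replace hk : k ≤ n := Nat.lt_succ_iff.1 (Finset.mem_range.1 hk)
  induction k with
  | zero => simp [h0]
  | succ k ih =>
    have hp : (∏ j ∈ Finset.range k, φ j) ≠ 0 :=
      Finset.prod_ne_zero_iff.2 fun j hj => hφ j (by have := Finset.mem_range.1 hj; omega)
    have h1 := ht k (by omega)
    have h2 := hφ k (by omega)
    rw [ih (by omega)] at h1
    rw [newton_succ, newton_succ, Finset.prod_range_succ]
    rw [← mul_left_inj' h2, h1]
    field_simp

/-- Polynomials in split form are eigenfunctions of the difference operator. -/
lemma IsLadder.diffOp_splitPoly {B D η E φ : ℕ → ℝ} (h : IsLadder B D η E φ) {n : ℕ}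
    (hφ : ∀ k < n, φ k ≠ 0) (x : ℕ) :
    diffOp B D (splitPoly η E φ n) x = E n * splitPoly η E φ n x := by
  set c : ℕ → ℝ := fun k => newton E k n / (∏ j ∈ Finset.range k, φ j) with hc
  have h1 : diffOp B D (splitPoly η E φ n) x =
      ∑ k ∈ Finset.range (n + 1), c k * diffOp B D (newton η k) x := by
    simp only [diffOp, splitPoly, ← Finset.sum_sub_distrib, Finset.mul_sum,
      ← Finset.sum_add_distrib]
    exact Finset.sum_congr rfl fun k _ => by ring
  have h2 : diffOp B D (newton η 0) x = 0 := by simp [diffOp]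
  have h3 : ∀ k ∈ Finset.range n, c (k + 1) * diffOp B D (newton η (k + 1)) x =
      c (k + 1) * E (k + 1) * newton η (k + 1) x + c k * (E n - E k) * newton η k x := by
    intro k hk
    have hk := Finset.mem_range.1 hk
    have hp : (∏ j ∈ Finset.range k, φ j) ≠ 0 :=
      Finset.prod_ne_zero_iff.2 fun j hj => hφ j (by have := Finset.mem_range.1 hj; omega)
    have h4 : c (k + 1) * φ k = c k * (E n - E k) := by
      simp only [hc, newton_succ, Finset.prod_range_succ]
      have := hφ k hk
      field_simp
    rw [h.ladder, ← h4]
    ring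
  have h4 : ∑ k ∈ Finset.range n, c (k + 1) * E (k + 1) * newton η (k + 1) x =
      ∑ k ∈ Finset.range (n + 1), c k * E k * newton η k x := by
    rw [Finset.sum_range_succ']
    simp [h.ev_zero]
  have h5 : ∑ k ∈ Finset.range n, c k * (E n - E k) * newton η k x =
      ∑ k ∈ Finset.range (n + 1), c k * (E n - E k) * newton η k x := by
    rw [Finset.sum_range_succ]
    simp
  rw [h1, Finset.sum_range_succ', h2, mul_zero, add_zero, Finset.sum_congr rfl h3,
    Finset.sum_add_distrib, h4, h5, ← Finset.sum_add_distrib, splitPoly, Finset.mul_sum]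
  exact Finset.sum_congr rfl fun k _ => by ring

lemma exists_polynomial_splitPoly {η E φ : ℕ → ℝ} (hE : StrictMono E) {n : ℕ}
    (hφ : ∀ k < n, φ k ≠ 0) : ∃ p : Polynomial ℝ, p.degree = (n : WithBot ℕ) ∧
      ∀ x, splitPoly η E φ n x = p.eval (η x) := by
  set c : ℕ → ℝ := fun k => newton E k n / (∏ j ∈ Finset.range k, φ j) with hc
  set r : ℕ → Polynomial ℝ := fun k => ∏ i ∈ Finset.range k, (Polynomial.X - Polynomial.C (η i))
    with hr
  have hdeg : ∀ k, (r k).degree = (k : WithBot ℕ) := by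
    intro k
    rw [hr, Polynomial.degree_prod]
    simp
  have hcn : c n ≠ 0 := div_ne_zero (newton_ne_zero hE le_rfl)
    (Finset.prod_ne_zero_iff.2 fun j hj => hφ j (Finset.mem_range.1 hj))
  refine ⟨∑ k ∈ Finset.range (n + 1), Polynomial.C (c k) * r k, ?_, fun x => ?_⟩
  · have hd : (Polynomial.C (c n) * r n).degree = (n : WithBot ℕ) := by
      rw [Polynomial.degree_C_mul hcn, hdeg]
    rw [Finset.sum_range_succ, Polynomial.degree_add_eq_right_of_degree_lt, hd]
    rw [hd]
    refine (Polynomial.degree_sum_le _ _).trans_lt ?_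
    rw [Finset.sup_lt_iff (by exact WithBot.bot_lt_coe n)]
    intro k hk
    refine (Polynomial.degree_mul_le _ _).trans_lt ?_
    rw [hdeg]
    refine (add_le_add_left Polynomial.degree_C_le _).trans_lt ?_
    rw [zero_add]
    exact_mod_cast Finset.mem_range.1 hk
  · simp only [splitPoly, Polynomial.eval_finsetSum, Polynomial.eval_mul, Polynomial.eval_C, hr,
      Polynomial.eval_prod, Polynomial.eval_sub, Polynomial.eval_X]
    rfl

lemma hasSum_of_eq {ι : Type*} {f g : ι → ℝ} {a b : ℝ} (h : HasSum f a) (hf : ∀ i, g i = f i)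
    (hb : b = a) : HasSum g b := by
  rw [hb, funext hf]
  exact h

/-! ### Orthogonality, norms and total mass -/

/-- Lagrange's identity (summation by parts) for the difference operator with the weight function
that makes it symmetric. -/
lemma sum_diffOp_sub {B D w : ℕ → ℝ} (hD : D 0 = 0) {M : ℕ}
    (hw : ∀ x < M, w (x + 1) * D (x + 1) = w x * B x) (f g : ℕ → ℝ) :
    ∑ x ∈ Finset.range (M + 1), w x * (diffOp B D f x * g x - f x * diffOp B D g x) =
      w M * B M * (f M * g (M + 1) - f (M + 1) * g M) := by
  induction M with
  | zero => simp [diffOp, hD]; ring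
  | succ M ih =>
    rw [Finset.sum_range_succ, ih fun x hx => hw x (by omega)]
    have := hw M (by omega)
    simp only [diffOp, Nat.add_sub_cancel]
    linear_combination (f (M + 1) * g M - f M * g (M + 1)) * this

/-- The three term recurrence relation determines the quotients of the squared norms. -/
lemma norm_recurrence {ι : Type*} {w t : ι → ℝ} {p : ℕ → ι → ℝ} {A C : ℕ → ℝ} {n : ℕ}
    {h h' : ℝ}
    (hr : ∀ i, A n * (p n i - p (n + 1) i) + C n * (p n i - p (n - 1) i) = t i * p n i)
    (hr' : ∀ i, A (n + 1) * (p (n + 1) i - p (n + 2) i) + C (n + 1) * (p (n + 1) i - p n i) =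
      t i * p (n + 1) i)
    (hn : HasSum (fun i => w i * p n i * p n i) h)
    (hn' : HasSum (fun i => w i * p (n + 1) i * p (n + 1) i) h')
    (h1 : HasSum (fun i => w i * p n i * p (n + 1) i) 0)
    (h2 : HasSum (fun i => w i * p (n - 1) i * p (n + 1) i) 0)
    (h3 : A (n + 1) = 0 ∨ HasSum (fun i => w i * p n i * p (n + 2) i) 0) :
    A n * h' = C (n + 1) * h := by
  have e1 : HasSum (fun i => w i * (t i * p n i) * p (n + 1) i)
      (A n * (0 - h') + C n * (0 - 0)) := by
    refine hasSum_of_eq (((h1.sub hn').mul_left (A n)).add ((h1.sub h2).mul_left (C n)))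
      (fun i => ?_) rfl
    rw [← hr i]; ring
  have e2 : HasSum (fun i => w i * (t i * p n i) * p (n + 1) i) (C (n + 1) * (0 - h)) := by
    rcases h3 with h3 | h3
    · refine hasSum_of_eq ((h1.sub hn).mul_left (C (n + 1))) (fun i => ?_) rfl
      have := hr' i
      rw [h3] at this
      linear_combination -(w i * p n i) * this
    · refine hasSum_of_eq (((h1.sub h3).mul_left (A (n + 1))).add
        ((h1.sub hn).mul_left (C (n + 1)))) (fun i => ?_) (by ring)
      linear_combination -(w i * p n i) * hr' i
  have := e1.unique e2
  linarith

lemma IsLadder.birth_mul {B D η E φ : ℕ → ℝ} (h : IsLadder B D η E φ) (k : ℕ) :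
    B k * newton η (k + 1) (k + 1) = -(φ k * newton η k k) := by
  have := h.ladder k k
  rw [diffOp, newton_eq_zero η (Nat.lt_succ_self k), newton_eq_zero η (k := k + 1) (x := k - 1)
    (by omega)] at this
  linarith

/-- The off-diagonal entries do not vanish where the birth rates do not. -/
lemma IsLadder.ne_zero {B D η E φ : ℕ → ℝ} (h : IsLadder B D η E φ) (hη : StrictMono η) {k : ℕ}
    (hB : B k ≠ 0) : φ k ≠ 0 := by
  intro h0
  have := h.birth_mul k
  rw [h0, zero_mul, neg_zero] at this
  exact mul_ne_zero hB (newton_ne_zero hη le_rfl) this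

/-- The total mass of the stationary measure of a finite lattice: the moments with respect to the
Newton basis satisfy a two term recurrence, and the last one has one term only. -/
lemma IsLadder.total_mass {B D η E φ w : ℕ → ℝ} (h : IsLadder B D η E φ) {N : ℕ}
    (hw0 : w 0 = 1) (hw : ∀ x < N, w (x + 1) * D (x + 1) = w x * B x) (hBN : B N = 0)
    (hφ : ∀ k < N, φ k ≠ 0) :
    (∑ x ∈ Finset.range (N + 1), w x) * ∏ k ∈ Finset.range N, D (k + 1) =
      ∏ k ∈ Finset.range N, E (k + 1) := by
  set μ : ℕ → ℝ := fun k => ∑ x ∈ Finset.range (N + 1), w x * newton η k x with hμ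
  have h1 : ∀ k, E (k + 1) * μ (k + 1) = -(φ k * μ k) := by
    intro k
    have := sum_diffOp_sub h.death_zero hw (newton η (k + 1)) fun _ => 1
    simp only [h.ladder, hBN] at this
    simp only [hμ, Finset.mul_sum, ← Finset.sum_neg_distrib]
    rw [← sub_eq_zero, ← Finset.sum_sub_distrib]
    rw [mul_zero, zero_mul] at this
    rw [← this]
    refine Finset.sum_congr rfl fun x _ => ?_
    simp [diffOp]
    ring
  have h2 : ∀ k, μ 0 * ∏ j ∈ Finset.range k, -φ j = μ k * ∏ j ∈ Finset.range k, E (j + 1) := by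
    intro k
    induction k with
    | zero => simp
    | succ k ih =>
      rw [Finset.prod_range_succ, Finset.prod_range_succ, ← mul_assoc, ih]
      linear_combination -(∏ j ∈ Finset.range k, E (j + 1)) * h1 k
  have h3 : μ N = w N * newton η N N := by
    simp only [hμ]
    rw [Finset.sum_range_succ, Finset.sum_eq_zero, zero_add]
    intro x hx
    rw [newton_eq_zero η (Finset.mem_range.1 hx), mul_zero]
  have h4 : ∀ k ≤ N, w k * newton η k k * ∏ j ∈ Finset.range k, D (j + 1) =
      ∏ j ∈ Finset.range k, -φ j := by
    intro k hk
    induction k with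
    | zero => simp [hw0]
    | succ k ih =>
      rw [Finset.prod_range_succ, Finset.prod_range_succ, ← ih (by omega)]
      linear_combination (newton η (k + 1) (k + 1) * ∏ j ∈ Finset.range k, D (j + 1)) *
        hw k (by omega) + (w k * ∏ j ∈ Finset.range k, D (j + 1)) * h.birth_mul k
  have h5 : (∏ j ∈ Finset.range N, -φ j) ≠ 0 :=
    Finset.prod_ne_zero_iff.2 fun j hj => neg_ne_zero.2 (hφ j (Finset.mem_range.1 hj))
  have h6 : μ 0 = ∑ x ∈ Finset.range (N + 1), w x := by simp [hμ]
  rw [← h6, ← mul_left_inj' h5]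
  have := h2 N
  rw [h3] at this
  linear_combination (∏ k ∈ Finset.range N, D (k + 1)) * this +
    (∏ k ∈ Finset.range N, E (k + 1)) * h4 N le_rfl

/-! ### Spectra quadratic in the index -/

/-- The sequence `x (h₀ x + h₁)`. -/
def quadSpec (h₀ h₁ : ℝ) (x : ℕ) : ℝ := x * (h₀ * x + h₁)

/-- The off-diagonal entries `(k+1) g(k)`, with a cubic polynomial `g` of leading terms prescribed
by the two spectra and with two free parameters `u`, `v`. -/
def quadOff (h₀ h₁ e₀ e₁ u v : ℝ) (k : ℕ) : ℝ :=
  (k + 1) * (e₀ * h₀ * k ^ 3 + (e₀ * h₁ + e₀ * h₀ + e₁ * h₀) * k ^ 2 + u * k + v)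

lemma quadOff_swap (h₀ h₁ e₀ e₁ u v : ℝ) : quadOff h₀ h₁ e₀ e₁ u v = quadOff e₀ e₁ h₀ h₁ u v := by
  funext k
  simp only [quadOff]
  ring

lemma strictMono_quadSpec {h₀ h₁ : ℝ} (h : ∀ j : ℕ, 1 ≤ j → 0 < h₀ * j + h₁) :
    StrictMono (quadSpec h₀ h₁) := by
  refine strictMono_nat_of_lt_succ fun x => ?_
  have := h (2 * x + 1) (by omega)
  simp only [quadSpec]
  push_cast at this ⊢
  linarith

section

variable (h₀ h₁ : ℝ) (k x : ℕ)

lemma newton_quad_succ : newton (quadSpec h₀ h₁) (k + 1) x =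
    newton (quadSpec h₀ h₁) k x * ((x - k) * (h₀ * (x + k) + h₁)) := by
  rw [newton_succ]
  simp only [quadSpec]
  ring

lemma newton_quad_up : (h₀ * x + h₁) * newton (quadSpec h₀ h₁) (k + 1) (x + 1) =
    newton (quadSpec h₀ h₁) k x *
      ((x + 1) * (h₀ * (x + k) + h₁) * (h₀ * (x + k + 1) + h₁)) := by
  induction k with
  | zero => simp [newton_succ, quadSpec]; ring
  | succ k ih =>
    rw [newton_succ, ← mul_assoc, ih, newton_succ]
    simp only [quadSpec]
    push_cast
    ring

lemma newton_quad_down : (x + 1) * newton (quadSpec h₀ h₁) (k + 1) x =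
    newton (quadSpec h₀ h₁) k (x + 1) * ((x + 1 - k) * (x - k) * (h₀ * x + h₁)) := by
  induction k with
  | zero => simp [newton_succ, quadSpec]; ring
  | succ k ih =>
    rw [newton_succ, ← mul_assoc, ih, newton_succ]
    simp only [quadSpec]
    push_cast
    ring

end

/-- The birth and death rates belonging to two quadratic spectra. The rates at `0` are treated
separately, as the general formula may be `0/0` there. The free parameters `u` and `v` are read off
from the birth rate. -/
theorem isLadder_quad {B D : ℕ → ℝ} {h₀ h₁ e₀ e₁ u v : ℝ}
    (hpos : ∀ j : ℕ, 1 ≤ j → 0 < h₀ * j + h₁) (hD0 : D 0 = 0) (hB0 : B 0 * (h₀ + h₁) = -v)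
    (hB : ∀ x : ℕ, 1 ≤ x → B x * ((2 * h₀ * x + h₁) * (2 * h₀ * x + h₀ + h₁)) =
      -((h₀ * x + h₁) *
        (e₀ * h₀ * x ^ 3 + (e₀ * h₁ + e₀ * h₀ + e₁ * h₀) * x ^ 2 + u * x + v)))
    (hD : ∀ x : ℕ, 1 ≤ x → D x * ((2 * h₀ * x + h₁) * (2 * h₀ * x + h₁ - h₀)) =
      x * (-e₀ * h₀ ^ 2 * x ^ 3 - 3 * e₀ * h₀ * h₁ * x ^ 2 - 3 * e₀ * h₁ ^ 2 * x +
        (e₀ * h₁ + e₀ * h₀ + e₁ * h₀) * (h₀ * x ^ 2 + 2 * h₁ * x) + e₀ * h₁ ^ 2 + e₁ * h₁ ^ 2 -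
        u * h₀ * x - u * h₁ + v * h₀)) :
    IsLadder B D (quadSpec h₀ h₁) (quadSpec e₀ e₁) (quadOff h₀ h₁ e₀ e₁ u v) where
  death_zero := hD0
  ev_zero := by simp [quadSpec]
  ladder k x := by
    rcases x with _ | x
    · rw [diffOp, hD0]
      rcases k with _ | k
      · simp [newton_succ, quadSpec, quadOff]
        linarith
      · rw [newton_eq_zero _ (k := k + 1 + 1) (x := 0) (by omega),
          newton_eq_zero _ (k := k + 1 + 1) (x := 0 + 1) (by omega),
          newton_eq_zero _ (k := k + 1) (x := 0) (by omega)]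
        simp
    · have d0 := hpos (2 * (x + 1)) (by omega)
      have d1 := hpos (2 * (x + 1) + 1) (by omega)
      have d2 := hpos (2 * (x + 1) - 1) (by omega)
      rw [Nat.cast_sub (by omega)] at d2
      have hB' := hB (x + 1) (by omega)
      have hD' := hD (x + 1) (by omega)
      have r2 := newton_quad_up h₀ h₁ k (x + 1)
      have r3 := newton_quad_down h₀ h₁ k x
      rw [diffOp, newton_quad_succ, Nat.add_sub_cancel]
      push_cast at *
      have hne : (2 * h₀ * (x + 1) + h₁) * (2 * h₀ * (x + 1) + h₀ + h₁) *
          (2 * h₀ * (x + 1) + h₁ - h₀) ≠ 0 := by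
        refine mul_ne_zero (mul_ne_zero ?_ ?_) ?_ <;> refine ne_of_gt ?_ <;> linarith
      rw [← mul_left_inj' hne]
      generalize newton (quadSpec h₀ h₁) k (x + 1) = n at *
      generalize newton (quadSpec h₀ h₁) (k + 1) (x + 1 + 1) = n2 at *
      generalize newton (quadSpec h₀ h₁) (k + 1) x = n3 at *
      simp only [quadSpec, quadOff]
      push_cast
      linear_combination
        (n * ((x + 1 - k) * (h₀ * (x + 1 + k) + h₁)) - n2) * (2 * h₀ * (x + 1) + h₁ - h₀) * hB' +
        (n * ((x + 1 - k) * (h₀ * (x + 1 + k) + h₁)) - n3) * (2 * h₀ * (x + 1) + h₀ + h₁) * hD' +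
        (e₀ * h₀ * (x + 1) ^ 3 + (e₀ * h₁ + e₀ * h₀ + e₁ * h₀) * (x + 1) ^ 2 + u * (x + 1) + v) *
          (2 * h₀ * (x + 1) + h₁ - h₀) * r2 -
        (-e₀ * h₀ ^ 2 * (x + 1) ^ 3 - 3 * e₀ * h₀ * h₁ * (x + 1) ^ 2 - 3 * e₀ * h₁ ^ 2 * (x + 1) +
          (e₀ * h₁ + e₀ * h₀ + e₁ * h₀) * (h₀ * (x + 1) ^ 2 + 2 * h₁ * (x + 1)) + e₀ * h₁ ^ 2 +
          e₁ * h₁ ^ 2 - u * h₀ * (x + 1) - u * h₁ + v * h₀) * (2 * h₀ * (x + 1) + h₀ + h₁) * r3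

/-! ### Spectra of `q`-quadratic type -/

/-- The sequence `(q^{-x} - 1) (h₀ - h₁ q^x)`. -/
def qSpec (q h₀ h₁ : ℝ) (x : ℕ) : ℝ := ((q ^ x)⁻¹ - 1) * (h₀ - h₁ * q ^ x)

/-- The off-diagonal entries `(1 - K) (q e₀ h₀ K⁻² + u K⁻¹ + v - e₁ h₁ K q⁻¹)`, `K = q^{k+1}`, with
two free parameters `u`, `v`. -/
def qOff (q h₀ h₁ e₀ e₁ u v : ℝ) (k : ℕ) : ℝ :=
  (1 - q * q ^ k) * (e₀ * h₀ / (q * (q ^ k) ^ 2) + u / (q * q ^ k) + v - e₁ * h₁ * q ^ k)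

lemma qOff_swap (q h₀ h₁ e₀ e₁ u v : ℝ) : qOff q h₀ h₁ e₀ e₁ u v = qOff q e₀ e₁ h₀ h₁ u v := by
  funext k
  simp only [qOff]
  ring

lemma strictMono_qSpec {q : ℝ} (hq : 0 < q) (hq1 : q < 1) {h₀ h₁ : ℝ}
    (h : ∀ j : ℕ, 1 ≤ j → 0 < h₀ - h₁ * q ^ j) : StrictMono (qSpec q h₀ h₁) := by
  refine strictMono_nat_of_lt_succ fun x => sub_pos.1 ?_
  have h1 := h (2 * x + 1) (by omega)
  have hX : 0 < q ^ x := pow_pos hq x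
  have : qSpec q h₀ h₁ (x + 1) - qSpec q h₀ h₁ x =
      (1 - q) * (h₀ - h₁ * q ^ (2 * x + 1)) / (q * q ^ x) := by
    simp only [qSpec, pow_succ, pow_mul']
    field_simp
    ring
  rw [this]
  have := sub_pos.2 hq1
  positivity

lemma newton_q_succ {q : ℝ} (hq : 0 < q) (h₀ h₁ : ℝ) (k x : ℕ) : newton (qSpec q h₀ h₁) (k + 1) x =
    newton (qSpec q h₀ h₁) k x *
      (((q ^ x)⁻¹ - (q ^ k)⁻¹) * (h₀ - h₁ * (q ^ x * q ^ k))) := by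
  have hX : 0 < q ^ x := pow_pos hq x
  have hK : 0 < q ^ k := pow_pos hq k
  rw [newton_succ]
  congr 1
  simp only [qSpec]
  field_simp
  ring

lemma newton_q_up {q : ℝ} (hq : 0 < q) (h₀ h₁ : ℝ) (k x : ℕ) :
    (h₀ - h₁ * q ^ x) * newton (qSpec q h₀ h₁) (k + 1) (x + 1) =
    newton (qSpec q h₀ h₁) k x * ((q * q ^ k)⁻¹ * ((q ^ x)⁻¹ - q) *
      (h₀ - h₁ * (q ^ x * q ^ k)) * (h₀ - h₁ * (q ^ x * q ^ k * q))) := by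
  have hX : 0 < q ^ x := pow_pos hq x
  induction k with
  | zero =>
    simp [newton_succ, qSpec, pow_succ]
    field_simp
  | succ k ih =>
    have hK : 0 < q ^ k := pow_pos hq k
    rw [newton_q_succ hq, ← mul_assoc, ih, newton_q_succ hq]
    simp only [pow_succ]
    field_simp

lemma newton_q_down {q : ℝ} (hq : 0 < q) (h₀ h₁ : ℝ) (k x : ℕ) :
    ((q * q ^ x)⁻¹ - 1) * newton (qSpec q h₀ h₁) (k + 1) x =
    newton (qSpec q h₀ h₁) k (x + 1) * (q * q ^ k * ((q * q ^ x)⁻¹ - (q ^ k)⁻¹) *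
      ((q * q ^ x)⁻¹ - (q * q ^ k)⁻¹) * (h₀ - h₁ * q ^ x)) := by
  have hX : 0 < q ^ x := pow_pos hq x
  induction k with
  | zero =>
    simp [newton_succ, qSpec]
    field_simp
  | succ k ih =>
    have hK : 0 < q ^ k := pow_pos hq k
    rw [newton_q_succ hq, ← mul_assoc, ih, newton_q_succ hq]
    simp only [pow_succ]
    field_simp

/-- The birth and death rates belonging to two `q`-quadratic spectra. The rates at `0` are treated
separately, as the general formula may be `0/0` there. The free parameters `u` and `v` are read off
from the birth rate. -/
theorem isLadder_q {B D : ℕ → ℝ} {q h₀ h₁ e₀ e₁ u v : ℝ} (hq : 0 < q)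
    (hpos : ∀ j : ℕ, 1 ≤ j → 0 < h₀ - h₁ * q ^ j) (hD0 : D 0 = 0)
    (hB0 : B 0 * (h₀ - q * h₁) = -(e₀ * h₀ + u + q * v - q * e₁ * h₁))
    (hB : ∀ x : ℕ, 1 ≤ x → B x * ((h₀ - h₁ * (q ^ x) ^ 2) * (h₀ - q * h₁ * (q ^ x) ^ 2)) =
      -((h₀ - h₁ * q ^ x) *
        (e₀ * h₀ + u * q ^ x + q * v * (q ^ x) ^ 2 - q * e₁ * h₁ * (q ^ x) ^ 3)))
    (hD : ∀ x : ℕ, 1 ≤ x → D x * ((h₀ - h₁ * (q ^ x) ^ 2) * (q * h₀ - h₁ * (q ^ x) ^ 2)) =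
      (1 - q ^ x) * (e₀ * h₁ ^ 2 * (q ^ x) ^ 3 + u * h₁ * (q ^ x) ^ 2 + q * v * h₀ * q ^ x -
        q * e₁ * h₀ ^ 2)) :
    IsLadder B D (qSpec q h₀ h₁) (qSpec q e₀ e₁) (qOff q h₀ h₁ e₀ e₁ u v) where
  death_zero := hD0
  ev_zero := by simp [qSpec]
  ladder k x := by
    rcases x with _ | x
    · rw [diffOp, hD0]
      rcases k with _ | k
      · simp [newton_succ, qSpec, qOff]
        field_simp
        linear_combination -(1 - q) * hB0
      · rw [newton_eq_zero _ (k := k + 1 + 1) (x := 0) (by omega),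
          newton_eq_zero _ (k := k + 1 + 1) (x := 0 + 1) (by omega),
          newton_eq_zero _ (k := k + 1) (x := 0) (by omega)]
        simp
    · have d0 := hpos (2 * (x + 1)) (by omega)
      have d1 := hpos (2 * (x + 1) + 1) (by omega)
      have d2 := hpos (2 * x + 1) (by omega)
      have hB' := hB (x + 1) (by omega)
      have hD' := hD (x + 1) (by omega)
      have r2 := newton_q_up hq h₀ h₁ k (x + 1)
      have r3 := newton_q_down hq h₀ h₁ k x
      rw [diffOp, newton_q_succ hq, Nat.add_sub_cancel]
      generalize newton (qSpec q h₀ h₁) k (x + 1) = n at *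
      generalize newton (qSpec q h₀ h₁) (k + 1) (x + 1 + 1) = n2 at *
      generalize newton (qSpec q h₀ h₁) (k + 1) x = n3 at *
      generalize B (x + 1) = b at *
      generalize D (x + 1) = d at *
      have hX : 0 < q ^ x := pow_pos hq x
      have hK : 0 < q ^ k := pow_pos hq k
      simp only [qSpec, qOff, pow_succ, pow_mul', pow_zero, one_mul] at *
      generalize q ^ x = X at *
      generalize q ^ k = K at *
      have e0 : (h₀ - h₁ * (X * q * (X * q))) ≠ 0 := by
        refine ne_of_gt ?_; linarith
      have e1 : (h₀ - q * h₁ * (X * q * (X * q))) ≠ 0 := by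
        refine ne_of_gt ?_; linarith
      have e2 : (q * h₀ - h₁ * (X * q * (X * q))) ≠ 0 := by
        have := mul_pos hq d2
        refine ne_of_gt ?_; linarith
      rw [← mul_left_inj' (mul_ne_zero (mul_ne_zero e0 e1) e2)]
      linear_combination (norm := skip)
        (n * (((X * q)⁻¹ - K⁻¹) * (h₀ - h₁ * (X * q * K))) - n2) *
          (q * h₀ - h₁ * (X * q * (X * q))) * hB' +
        (n * (((X * q)⁻¹ - K⁻¹) * (h₀ - h₁ * (X * q * K))) - n3) *
          (h₀ - q * h₁ * (X * q * (X * q))) * hD' +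
        (e₀ * h₀ + u * (X * q) + q * v * (X * q) ^ 2 - q * e₁ * h₁ * (X * q) ^ 3) *
          (q * h₀ - h₁ * (X * q * (X * q))) * r2 -
        (e₀ * h₁ ^ 2 * (X * q) ^ 3 + u * h₁ * (X * q) ^ 2 + q * v * h₀ * (X * q) -
          q * e₁ * h₀ ^ 2) *
          (h₀ - q * h₁ * (X * q * (X * q))) * (q * X) * r3
      field_simp
      ring

/-! ### Sums over the lattice -/

lemma hasSum_lattice_top {f : ℕ → ℝ} {a : ℝ} :
    HasSum (fun x : Lattice ⊤ => f x.1) a ↔ HasSum f a :=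
  (Equiv.subtypeUnivEquiv (p := fun x : ℕ => (x : ℕ∞) ≤ ⊤) fun _ => le_top).hasSum_iff
    (f := f)

lemma hasSum_lattice_coe (N : ℕ) (f : ℕ → ℝ) :
    HasSum (fun x : Lattice (N : ℕ∞) => f x.1) (∑ x ∈ Finset.range (N + 1), f x) := by
  have e : ∀ x : ℕ, (x : ℕ∞) ≤ (N : ℕ∞) ↔ x ∈ Finset.range (N + 1) := fun x => by
    rw [Nat.cast_le, Finset.mem_range, Nat.lt_succ_iff]
  exact (Equiv.subtypeEquivRight e).hasSum_iff.2 (Finset.hasSum (Finset.range (N + 1)) f)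

lemma hasSum_lattice_ite {N : ℕ∞} (j : ℕ) (g : ℕ → ℝ) :
    HasSum (fun y : Lattice N => if y.1 = j then g y.1 else 0)
      (if (j : ℕ∞) ≤ N then g j else 0) := by
  by_cases h : (j : ℕ∞) ≤ N
  · rw [if_pos h]
    refine hasSum_of_eq (hasSum_single (⟨j, h⟩ : Lattice N) fun y hy => ?_) (fun _ => rfl) ?_
    · rw [if_neg fun e => hy (Subtype.ext e)]
    · simp
  · rw [if_neg h]
    refine hasSum_of_eq hasSum_zero (fun y => if_neg fun e => h ?_) rfl
    rw [← e]; exact y.2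

lemma summable_mul_of_sq {ι : Type*} {w f g : ι → ℝ} (hw : ∀ i, 0 ≤ w i)
    (hf : Summable fun i => w i * f i ^ 2) (hg : Summable fun i => w i * g i ^ 2) :
    Summable fun i => w i * f i * g i := by
  refine Summable.of_norm_bounded (hf.add hg) fun i => ?_
  rw [Real.norm_eq_abs, abs_le]
  constructor <;> nlinarith [mul_nonneg (hw i) (sq_nonneg (f i + g i)),
    mul_nonneg (hw i) (sq_nonneg (f i - g i)), mul_nonneg (hw i) (sq_nonneg (f i)),
    mul_nonneg (hw i) (sq_nonneg (g i))]

/-- Eigenfunctions of the difference operator to different eigenvalues are orthogonal. On the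
infinite lattice this needs square summability and bounded rates. -/
lemma hasSum_mul_eq_zero {N : ℕ∞} {B D w f g : ℕ → ℝ} {l m K : ℝ} (hbd : IsBirthDeath N B D)
    (hK : ∀ x : Lattice N, B x + D x ≤ K) (hw0 : ∀ x : Lattice N, 0 ≤ w x)
    (hw : ∀ x : ℕ, ((x + 1 : ℕ) : ℕ∞) ≤ N → w (x + 1) * D (x + 1) = w x * B x)
    (hf : ∀ x : Lattice N, diffOp B D f x = l * f x)
    (hg : ∀ x : Lattice N, diffOp B D g x = m * g x) (hlm : l ≠ m)
    (hf2 : Summable fun x : Lattice N => w x * f x ^ 2)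
    (hg2 : Summable fun x : Lattice N => w x * g x ^ 2) :
    HasSum (fun x : Lattice N => w x * f x * g x) 0 := by
  have key : ∀ M : ℕ, (M : ℕ∞) ≤ N → (l - m) * ∑ x ∈ Finset.range (M + 1), w x * f x * g x =
      w M * B M * (f M * g (M + 1) - f (M + 1) * g M) := by
    intro M hM
    have hle : ∀ x ≤ M, (x : ℕ∞) ≤ N := fun x hx => le_trans (by exact_mod_cast hx) hM
    rw [← sum_diffOp_sub hbd.death_zero (fun x hx => hw x (hle _ hx)), Finset.mul_sum]
    refine Finset.sum_congr rfl fun x hx => ?_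
    have hx' := hle x (Nat.lt_succ_iff.1 (Finset.mem_range.1 hx))
    rw [hf ⟨x, hx'⟩, hg ⟨x, hx'⟩]
    ring
  have hlm' : l - m ≠ 0 := sub_ne_zero.2 hlm
  induction N using ENat.recTopCoe with
  | coe N =>
    have := key N le_rfl
    rw [hbd.birth_end ⟨N, le_rfl⟩ rfl, mul_zero, zero_mul] at this
    rw [← (mul_eq_zero.1 this).resolve_left hlm']
    exact hasSum_lattice_coe N fun x => w x * f x * g x
  | top =>
    have hs := (summable_mul_of_sq hw0 hf2 hg2).hasSum
    have hs' := (hasSum_lattice_top (f := fun x => w x * f x * g x)).1 hs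
    have hF := (hasSum_lattice_top (f := fun x => w x * f x ^ 2)).1 hf2.hasSum
    have hG := (hasSum_lattice_top (f := fun x => w x * g x ^ 2)).1 hg2.hasSum
    have hF0 := hF.summable.tendsto_atTop_zero
    have hG0 := hG.summable.tendsto_atTop_zero
    have h1 : Tendsto (fun M : ℕ => (l - m) * ∑ x ∈ Finset.range (M + 1), w x * f x * g x) atTop
        (𝓝 ((l - m) * _)) :=
      ((tendsto_add_atTop_iff_nat 1).2 hs'.tendsto_sum_nat).const_mul (l - m)
    have h2 : Tendsto (fun M : ℕ => (l - m) * ∑ x ∈ Finset.range (M + 1), w x * f x * g x) atTop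
        (𝓝 0) := by
      have h3 : Tendsto (fun M : ℕ => K * (w M * f M ^ 2 + w (M + 1) * g (M + 1) ^ 2 +
          (w (M + 1) * f (M + 1) ^ 2 + w M * g M ^ 2))) atTop (𝓝 (K * (0 + 0 + (0 + 0)))) :=
        ((hF0.add ((tendsto_add_atTop_iff_nat 1).2 hG0)).add
          (((tendsto_add_atTop_iff_nat 1).2 hF0).add hG0)).const_mul K
      simp only [add_zero, mul_zero] at h3
      refine squeeze_zero_norm (fun M => ?_) h3
      rw [key M le_top, Real.norm_eq_abs]
      have hB : ∀ x, 0 < B x := fun x => hbd.birth_pos ⟨x, le_top⟩ (ENat.natCast_ne_top x)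
      have hD : ∀ x, 0 < D (x + 1) := fun x => hbd.death_pos ⟨x + 1, le_top⟩ x.succ_ne_zero
      have hD0 : ∀ x, 0 ≤ D x := fun x => by
        rcases x with _ | x
        · exact hbd.death_zero.ge
        · exact (hD x).le
      have hBK : B M ≤ K := by linarith [hK ⟨M, le_top⟩, hD0 M]
      have hDK : D (M + 1) ≤ K := by linarith [hK ⟨M + 1, le_top⟩, hB (M + 1)]
      have e := hw M le_top
      have w0 : 0 ≤ w M := hw0 ⟨M, le_top⟩
      have w1 : 0 ≤ w (M + 1) := hw0 ⟨M + 1, le_top⟩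
      have i1 : w M * B M * f M ^ 2 ≤ K * (w M * f M ^ 2) := by
        nlinarith [mul_nonneg w0 (sq_nonneg (f M))]
      have i2 : w M * B M * g M ^ 2 ≤ K * (w M * g M ^ 2) := by
        nlinarith [mul_nonneg w0 (sq_nonneg (g M))]
      have i3 : w M * B M * f (M + 1) ^ 2 ≤ K * (w (M + 1) * f (M + 1) ^ 2) := by
        rw [← e]; nlinarith [mul_nonneg w1 (sq_nonneg (f (M + 1)))]
      have i4 : w M * B M * g (M + 1) ^ 2 ≤ K * (w (M + 1) * g (M + 1) ^ 2) := by
        rw [← e]; nlinarith [mul_nonneg w1 (sq_nonneg (g (M + 1)))]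
      have hc : 0 ≤ w M * B M := mul_nonneg w0 (hB M).le
      generalize w M * B M = c at *
      rw [abs_le]
      constructor
      · nlinarith [mul_nonneg hc (sq_nonneg (f M + g (M + 1))),
          mul_nonneg hc (sq_nonneg (f (M + 1) - g M)), mul_nonneg hc (sq_nonneg (f M)),
          mul_nonneg hc (sq_nonneg (g (M + 1))), mul_nonneg hc (sq_nonneg (f (M + 1))),
          mul_nonneg hc (sq_nonneg (g M))]
      · nlinarith [mul_nonneg hc (sq_nonneg (f M - g (M + 1))),
          mul_nonneg hc (sq_nonneg (f (M + 1) + g M)), mul_nonneg hc (sq_nonneg (f M)),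
          mul_nonneg hc (sq_nonneg (g (M + 1))), mul_nonneg hc (sq_nonneg (f (M + 1))),
          mul_nonneg hc (sq_nonneg (g M))]
    have h4 := tendsto_nhds_unique h1 h2
    rw [(mul_eq_zero.1 h4).resolve_left hlm'] at hs
    exact hs

/-! ### Expansions in orthogonal matrices -/

/-- If the rows and the columns of an infinite matrix are orthonormal, every square summable
function is the pointwise sum of its expansion in the rows. -/
lemma hasSum_expansion {ι κ : Type*} [DecidableEq ι] [DecidableEq κ] {φ : ι → κ → ℝ}
    (ho : ∀ n m, HasSum (fun x => φ n x * φ m x) (if n = m then 1 else 0))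
    (hd : ∀ x y, HasSum (fun n => φ n x * φ n y) (if x = y then 1 else 0))
    {u : κ → ℝ} (hu : Summable fun x => u x ^ 2) (x : κ) :
    HasSum (fun n => (∑' y, φ n y * u y) * φ n x) (u x) := by
  have hmem : ∀ v : κ → ℝ, (Summable fun x => v x ^ 2) → Memℓp v 2 := fun v hv => by
    refine memℓp_gen ?_
    simpa using hv
  have hsq : ∀ n, Summable fun x => φ n x ^ 2 := fun n => by
    simpa [pow_two] using (ho n n).summable
  set e : ι → lp (fun _ : κ => ℝ) 2 := fun n => ⟨φ n, hmem _ (hsq n)⟩ with he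
  set U : lp (fun _ : κ => ℝ) 2 := ⟨u, hmem u hu⟩ with hU
  set d : lp (fun _ : κ => ℝ) 2 := lp.single 2 x (1 : ℝ) with hdd
  have inner_eq : ∀ f g : lp (fun _ : κ => ℝ) 2, inner ℝ f g = ∑' y, f y * g y := fun f g => by
    rw [lp.inner_eq_tsum]
    exact tsum_congr fun y => by simp [mul_comm]
  have hon : Orthonormal ℝ e := by
    rw [orthonormal_iff_ite]
    intro n m
    rw [inner_eq]
    exact (ho n m).tsum_eq
  have hin : ∀ f : lp (fun _ : κ => ℝ) 2, inner ℝ f d = f x := fun f => by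
    rw [inner_eq, tsum_eq_single x]
    · simp [hdd, lp.single_apply]
    · intro y hy
      simp [hdd, lp.single_apply, hy]
  have hd1 : inner ℝ d d = (1 : ℝ) := by rw [hin]; simp [hdd, lp.single_apply]
  have hexp : HasSum (fun n => φ n x • e n) d := by
    have h1 : Tendsto (fun s : Finset ι => ‖∑ n ∈ s, φ n x • e n - d‖ ^ 2) atTop (𝓝 0) := by
      have h2 : ∀ s : Finset ι, ‖∑ n ∈ s, φ n x • e n - d‖ ^ 2 =
          1 - ∑ n ∈ s, φ n x * φ n x := by
        intro s
        have h3 : inner ℝ (∑ n ∈ s, φ n x • e n) d = ∑ n ∈ s, φ n x * φ n x := by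
          rw [sum_inner]
          exact Finset.sum_congr rfl fun n _ => by rw [inner_smul_left, hin]; rfl
        have h4 : inner ℝ (∑ n ∈ s, φ n x • e n) (∑ n ∈ s, φ n x • e n) =
            ∑ n ∈ s, φ n x * φ n x := by
          rw [hon.inner_sum]
          rfl
        rw [← real_inner_self_eq_norm_sq, inner_sub_left, inner_sub_right, inner_sub_right, hd1,
          h4, real_inner_comm (∑ n ∈ s, φ n x • e n) d, h3]
        ring
      simp only [h2]
      have := (hd x x).const_sub 1
      rw [if_pos rfl, sub_self] at this
      exact this
    rw [HasSum, SummationFilter.unconditional_filter, tendsto_iff_norm_sub_tendsto_zero]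
    have := h1.sqrt
    simpa using this
  have h3 := hexp.mapL (innerSL ℝ U)
  refine hasSum_of_eq h3 (fun n => ?_) ?_
  · rw [map_smul, innerSL_apply_apply, inner_eq, smul_eq_mul, mul_comm]
    congr 1
    exact tsum_congr fun y => mul_comm _ _
  · rw [innerSL_apply_apply, hin]

/-! ### Matrices with finite rows -/

section Matrices

variable {N : ℕ∞}

/-- Every row of the matrix has finitely many non-zero entries. -/
def RowFinite (A : Matrix (Lattice N) (Lattice N) ℝ) : Prop :=
  ∀ x, (Function.support (A x)).Finite

lemma rowFinite_of_band {A : Matrix (Lattice N) (Lattice N) ℝ} {r : ℕ}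
    (h : ∀ x y : Lattice N, x.1 + r < y.1 → A x y = 0) : RowFinite A := fun x => by
  refine Set.Finite.subset ((Set.finite_Iic (x.1 + r)).preimage Subtype.val_injective.injOn) ?_
  intro y hy
  by_contra hlt
  exact hy (h x y (not_le.1 hlt))

variable {A : Matrix (Lattice N) (Lattice N) ℝ}

lemma RowFinite.hasSum_act (hA : RowFinite A) (v : Lattice N → ℝ) (x : Lattice N) :
    HasSum (fun y => A x y * v y) (act A v x) := by
  refine Summable.hasSum (summable_of_hasFiniteSupport ((hA x).subset ?_))
  exact Function.support_mul_subset_left _ _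

lemma RowFinite.act_eq_sum (hA : RowFinite A) (v : Lattice N → ℝ) (x : Lattice N) :
    act A v x = ∑ y ∈ (hA x).toFinset, A x y * v y := by
  refine tsum_eq_sum fun y hy => ?_
  rw [Set.Finite.mem_toFinset, Function.mem_support, not_not] at hy
  rw [hy, zero_mul]

/-- The action of a matrix with finite rows can be computed term by term. -/
lemma RowFinite.hasSum_act_apply (hA : RowFinite A) {ι : Type*} {f : ι → Lattice N → ℝ}
    {v : Lattice N → ℝ} (h : ∀ y, HasSum (fun n => f n y) (v y)) (x : Lattice N) :
    HasSum (fun n => act A (f n) x) (act A v x) := by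
  simp only [hA.act_eq_sum]
  exact hasSum_sum fun y _ => (h y).mul_left (A x y)

lemma RowFinite.act_smul (hA : RowFinite A) (c : ℝ) (v : Lattice N → ℝ) (x : Lattice N) :
    act A (fun y => c * v y) x = c * act A v x := by
  simp only [hA.act_eq_sum, Finset.mul_sum]
  exact Finset.sum_congr rfl fun y _ => by ring

lemma RowFinite.act_sub (hA : RowFinite A) (v v' : Lattice N → ℝ) (x : Lattice N) :
    act A (fun y => v y - v' y) x = act A v x - act A v' x := by
  simp only [hA.act_eq_sum, ← Finset.sum_sub_distrib]
  exact Finset.sum_congr rfl fun y _ => by ring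

lemma act_single (A : Matrix (Lattice N) (Lattice N) ℝ) (x y : Lattice N) :
    act A (fun z => if z = y then 1 else 0) x = A x y := by
  rw [act, tsum_eq_single y]
  · simp
  · intro z hz
    simp [hz]

/-- The action of a matrix of the form `g (α A + β) g⁻¹` with a diagonal matrix `g`. -/
lemma act_conj {A' : Matrix (Lattice N) (Lattice N) ℝ} (hA : RowFinite A) {g : Lattice N → ℝ}
    (hg : ∀ x, g x ≠ 0) {α β : ℝ}
    (hA' : ∀ x y, A' x y = g x * (α * A x y + β * (1 : Matrix _ _ ℝ) x y) * (g y)⁻¹)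
    (v : Lattice N → ℝ) (x : Lattice N) :
    act A' (fun y => g y * v y) x = g x * (α * act A v x + β * v x) := by
  have h1 : HasSum (fun y => (1 : Matrix (Lattice N) (Lattice N) ℝ) x y * v y) (v x) := by
    have := hasSum_single (f := fun y => (1 : Matrix (Lattice N) (Lattice N) ℝ) x y * v y) x
      fun y hy => by rw [Matrix.one_apply_ne hy.symm, zero_mul]
    simpa using this
  refine (hasSum_of_eq ((((hA.hasSum_act v x).mul_left α).add (h1.mul_left β)).mul_left (g x))
    (fun y => ?_) rfl).tsum_eq
  rw [hA']
  have := hg y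
  field_simp

/-- A complete eigensystem of `A` gives one of `g (α A + β) g⁻¹`, with a diagonal matrix `g`. -/
lemma IsCompleteEigensystem.conj {wt ev : Lattice N → ℝ} {v : Lattice N → Lattice N → ℝ}
    (h : IsCompleteEigensystem A wt ev v) {A' : Matrix (Lattice N) (Lattice N) ℝ}
    (hA : RowFinite A) {g : Lattice N → ℝ} (hg : ∀ x, g x ≠ 0) {α β : ℝ} (hα : α ≠ 0)
    (hA' : ∀ x y, A' x y = g x * (α * A x y + β * (1 : Matrix _ _ ℝ) x y) * (g y)⁻¹)
    {wt' ev' : Lattice N → ℝ} {v' : Lattice N → Lattice N → ℝ}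
    (hwt : ∀ x, wt' x * g x ^ 2 = wt x) (hev : ∀ n, ev' n = α * ev n + β)
    {c : Lattice N → ℝ} (hc : ∀ n, c n ≠ 0) (hv : ∀ n x, v' n x = g x * (c n * v n x)) :
    IsCompleteEigensystem A' wt' ev' v' where
  ne_zero n h0 := by
    refine h.ne_zero n (funext fun x => ?_)
    have := congrFun h0 x
    rw [hv, Pi.zero_apply] at this
    simpa [hg x, hc n] using this
  mem n := by
    refine ((h.mem n).mul_left (c n ^ 2)).congr fun x => ?_
    rw [hv, ← hwt]; ring
  eigen n := by
    funext x
    rw [show v' n = fun y => g y * (c n * v n y) from funext (hv n), act_conj hA hg hA',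
      hA.act_smul, h.eigen n, hev, Pi.smul_apply, Pi.smul_apply, smul_eq_mul, smul_eq_mul]
    ring
  simple n m hnm := by
    simp only [hev, add_left_inj, mul_right_inj' hα] at hnm
    exact h.simple hnm
  orthogonal n m hnm := by
    refine hasSum_of_eq ((h.orthogonal n m hnm).mul_left (c n * c m)) (fun x => ?_) (by simp)
    rw [hv, hv, ← hwt]; ring
  total u hu h0 := by
    have h1 := h.total (fun x => (g x)⁻¹ * u x) (hu.congr fun x => ?_) fun n => ?_
    · funext x
      have := congrFun h1 x
      simpa [hg x] using this
    · rw [← hwt]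
      have := hg x
      field_simp
    · have := h0 n
      rw [← mul_right_inj' (hc n), mul_zero, ← tsum_mul_left, ← this]
      refine tsum_congr fun x => ?_
      rw [hv, ← hwt]
      have := hg x
      field_simp
  all e u hu0 hu he := by
    set u' : Lattice N → ℝ := fun x => (g x)⁻¹ * u x with hu'
    have hgu : u = fun x => g x * u' x := by
      funext x
      have := hg x
      simp only [hu']
      field_simp
    have hu1 : u' ≠ 0 := fun h1 => hu0 <| by
      rw [hgu, h1]
      exact funext fun x => mul_zero _
    have hu2 : Summable fun x => wt x * u' x ^ 2 := hu.congr fun x => by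
      rw [← hwt, hu']
      have := hg x
      field_simp
    have hu3 : act A u' = ((e - β) / α) • u' := by
      funext x
      have h2 := congrFun he x
      conv at h2 => rw [hgu]
      rw [act_conj hA hg hA', Pi.smul_apply, smul_eq_mul] at h2
      rw [Pi.smul_apply, smul_eq_mul]
      have := hg x
      field_simp
      have h3 : g x * (α * act A u' x - (e - β) * u' x) = 0 := by linear_combination h2
      have := (mul_eq_zero.1 h3).resolve_left this
      linarith
    obtain ⟨n, hn, d, hd⟩ := h.all ((e - β) / α) u' hu1 hu2 hu3
    refine ⟨n, ?_, d / c n, funext fun x => ?_⟩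
    · rw [hev, ← hn]
      field_simp
      ring
    · rw [hgu]
      simp only [hd, Pi.smul_apply, smul_eq_mul, hv]
      have := hc n
      field_simp

/-! ### The matrices of a birth and death process -/

variable {B D : ℕ → ℝ}

lemma band_Htilde (x y : Lattice N) (h : x.1 + 1 < y.1) : Htilde N B D x y = 0 := by
  rw [Htilde, if_neg (by omega), if_neg (by omega), if_neg]
  intro e
  rw [e] at h
  omega

lemma rowFinite_Htilde : RowFinite (Htilde N B D) := rowFinite_of_band band_Htilde

lemma act_Htilde (hbd : IsBirthDeath N B D) (v : ℕ → ℝ) (x : Lattice N) :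
    act (Htilde N B D) (fun y => v y) x = diffOp B D v x := by
  have h1 := hasSum_lattice_ite (N := N) (x.1 + 1) fun y => -B x * v y
  have h2 := hasSum_lattice_ite (N := N) (x.1 - 1) fun y => -D x * v y
  have h3 := hasSum_lattice_ite (N := N) x.1 fun y => (B x + D x) * v y
  refine (hasSum_of_eq ((h1.add h2).add h3) (fun y => ?_) ?_).tsum_eq
  · simp only [Htilde, Subtype.ext_iff]
    rcases Nat.eq_zero_or_pos x.1 with h0 | h0
    · rw [h0, hbd.death_zero]
      split_ifs <;> first | contradiction | omega | simp
    · split_ifs <;> first | omega | simp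
  · have hle : ((x.1 - 1 : ℕ) : ℕ∞) ≤ N := le_trans (Nat.cast_le.2 (Nat.sub_le _ _)) x.2
    rw [if_pos x.2, if_pos hle, diffOp]
    split_ifs with h
    · ring
    · have : (x.1 : ℕ∞) = N := by
        refine le_antisymm x.2 ?_
        rw [not_le] at h
        exact Order.le_of_lt_add_one (by exact_mod_cast h)
      rw [hbd.birth_end x this]
      ring

lemma IsBirthDeath.birth_nonneg (hbd : IsBirthDeath N B D) (x : Lattice N) : 0 ≤ B x := by
  by_cases h : (x.1 : ℕ∞) = N
  · exact (hbd.birth_end x h).ge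
  · exact (hbd.birth_pos x h).le

lemma IsBirthDeath.death_nonneg (hbd : IsBirthDeath N B D) (x : Lattice N) : 0 ≤ D x := by
  by_cases h : x.1 = 0
  · rw [h]; exact hbd.death_zero.ge
  · exact (hbd.death_pos x h).le

lemma IsBirthDeath.birth_pos_of_succ (hbd : IsBirthDeath N B D) {x : ℕ}
    (h : ((x + 1 : ℕ) : ℕ∞) ≤ N) : 0 < B x := by
  refine hbd.birth_pos ⟨x, le_trans (by exact_mod_cast x.le_succ) h⟩ fun e => ?_
  rw [← e, Nat.cast_le] at h
  simp only at h
  omega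

lemma IsBirthDeath.prod_pos (hbd : IsBirthDeath N B D) (x : Lattice N) :
    0 < ∏ y ∈ Finset.range x, B y / D (y + 1) := by
  refine Finset.prod_pos fun y hy => ?_
  have hy' : ((y + 1 : ℕ) : ℕ∞) ≤ N :=
    le_trans (by exact_mod_cast Finset.mem_range.1 hy) x.2
  exact div_pos (hbd.birth_pos_of_succ hy') (hbd.death_pos ⟨y + 1, hy'⟩ y.succ_ne_zero)

lemma phi0_pos (hbd : IsBirthDeath N B D) (x : Lattice N) : 0 < phi0 B D x :=
  Real.sqrt_pos.2 (hbd.prod_pos x)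

lemma phi0_sq_eq (hbd : IsBirthDeath N B D) (x : Lattice N) :
    phi0 B D x ^ 2 = ∏ y ∈ Finset.range x, B y / D (y + 1) :=
  Real.sq_sqrt (hbd.prod_pos x).le

@[simp] lemma phi0_zero : phi0 B D 0 = 1 := by simp [phi0]

/-- Detailed balance. -/
lemma phi0_sq_succ (hbd : IsBirthDeath N B D) {x : ℕ} (h : ((x + 1 : ℕ) : ℕ∞) ≤ N) :
    phi0 B D (x + 1) ^ 2 * D (x + 1) = phi0 B D x ^ 2 * B x := by
  have hx : (x : ℕ∞) ≤ N := le_trans (by exact_mod_cast x.le_succ) h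
  have h1 := phi0_sq_eq hbd ⟨x + 1, h⟩
  have h2 := phi0_sq_eq hbd ⟨x, hx⟩
  simp only at h1 h2
  rw [h1, h2, Finset.prod_range_succ]
  have := (hbd.death_pos ⟨x + 1, h⟩ x.succ_ne_zero).ne'
  simp only at this
  field_simp

lemma gen_eq (hbd : IsBirthDeath N B D) (x y : Lattice N) :
    gen N B D x y = phi0 B D x ^ 2 * (-1 * Htilde N B D x y + 0 * (1 : Matrix _ _ ℝ) x y) *
      (phi0 B D y ^ 2)⁻¹ := by
  have hx := (phi0_pos hbd x).ne'
  have hy := (phi0_pos hbd y).ne'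
  obtain ⟨x, hxN⟩ := x
  obtain ⟨y, hyN⟩ := y
  simp only [gen, Htilde, Subtype.mk.injEq] at *
  by_cases h1 : x = y + 1
  · subst h1
    rw [if_pos rfl, if_neg (by omega), if_pos rfl]
    have := phi0_sq_succ hbd hxN
    field_simp
    linarith
  rw [if_neg h1]
  by_cases h2 : x + 1 = y
  · subst h2
    rw [if_pos rfl, if_pos rfl]
    have := phi0_sq_succ hbd hyN
    field_simp
    linarith
  rw [if_neg h2]
  by_cases h3 : x = y
  · subst h3
    rw [if_pos rfl, if_neg (by omega), if_neg (by omega), if_pos rfl]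
    field_simp
    ring
  · rw [if_neg h3, if_neg (by omega), if_neg (by omega), if_neg h3]
    simp

lemma trans_eq (N : ℕ∞) (B D : ℕ → ℝ) (t : ℝ) :
    trans N (fun x => t * B x) (fun x => t * D x) = 1 + t • gen N B D := by
  ext x y
  rw [Matrix.add_apply, Matrix.smul_apply, Matrix.one_apply, smul_eq_mul]
  obtain ⟨x, hxN⟩ := x
  obtain ⟨y, hyN⟩ := y
  simp only [trans, gen, Subtype.mk.injEq]
  split_ifs <;> first | omega | ring

lemma rowFinite_gen : RowFinite (gen N B D) := by
  refine rowFinite_of_band (r := 1) fun x y h => ?_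
  rw [gen, if_neg (by omega), if_neg (by omega), if_neg]
  intro e
  rw [e] at h
  omega

lemma rowFinite_trans : RowFinite (trans N B D) := by
  refine rowFinite_of_band (r := 1) fun x y h => ?_
  rw [trans, if_neg (by omega), if_neg (by omega), if_neg]
  intro e
  rw [e] at h
  omega

lemma rowFinite_Hsymm : RowFinite (Hsymm N B D) := by
  refine rowFinite_of_band (r := 1) fun x y h => ?_
  rw [Hsymm, band_Htilde x y h]
  simp

end Matrices

/-! ### Diagonalized birth and death processes -/

namespace Data

/-- The properties of the data from which the solution of the processes follows: the rates are
admissible and bounded, the `P̌_n` solve the difference equation with different eigenvalues, and the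
matrix of the `φ̂_n(x)` has orthonormal rows and orthonormal columns. -/
structure IsDiagonalized (S : Data) : Prop where
  isBirthDeath : IsBirthDeath S.N S.B S.D
  bounded : ∃ M : ℝ, ∀ x : Lattice S.N, S.B x + S.D x ≤ M
  P_zero : ∀ x : Lattice S.N, S.P 0 x = 1
  P_at_zero : ∀ n : Lattice S.N, S.P n 0 = 1
  difference_eq : ∀ n x : Lattice S.N, diffOp S.B S.D (S.P n) x = S.E n * S.P n x
  E_zero : S.E 0 = 0
  E_pos : ∀ n : Lattice S.N, n.1 ≠ 0 → 0 < S.E n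
  E_injective : Function.Injective fun n : Lattice S.N => S.E n
  d0sq_pos : 0 < S.d0sq
  dratio_zero : S.dratio 0 = 1
  dsq_pos : ∀ n : Lattice S.N, 0 < S.dsq n
  norm : ∀ n m : Lattice S.N,
    HasSum (fun x : Lattice S.N => phi0 S.B S.D x ^ 2 * S.P n x * S.P m x)
      (if n = m then 1 / S.dsq n else 0)
  dual : ∀ x y : Lattice S.N,
    HasSum (fun n : Lattice S.N => S.phihat n x * S.phihat n y) (if x = y then 1 else 0)

lemma orthonormal_of_norm {S : Data} (hd : ∀ n : Lattice S.N, 0 < S.dsq n)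
    (hn : ∀ n m : Lattice S.N,
      HasSum (fun x : Lattice S.N => phi0 S.B S.D x ^ 2 * S.P n x * S.P m x)
        (if n = m then 1 / S.dsq n else 0)) (n m : Lattice S.N) :
    HasSum (fun x : Lattice S.N => S.phihat n x * S.phihat m x) (if n = m then 1 else 0) := by
  refine hasSum_of_eq ((hn n m).mul_left (√(S.dsq n) * √(S.dsq m))) (fun x => ?_) ?_
  · simp only [phihat]; ring
  · split_ifs with e
    · subst e
      rw [Real.mul_self_sqrt (hd n).le]
      have := (hd n).ne'
      field_simp
    · simp

namespace IsDiagonalized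

variable {S : Data}

lemma dsq_zero (h : S.IsDiagonalized) : S.dsq 0 = S.d0sq := by rw [dsq, h.dratio_zero, one_mul]

lemma phihat_zero (h : S.IsDiagonalized) (x : Lattice S.N) :
    S.phihat 0 x = √S.d0sq * phi0 S.B S.D x := by
  rw [phihat, h.dsq_zero, h.P_zero, mul_one]

lemma phihat_zero_pos (h : S.IsDiagonalized) (x : Lattice S.N) : 0 < S.phihat 0 x := by
  rw [h.phihat_zero]
  exact mul_pos (Real.sqrt_pos.2 h.d0sq_pos) (phi0_pos h.isBirthDeath x)

lemma phihat_zero_sq (h : S.IsDiagonalized) (x : Lattice S.N) :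
    S.phihat 0 x * S.phihat 0 x = S.stat x := by
  rw [h.phihat_zero, stat]
  linear_combination phi0 S.B S.D x ^ 2 * Real.mul_self_sqrt h.d0sq_pos.le

lemma stat_pos (h : S.IsDiagonalized) (x : Lattice S.N) : 0 < S.stat x := by
  rw [← h.phihat_zero_sq]
  exact mul_pos (h.phihat_zero_pos x) (h.phihat_zero_pos x)

lemma orthonormal (h : S.IsDiagonalized) (n m : Lattice S.N) :
    HasSum (fun x : Lattice S.N => S.phihat n x * S.phihat m x) (if n = m then 1 else 0) :=
  orthonormal_of_norm h.dsq_pos h.norm n m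

lemma stat_prob (h : S.IsDiagonalized) : IsProb fun x : Lattice S.N => S.stat x where
  nonneg x := (h.stat_pos x).le
  sum_eq_one := by
    have := h.orthonormal ⟨0, zero_le⟩ ⟨0, zero_le⟩
    simp only [if_true, h.phihat_zero_sq] at this
    exact this

lemma hasSum_phi0_sq (h : S.IsDiagonalized) :
    HasSum (fun x : Lattice S.N => phi0 S.B S.D x ^ 2) (1 / S.d0sq) := by
  refine hasSum_of_eq (h.norm ⟨0, zero_le⟩ ⟨0, zero_le⟩) (fun x => ?_) ?_
  · simp [h.P_zero]
  · simp [h.dsq_zero]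

lemma expansion (h : S.IsDiagonalized) {u : Lattice S.N → ℝ} (hu : Summable fun x => u x ^ 2)
    (x : Lattice S.N) :
    HasSum (fun n : Lattice S.N => (∑' y : Lattice S.N, S.phihat n y * u y) * S.phihat n x)
      (u x) :=
  hasSum_expansion (φ := fun n x : Lattice S.N => S.phihat n x) h.orthonormal h.dual hu x

lemma summable_phihat_sq (h : S.IsDiagonalized) (n : Lattice S.N) :
    Summable fun x : Lattice S.N => S.phihat n x ^ 2 := by
  simpa [pow_two] using (h.orthonormal n n).summable

/-- The polynomials are a complete system of eigenvectors of the difference operator. -/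
lemma eigensystem (h : S.IsDiagonalized) : IsCompleteEigensystem (Htilde S.N S.B S.D)
    (fun x => phi0 S.B S.D x ^ 2) (fun n => S.E n) (fun n x => S.P n x) := by
  have hmem : ∀ n : Lattice S.N, Summable fun x : Lattice S.N => phi0 S.B S.D x ^ 2 * S.P n x ^ 2 :=
    fun n => (h.norm n n).summable.congr fun x => by ring
  have htotal : ∀ u : Lattice S.N → ℝ,
      (Summable fun x : Lattice S.N => phi0 S.B S.D x ^ 2 * u x ^ 2) →
      (∀ n : Lattice S.N, ∑' x : Lattice S.N, phi0 S.B S.D x ^ 2 * S.P n x * u x = 0) →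
      u = 0 := by
    intro u hu h0
    have hu' : Summable fun x : Lattice S.N => (phi0 S.B S.D x * u x) ^ 2 :=
      hu.congr fun x => by ring
    funext x
    have h1 := h.expansion hu' x
    have h2 : ∀ n : Lattice S.N,
        ∑' y : Lattice S.N, S.phihat n y * (phi0 S.B S.D y * u y) = 0 := fun n => by
      rw [← mul_zero (√(S.dsq n)), ← h0 n, ← tsum_mul_left]
      exact tsum_congr fun y => by simp only [phihat]; ring
    simp only [h2, zero_mul] at h1
    have := h1.unique hasSum_zero
    exact (mul_eq_zero.1 this).resolve_left (phi0_pos h.isBirthDeath x).ne'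
  refine
    { ne_zero := fun n h0 => ?_
      mem := hmem
      eigen := fun n => funext fun x => (act_Htilde h.isBirthDeath (S.P n) x).trans
        (h.difference_eq n x)
      simple := h.E_injective
      orthogonal := fun n m hnm => by simpa [hnm] using h.norm n m
      total := htotal
      all := fun e u hu0 hu he => ?_ }
  · have := congrFun h0 ⟨0, zero_le⟩
    rw [h.P_at_zero] at this
    exact one_ne_zero this
  · set v : ℕ → ℝ := fun k => if hk : (k : ℕ∞) ≤ S.N then u ⟨k, hk⟩ else 0 with hv
    have huv : u = fun x : Lattice S.N => v x := funext fun x => by simp [hv, x.2]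
    have hev : ∀ x : Lattice S.N, diffOp S.B S.D v x = e * v x := fun x => by
      rw [← act_Htilde h.isBirthDeath, ← huv, he, huv]
      rfl
    obtain ⟨M, hM⟩ := h.bounded
    have horth : ∀ n : Lattice S.N, S.E n ≠ e →
        HasSum (fun x : Lattice S.N => phi0 S.B S.D x ^ 2 * S.P n x * u x) 0 := fun n hn => by
      conv => enter [1, x]; rw [huv]
      exact hasSum_mul_eq_zero (w := fun x => phi0 S.B S.D x ^ 2) h.isBirthDeath hM
        (fun x => sq_nonneg _) (fun x hx => phi0_sq_succ h.isBirthDeath hx)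
        (h.difference_eq n) hev hn (hmem n) (by rw [huv] at hu; exact hu)
    have hex : ∃ n : Lattice S.N, S.E n = e := by
      by_contra hcon
      exact hu0 (htotal u hu fun n => (horth n fun hn => hcon ⟨n, hn⟩).tsum_eq)
    obtain ⟨n, rfl⟩ := hex
    refine ⟨n, rfl, S.dsq n * ∑' x : Lattice S.N, phi0 S.B S.D x ^ 2 * S.P n x * u x, ?_⟩
    set c := S.dsq n * ∑' x : Lattice S.N, phi0 S.B S.D x ^ 2 * S.P n x * u x with hc
    have hs : ∀ m : Lattice S.N, Summable fun x : Lattice S.N =>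
        phi0 S.B S.D x ^ 2 * S.P m x * u x := fun m =>
      summable_mul_of_sq (fun x => sq_nonneg _) (hmem m) hu
    have h0 := htotal (fun x => u x - c * S.P n x) ?_ fun m => ?_
    · funext x
      have := congrFun h0 x
      rw [Pi.smul_apply, smul_eq_mul]
      simpa [sub_eq_zero] using this
    · have h1 := (hs n).mul_left (-2 * c)
      refine ((hu.add ((hmem n).mul_left (c ^ 2))).add h1).congr fun x => ?_
      ring
    · have h1 := ((hs m).hasSum.sub ((h.norm m n).mul_left c))
      refine (hasSum_of_eq h1 (fun x => by ring) ?_).tsum_eq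
      split_ifs with hmn
      · subst hmn
        rw [hc]
        have := (h.dsq_pos m).ne'
        field_simp
        ring
      · rw [(horth m fun e => hmn (h.E_injective e)).tsum_eq]
        simp

lemma eigensystem_symm (h : S.IsDiagonalized) : IsCompleteEigensystem (Hsymm S.N S.B S.D)
    (fun _ => 1) (fun n => S.E n) (fun n x => S.phihat n x) :=
  h.eigensystem.conj rowFinite_Htilde (g := fun x => phi0 S.B S.D x)
    (fun x => (phi0_pos h.isBirthDeath x).ne') one_ne_zero (β := 0)
    (fun x y => by simp [Hsymm]) (fun x => one_mul _) (fun n => by ring)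
    (c := fun n => √(S.dsq n)) (fun n => (Real.sqrt_pos.2 (h.dsq_pos n)).ne')
    fun n x => by simp only [phihat]; ring

lemma eigensystem_gen_smul (h : S.IsDiagonalized) {A : Matrix (Lattice S.N) (Lattice S.N) ℝ}
    {α β : ℝ} (hα : α ≠ 0) (hA : A = β • 1 + α • S.LBD) :
    IsCompleteEigensystem A (fun x => (phi0 S.B S.D x ^ 2)⁻¹) (fun n => β - α * S.E n)
      (fun n x => S.phihat 0 x * S.phihat n x) := by
  have hφ := fun x : Lattice S.N => (phi0_pos h.isBirthDeath x).ne'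
  refine h.eigensystem.conj rowFinite_Htilde (g := fun x => phi0 S.B S.D x ^ 2)
    (fun x => pow_ne_zero 2 (hφ x)) (α := -α) (neg_ne_zero.2 hα) (β := β)
    (fun x y => ?_) (fun x => ?_) (fun n => by ring)
    (c := fun n => √S.d0sq * √(S.dsq n)) (fun n => mul_ne_zero (Real.sqrt_pos.2 h.d0sq_pos).ne'
      (Real.sqrt_pos.2 (h.dsq_pos n)).ne')
    fun n x => by rw [h.phihat_zero]; simp only [phihat]; ring
  · rw [hA, Matrix.add_apply, Matrix.smul_apply, Matrix.smul_apply, LBD, gen_eq h.isBirthDeath,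
      smul_eq_mul, smul_eq_mul]
    have := hφ y
    by_cases e : x = y
    · subst e
      field_simp
      ring
    · rw [Matrix.one_apply_ne e]
      ring
  · have := hφ x
    field_simp

lemma eigensystem_LBD (h : S.IsDiagonalized) : IsCompleteEigensystem S.LBD
    (fun x => (phi0 S.B S.D x ^ 2)⁻¹) (fun n => -S.E n)
    (fun n x => S.phihat 0 x * S.phihat n x) := by
  have := h.eigensystem_gen_smul (A := S.LBD) (α := 1) (β := 0) one_ne_zero (by simp)
  simpa using this

lemma L_eq (S : Data) (t : ℝ) : S.L t = 1 + t • S.LBD := trans_eq _ _ _ _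

lemma eigensystem_L (h : S.IsDiagonalized) {t : ℝ} (ht : t ≠ 0) : IsCompleteEigensystem (S.L t)
    (fun x => (phi0 S.B S.D x ^ 2)⁻¹) (fun n => S.kappa t n)
    (fun n x => S.phihat 0 x * S.phihat n x) :=
  h.eigensystem_gen_smul (A := S.L t) (α := t) (β := 1) ht (by rw [L_eq, one_smul])

/-! ### Spectral representations -/

lemma act_stat (h : S.IsDiagonalized) : act S.LBD (fun x => S.stat x) = 0 := by
  have := h.eigensystem_LBD.eigen ⟨0, zero_le⟩
  simp only [h.phihat_zero_sq, h.E_zero] at this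
  simpa using this

lemma act_L_stat (h : S.IsDiagonalized) {t : ℝ} (ht : t ≠ 0) :
    act (S.L t) (fun x => S.stat x) = fun x : Lattice S.N => S.stat x := by
  have := (h.eigensystem_L ht).eigen ⟨0, zero_le⟩
  simp only [h.phihat_zero_sq, kappa, h.E_zero] at this
  simpa using this

lemma rowFinite_L (S : Data) (t : ℝ) : RowFinite (S.L t) := rowFinite_trans

/-- A matrix acts on an expansion in eigenvectors by multiplication with the eigenvalues. -/
lemma hasSum_act_eigen {A : Matrix (Lattice S.N) (Lattice S.N) ℝ} (hA : RowFinite A)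
    {wt ev : Lattice S.N → ℝ} {f : Lattice S.N → Lattice S.N → ℝ}
    (he : IsCompleteEigensystem A wt ev f) {c v : Lattice S.N → ℝ}
    (hv : ∀ x, HasSum (fun n => c n * f n x) (v x)) (x : Lattice S.N) :
    HasSum (fun n => c n * ev n * f n x) (act A v x) := by
  refine hasSum_of_eq (hA.hasSum_act_apply hv x) (fun n => ?_) rfl
  rw [hA.act_smul, he.eigen n, Pi.smul_apply, smul_eq_mul]
  ring

lemma spectral_symm (h : S.IsDiagonalized) (x y : Lattice S.N) :
    HasSum (fun n : Lattice S.N => S.E n * S.phihat n x * S.phihat n y)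
      (Hsymm S.N S.B S.D x y) := by
  exact hasSum_of_eq (hasSum_act_eigen rowFinite_Hsymm h.eigensystem_symm
    (c := fun n => S.phihat n y) (fun z => hasSum_of_eq (h.dual z y) (fun n => by ring) rfl) x)
    (fun n => by ring) (act_single _ x y).symm

/-- The expansion of a point mass. -/
lemma hasSum_pointMass (h : S.IsDiagonalized) (x y : Lattice S.N) :
    HasSum (fun n : Lattice S.N => S.phihat n y * (S.phihat 0 y)⁻¹ *
      (S.phihat 0 x * S.phihat n x)) (if x = y then 1 else 0) := by
  refine hasSum_of_eq ((h.dual x y).mul_left (S.phihat 0 x * (S.phihat 0 y)⁻¹))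
    (fun n => by ring) ?_
  split_ifs with e
  · subst e
    have := (h.phihat_zero_pos x).ne'
    field_simp
  · simp

/-- The two forms of the terms of a spectral representation agree. -/
lemma spectral_term (h : S.IsDiagonalized) (n x y : Lattice S.N) (e : ℝ) :
    S.stat x * (e * (S.dsq n / S.dsq 0) * S.P n x * S.P n y) =
      S.phihat 0 x * (e * S.phihat n x * S.phihat n y) * (S.phihat 0 y)⁻¹ := by
  have h1 := (Real.sqrt_pos.2 h.d0sq_pos).ne'
  have h2 := (phi0_pos h.isBirthDeath y).ne'
  have h3 := Real.mul_self_sqrt h.d0sq_pos.le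
  have h4 := Real.mul_self_sqrt (h.dsq_pos n).le
  have h5 := h.d0sq_pos.ne'
  rw [h.phihat_zero, h.phihat_zero, stat, h.dsq_zero]
  simp only [phihat]
  field_simp
  rw [pow_two √(S.dsq n), h4]
  ring

lemma spectral_LBD (h : S.IsDiagonalized) (x y : Lattice S.N) :
    HasSum (fun n : Lattice S.N =>
      -(S.phihat 0 x * (S.E n * S.phihat n x * S.phihat n y) * (S.phihat 0 y)⁻¹))
      (S.LBD x y) := by
  exact hasSum_of_eq (hasSum_act_eigen (A := S.LBD) rowFinite_gen h.eigensystem_LBD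
    (fun z => h.hasSum_pointMass z y) x) (fun n => by ring)
    (act_single _ x y).symm

lemma spectral_L (h : S.IsDiagonalized) {t : ℝ} (ht : t ≠ 0) (x y : Lattice S.N) :
    HasSum (fun n : Lattice S.N =>
      S.phihat 0 x * (S.kappa t n * S.phihat n x * S.phihat n y) * (S.phihat 0 y)⁻¹)
      (S.L t x y) := by
  exact hasSum_of_eq (hasSum_act_eigen (rowFinite_L S t) (h.eigensystem_L ht)
    (fun z => h.hasSum_pointMass z y) x) (fun n => by ring)
    (act_single _ x y).symm

/-- The expansion of an initial distribution. -/
lemma expansion_prob (h : S.IsDiagonalized) {p : Lattice S.N → ℝ} (hp : IsProb p)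
    (hp2 : S.Expandable p) :
    (∀ n : Lattice S.N,
      Summable fun x : Lattice S.N => S.phihat n x * (S.phihat 0 x)⁻¹ * p x) ∧
    S.coeff p 0 = 1 ∧
    ∀ x : Lattice S.N, HasSum (fun n : Lattice S.N =>
      S.coeff p n * (S.phihat 0 x * S.phihat n x)) (p x) := by
  refine ⟨fun n => ?_, ?_, fun x => ?_⟩
  · have := summable_mul_of_sq (w := fun _ : Lattice S.N => (1 : ℝ)) (fun _ => zero_le_one)
      ((h.summable_phihat_sq n).congr fun x => (one_mul _).symm)
      (hp2.congr fun x => (one_mul _).symm)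
    refine this.congr fun x => ?_
    ring
  · refine (hasSum_of_eq hp.sum_eq_one (fun x => ?_) rfl).tsum_eq
    have := (h.phihat_zero_pos x).ne'
    field_simp
  · have := (h.phihat_zero_pos x).ne'
    refine hasSum_of_eq ((h.expansion hp2 x).mul_left (S.phihat 0 x)) (fun n => ?_)
      (by field_simp)
    rw [coeff, tsum_congr fun y : Lattice S.N => show S.phihat n y * (S.phihat 0 y)⁻¹ * p y =
      S.phihat n y * (p y / S.phihat 0 y) by ring]
    ring

/-- The spectral data of a diagonalized birth and death process. -/
lemma isSpectralData (h : S.IsDiagonalized) (heta : S.eta 0 = 0)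
    (hpoly : ∀ n : Lattice S.N, ∃ p : Polynomial ℝ, p.degree = (n.1 : WithBot ℕ) ∧
      ∀ x : Lattice S.N, S.P n x = p.eval (S.eta x))
    (hphi : ∀ x : Lattice S.N, phi0 S.B S.D x ^ 2 = S.phi0sq x) : S.IsSpectralData where
  isBirthDeath := h.isBirthDeath
  bounded := h.bounded
  eta_zero := heta
  polynomial := hpoly
  P_at_zero := h.P_at_zero
  difference_eq := h.difference_eq
  E_zero := h.E_zero
  E_pos := h.E_pos
  phi0_sq x := ⟨by rw [← hphi]; exact pow_pos (phi0_pos h.isBirthDeath x) 2, hphi x⟩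
  d0_sq := ⟨h.d0sq_pos, h.dratio_zero, h.hasSum_phi0_sq⟩
  d_sq_pos := h.dsq_pos
  norm := by simpa only [hphi] using h.norm
  eigensystem := by simpa only [hphi] using h.eigensystem
  eigensystem_symm := h.eigensystem_symm
  orthonormal := h.orthonormal
  spectral_symm := h.spectral_symm
  stat_prob := h.stat_prob
  expansion p hp hp2 := by
    obtain ⟨h1, h2, h3⟩ := h.expansion_prob hp hp2
    exact ⟨h1, h2, fun x => hasSum_of_eq (h3 x) (fun n => by ring) rfl⟩

end IsDiagonalized

end Data

/-! ### Stochastic matrices -/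

section Matrices

variable {N : ℕ∞} {A : Matrix (Lattice N) (Lattice N) ℝ}

/-- A matrix with finite rows which maps probability distributions to probability
distributions. -/
structure IsStochastic (A : Matrix (Lattice N) (Lattice N) ℝ) : Prop where
  rowFinite : RowFinite A
  nonneg : ∀ x y, 0 ≤ A x y
  sum_eq_one : ∀ y, HasSum (fun x => A x y) 1

lemma IsStochastic.hasSum_act (hA : IsStochastic A) {v : Lattice N → ℝ} {s : ℝ}
    (hv : ∀ x, 0 ≤ v x) (hs : HasSum v s) : HasSum (fun x => act A v x) s := by
  have h1 : Summable fun z : Lattice N × Lattice N => A z.2 z.1 * v z.1 := by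
    refine (summable_prod_of_nonneg fun z => mul_nonneg (hA.nonneg _ _) (hv _)).2
      ⟨fun y => (hA.sum_eq_one y).summable.mul_right (v y), hs.summable.congr fun y => ?_⟩
    change v y = ∑' x, A x y * v y
    rw [tsum_mul_right, (hA.sum_eq_one y).tsum_eq, one_mul]
  have h2 := h1.hasSum.prod_fiberwise fun y => (hA.sum_eq_one y).mul_right (v y)
  simp only [one_mul] at h2
  have h3 := h1.hasSum
  rw [h2.unique hs] at h3
  exact ((Equiv.prodComm (Lattice N) (Lattice N)).hasSum_iff.2 h3).prod_fiberwise
    fun x => hA.rowFinite.hasSum_act v x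

lemma IsStochastic.act_nonneg (hA : IsStochastic A) {v : Lattice N → ℝ} (hv : ∀ x, 0 ≤ v x)
    (x : Lattice N) : 0 ≤ act A v x :=
  tsum_nonneg fun y => mul_nonneg (hA.nonneg x y) (hv y)

lemma IsStochastic.abs_act_le (hA : IsStochastic A) (v : Lattice N → ℝ) (x : Lattice N) :
    |act A v x| ≤ act A (fun y => |v y|) x := by
  rw [hA.rowFinite.act_eq_sum, hA.rowFinite.act_eq_sum]
  refine (Finset.abs_sum_le_sum_abs _ _).trans (Finset.sum_le_sum fun y _ => ?_)
  rw [abs_mul, abs_of_nonneg (hA.nonneg x y)]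

lemma IsStochastic.isProb_act (hA : IsStochastic A) {p : Lattice N → ℝ} (hp : IsProb p) :
    IsProb (act A p) :=
  ⟨hA.act_nonneg hp.nonneg, hA.hasSum_act hp.nonneg hp.sum_eq_one⟩

lemma IsStochastic.isProb_evolve (hA : IsStochastic A) {p : Lattice N → ℝ} (hp : IsProb p)
    (ℓ : ℕ) : IsProb (evolve A p ℓ) := by
  induction ℓ with
  | zero => exact hp
  | succ ℓ ih => exact hA.isProb_act ih

lemma isProb_single (y : Lattice N) : IsProb fun z : Lattice N => if z = y then (1 : ℝ) else 0 where
  nonneg x := by split_ifs <;> norm_num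
  sum_eq_one := hasSum_ite_eq y 1

lemma IsProb.le_one {p : Lattice N → ℝ} (hp : IsProb p) (x : Lattice N) : p x ≤ 1 :=
  le_hasSum hp.sum_eq_one x fun y _ => hp.nonneg y

lemma matPow_eq_evolve (A : Matrix (Lattice N) (Lattice N) ℝ) (ℓ : ℕ) (x y : Lattice N) :
    matPow A ℓ x y = evolve A (fun z => if z = y then 1 else 0) ℓ x := by
  induction ℓ generalizing x with
  | zero => rfl
  | succ ℓ ih =>
    change ∑' z, A x z * matPow A ℓ z y = ∑' z, A x z * _
    exact tsum_congr fun z => by rw [ih]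

lemma RowFinite.hasSum_matPow (hA : RowFinite A) (p : Lattice N → ℝ) (ℓ : ℕ) (x : Lattice N) :
    HasSum (fun y => matPow A ℓ x y * p y) (evolve A p ℓ x) := by
  induction ℓ generalizing x with
  | zero =>
    have := hasSum_single (f := fun y => matPow A 0 x y * p y) x fun y hy => by
      rw [matPow, Matrix.one_apply_ne hy.symm, zero_mul]
    simpa [matPow, evolve] using this
  | succ ℓ ih =>
    refine hasSum_of_eq (hA.hasSum_act_apply ih x) (fun y => ?_) rfl
    rw [act, matPow, ← tsum_mul_right]
    exact tsum_congr fun z => by ring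

lemma hasSum_trans {B D : ℕ → ℝ} (hbd : IsBirthDeath N B D) (y : Lattice N) :
    HasSum (fun x => trans N B D x y) 1 := by
  have h1 := hasSum_lattice_ite (N := N) (y.1 + 1) fun _ => B y
  have h2 := hasSum_lattice_ite (N := N) (y.1 - 1) fun _ => D y
  have h3 := hasSum_lattice_ite (N := N) y.1 fun _ => 1 - B y - D y
  refine hasSum_of_eq ((h1.add h2).add h3) (fun x => ?_) ?_
  · simp only [trans, Subtype.ext_iff]
    rcases Nat.eq_zero_or_pos y.1 with h0 | h0
    · rw [h0, hbd.death_zero]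
      split_ifs <;> first | contradiction | omega | simp
    · split_ifs <;> first | omega | simp
  · have hle : ((y.1 - 1 : ℕ) : ℕ∞) ≤ N := le_trans (Nat.cast_le.2 (Nat.sub_le _ _)) y.2
    rw [if_pos y.2, if_pos hle]
    split_ifs with h
    · ring
    · have : (y.1 : ℕ∞) = N := by
        refine le_antisymm y.2 ?_
        rw [not_le] at h
        exact Order.le_of_lt_add_one (by exact_mod_cast h)
      rw [hbd.birth_end y this]
      ring

end Matrices

/-! ### The process in discrete time -/

namespace Data.IsDiagonalized

variable {S : Data}

lemma isBirthDeath_smul (h : S.IsDiagonalized) {t : ℝ} (ht : 0 < t) :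
    IsBirthDeath S.N (fun x => t * S.B x) (fun x => t * S.D x) where
  birth_pos x hx := mul_pos ht (h.isBirthDeath.birth_pos x hx)
  birth_end x hx := by simp only [h.isBirthDeath.birth_end x hx, mul_zero]
  death_pos x hx := mul_pos ht (h.isBirthDeath.death_pos x hx)
  death_zero := by simp only [h.isBirthDeath.death_zero, mul_zero]

lemma isStochastic_L (h : S.IsDiagonalized) {t : ℝ} (ht : 0 < t)
    (ht1 : ∀ x : Lattice S.N, t * (S.B x + S.D x) < 1) : IsStochastic (S.L t) where
  rowFinite := rowFinite_L S t
  nonneg x y := by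
    have h1 := mul_nonneg ht.le (h.isBirthDeath.birth_nonneg y)
    have h2 := mul_nonneg ht.le (h.isBirthDeath.death_nonneg y)
    have h3 := ht1 y
    simp only [L, trans]
    split_ifs
    · exact h1
    · exact h2
    · linarith
    · exact le_rfl
  sum_eq_one y := hasSum_trans (h.isBirthDeath_smul ht) y

/-- Eigenvalues of the transition matrix are at least `-1`; as there is a positive probability to
stay at each point, `-1` is no eigenvalue with summable eigenvector. -/
lemma neg_one_lt_kappa (h : S.IsDiagonalized) {t : ℝ} (ht : 0 < t)
    (ht1 : ∀ x : Lattice S.N, t * (S.B x + S.D x) < 1) (n : Lattice S.N) :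
    -1 < S.kappa t n := by
  by_contra hκ
  rw [not_lt] at hκ
  have hL := h.isStochastic_L ht ht1
  set u : Lattice S.N → ℝ := fun x => S.phihat 0 x * S.phihat n x with hu
  have hs : Summable fun x => |u x| := by
    refine (h.orthonormal ⟨0, zero_le⟩ n).summable.abs
  have he : ∀ x, act (S.L t) u x = S.kappa t n * u x := fun x =>
    congrFun ((h.eigensystem_L ht.ne').eigen n) x
  have hdiag : ∀ x, S.L t x x = 1 - t * S.B x - t * S.D x := fun x => by simp [L, trans]
  have key : ∀ x, |u x| + 2 * S.L t x x * |u x| ≤ act (S.L t) (fun y => |u y|) x := by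
    intro x
    have h1 := hL.rowFinite.hasSum_act u x
    have h2 := hL.rowFinite.hasSum_act (fun y => |u y|) x
    -- remove the diagonal term from both sums
    have h3 := (h1.sub (hasSum_ite_eq x (S.L t x x * u x)))
    have h4 := (h2.sub (hasSum_ite_eq x (S.L t x x * |u x|)))
    have h5 : |act (S.L t) u x - S.L t x x * u x| ≤
        act (S.L t) (fun y => |u y|) x - S.L t x x * |u x| := by
      rw [abs_le]
      constructor
      · rw [neg_le]
        refine hasSum_le (fun y => ?_) h3.neg h4
        split_ifs with e
        · subst e; simp
        · have := mul_le_mul_of_nonneg_left (neg_le_abs (u y)) (hL.nonneg x y)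
          simpa using this
      · refine hasSum_le (fun y => ?_) h3 h4
        split_ifs with e
        · subst e; simp
        · simpa using mul_le_mul_of_nonneg_left (le_abs_self (u y)) (hL.nonneg x y)
    have h6 : |act (S.L t) u x - S.L t x x * u x| = (-S.kappa t n + S.L t x x) * |u x| := by
      rw [he, ← sub_mul, abs_mul, abs_of_neg]
      · ring
      · rw [hdiag]; linarith [ht1 x]
    rw [h6] at h5
    nlinarith [abs_nonneg (u x)]
  have hsum := hL.hasSum_act (fun x => abs_nonneg (u x)) hs.hasSum
  have h7 : ∀ x, 2 * S.L t x x * |u x| ≤ act (S.L t) (fun y => |u y|) x - |u x| := fun x => by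
    linarith [key x]
  have h8 := hsum.sub hs.hasSum
  rw [sub_self] at h8
  have h9 : ∀ x, 0 ≤ 2 * S.L t x x * |u x| := fun x =>
    mul_nonneg (mul_nonneg zero_le_two (hL.nonneg x x)) (abs_nonneg _)
  have h10 : ∀ x, act (S.L t) (fun y => |u y|) x - |u x| = 0 := fun x =>
    congrFun ((hasSum_zero_iff_of_nonneg fun x => (h9 x).trans (h7 x)).1 h8) x
  set z : Lattice S.N := ⟨0, zero_le⟩ with hz
  have h11 := h7 z
  rw [h10] at h11
  have h12 : 0 < |u z| := by
    refine abs_pos.2 (mul_ne_zero (h.phihat_zero_pos z).ne' ?_)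
    rw [phihat, h.P_at_zero, mul_one]
    exact mul_ne_zero (Real.sqrt_pos.2 (h.dsq_pos n)).ne' (phi0_pos h.isBirthDeath z).ne'
  have h13 : 0 < S.L t z z := by rw [hdiag]; linarith [ht1 z]
  have := mul_pos (mul_pos two_pos h13) h12
  linarith

lemma kappa_le_one (h : S.IsDiagonalized) {t : ℝ} (ht : 0 < t) (n : Lattice S.N) :
    S.kappa t n ≤ 1 := by
  by_cases hn : n.1 = 0
  · rw [kappa, hn, h.E_zero]; simp
  · rw [kappa]
    linarith [mul_pos ht (h.E_pos n hn)]

lemma abs_kappa_le_one (h : S.IsDiagonalized) {t : ℝ} (ht : 0 < t)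
    (ht1 : ∀ x : Lattice S.N, t * (S.B x + S.D x) < 1) (n : Lattice S.N) :
    |S.kappa t n| ≤ 1 :=
  abs_le.2 ⟨(h.neg_one_lt_kappa ht ht1 n).le, h.kappa_le_one ht n⟩

/-- The expansion of the distribution after `ℓ` steps. -/
lemma hasSum_evolve (h : S.IsDiagonalized) {t : ℝ} (ht : t ≠ 0) {p c : Lattice S.N → ℝ}
    (hp : ∀ x : Lattice S.N,
      HasSum (fun n : Lattice S.N => c n * (S.phihat 0 x * S.phihat n x)) (p x))
    (ℓ : ℕ) (x : Lattice S.N) :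
    HasSum (fun n : Lattice S.N => c n * S.kappa t n ^ ℓ * (S.phihat 0 x * S.phihat n x))
      (evolve (S.L t) p ℓ x) := by
  induction ℓ generalizing x with
  | zero => simpa [evolve] using hp x
  | succ ℓ ih =>
    exact hasSum_of_eq (hasSum_act_eigen (rowFinite_L S t) (h.eigensystem_L ht)
      (c := fun n => c n * S.kappa t n ^ ℓ) ih x) (fun n => by ring) rfl

lemma tendsto_matPow (h : S.IsDiagonalized) {t : ℝ} (ht : 0 < t)
    (ht1 : ∀ x : Lattice S.N, t * (S.B x + S.D x) < 1) (x y : Lattice S.N) :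
    Tendsto (fun ℓ => matPow (S.L t) ℓ x y) atTop (𝓝 (S.stat x)) := by
  have h1 := fun ℓ => h.hasSum_evolve ht.ne' (fun x => h.hasSum_pointMass x y) ℓ x
  have h2 : ∀ ℓ, matPow (S.L t) ℓ x y = ∑' n : Lattice S.N,
      S.phihat n y * (S.phihat 0 y)⁻¹ * S.kappa t n ^ ℓ * (S.phihat 0 x * S.phihat n x) :=
    fun ℓ => by rw [matPow_eq_evolve, (h1 ℓ).tsum_eq]
  simp only [h2]
  set z : Lattice S.N := ⟨0, zero_le⟩ with hz
  have h3 : HasSum (fun n : Lattice S.N => if n = z then S.stat x else 0) (S.stat x) :=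
    hasSum_ite_eq z _
  rw [← h3.tsum_eq]
  refine tendsto_tsum_of_dominated_convergence (h.hasSum_pointMass x y).summable.abs (fun n => ?_)
    (Eventually.of_forall fun ℓ n => ?_)
  · split_ifs with e
    · rw [e]
      have : ∀ ℓ : ℕ, S.phihat z y * (S.phihat 0 y)⁻¹ * S.kappa t z ^ ℓ *
          (S.phihat 0 x * S.phihat z x) = S.stat x := fun ℓ => by
        have := (h.phihat_zero_pos y).ne'
        rw [← h.phihat_zero_sq]
        simp only [hz, kappa, h.E_zero]
        field_simp
        simp
      simp only [this]
      exact tendsto_const_nhds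
    · have hn : n.1 ≠ 0 := fun hn => e (Subtype.ext hn)
      have hκ : |S.kappa t n| < 1 := abs_lt.2 ⟨h.neg_one_lt_kappa ht ht1 n, by
        rw [kappa]; linarith [mul_pos ht (h.E_pos n hn)]⟩
      have := ((tendsto_pow_atTop_nhds_zero_of_abs_lt_one hκ).const_mul
        (S.phihat n y * (S.phihat 0 y)⁻¹)).mul_const (S.phihat 0 x * S.phihat n x)
      simpa using this
  · rw [Real.norm_eq_abs, mul_right_comm, abs_mul _ (S.kappa t n ^ ℓ), abs_pow]
    exact mul_le_of_le_one_right (abs_nonneg _)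
      (pow_le_one₀ (abs_nonneg _) (h.abs_kappa_le_one ht ht1 n))

lemma tendsto_evolve (h : S.IsDiagonalized) {t : ℝ} (ht : 0 < t)
    (ht1 : ∀ x : Lattice S.N, t * (S.B x + S.D x) < 1) {p : Lattice S.N → ℝ} (hp : IsProb p)
    (x : Lattice S.N) : Tendsto (fun ℓ => evolve (S.L t) p ℓ x) atTop (𝓝 (S.stat x)) := by
  have hL := h.isStochastic_L ht ht1
  simp only [fun ℓ => (hL.rowFinite.hasSum_matPow p ℓ x).tsum_eq.symm]
  have h3 := hp.sum_eq_one.mul_left (S.stat x)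
  rw [mul_one] at h3
  rw [← h3.tsum_eq]
  refine tendsto_tsum_of_dominated_convergence hp.sum_eq_one.summable
    (fun y => (h.tendsto_matPow ht ht1 x y).mul_const (p y))
    (Eventually.of_forall fun ℓ y => ?_)
  have h4 := hL.isProb_evolve (isProb_single y) ℓ
  rw [matPow_eq_evolve, Real.norm_eq_abs, abs_of_nonneg (mul_nonneg (h4.nonneg x) (hp.nonneg y))]
  exact mul_le_of_le_one_left (hp.nonneg y) (h4.le_one x)

lemma solvesDiscrete (h : S.IsDiagonalized)
    (hphi : ∀ x : Lattice S.N, phi0 S.B S.D x ^ 2 = S.phi0sq x) {t : ℝ} (ht : 0 < t)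
    (ht1 : ∀ x : Lattice S.N, t * (S.B x + S.D x) < 1) : S.SolvesDiscrete t where
  isBirthDeath := h.isBirthDeath_smul ht
  nonneg := (h.isStochastic_L ht ht1).nonneg
  sum_eq_one := (h.isStochastic_L ht ht1).sum_eq_one
  eq_one_add := L_eq S t
  eigensystem := by simpa only [hphi] using h.eigensystem_L ht.ne'
  stationary := h.act_L_stat ht.ne'
  steps p hp ℓ := ⟨(h.isStochastic_L ht ht1).isProb_evolve hp ℓ,
    (rowFinite_L S t).hasSum_matPow p ℓ⟩
  initial_value p hp hp2 ℓ x := hasSum_of_eq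
    (h.hasSum_evolve ht.ne' (h.expansion_prob hp hp2).2.2 ℓ x) (fun n => by ring) rfl
  transition ℓ x y := hasSum_of_eq
    (h.hasSum_evolve ht.ne' (fun x => h.hasSum_pointMass x y) ℓ x) (fun n => by ring)
    (matPow_eq_evolve _ _ _ _)
  limit p hp := h.tendsto_evolve ht ht1 hp
  limit_transition := h.tendsto_matPow ht ht1
  spectral x y := ⟨h.spectral_L ht.ne' x y,
    hasSum_of_eq (h.spectral_L ht.ne' x y) (fun n => h.spectral_term n x y _) rfl⟩

end Data.IsDiagonalized

/-! ### Poisson mixtures -/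

/-- The Poisson weights `e^{-s} s^k / k!`. -/
def poissonWeight (s : ℝ) (k : ℕ) : ℝ := Real.exp (-s) * (s ^ k / k.factorial)

/-- The mean of a sequence with the Poisson weights. -/
def poissonMean (a : ℕ → ℝ) (s : ℝ) : ℝ := ∑' k, poissonWeight s k * a k

lemma poissonWeight_nonneg {s : ℝ} (hs : 0 ≤ s) (k : ℕ) : 0 ≤ poissonWeight s k := by
  unfold poissonWeight
  positivity

lemma hasSum_poissonWeight_mul_pow (s z : ℝ) :
    HasSum (fun k => poissonWeight s k * z ^ k) (Real.exp (-(s * (1 - z)))) := by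
  have h1 := (NormedSpace.expSeries_div_hasSum_exp (s * z)).mul_left (Real.exp (-s))
  rw [← Real.exp_eq_exp_ℝ, ← Real.exp_add] at h1
  refine hasSum_of_eq h1 (fun k => ?_) (by ring_nf)
  rw [poissonWeight, mul_pow]
  ring

lemma hasSum_poissonWeight (s : ℝ) : HasSum (poissonWeight s) 1 := by
  simpa using hasSum_poissonWeight_mul_pow s 1

lemma summable_poissonWeight_mul {a : ℕ → ℝ} (ha : ∀ k, |a k| ≤ 1) (s : ℝ) :
    Summable fun k => poissonWeight s k * a k := by
  refine Summable.of_norm_bounded (hasSum_poissonWeight s).summable.abs fun k => ?_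
  rw [Real.norm_eq_abs, abs_mul]
  exact mul_le_of_le_one_right (abs_nonneg _) (ha k)

lemma poissonMean_zero (a : ℕ → ℝ) : poissonMean a 0 = a 0 := by
  rw [poissonMean, tsum_eq_single 0]
  · simp [poissonWeight]
  · intro k hk
    simp [poissonWeight, hk]

lemma hasDerivAt_poissonMean {a : ℕ → ℝ} (ha : ∀ k, |a k| ≤ 1) (s : ℝ) :
    HasDerivAt (poissonMean a) (poissonMean (fun k => a (k + 1)) s - poissonMean a s) s := by
  have hE : ∀ (a : ℕ → ℝ) s, poissonMean a s =
      Real.exp (-s) * ∑' k : ℕ, s ^ k / k.factorial * a k := fun a s => by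
    rw [← tsum_mul_left]
    exact tsum_congr fun k => by rw [poissonWeight]; ring
  have hF : HasDerivAt (fun s : ℝ => ∑' k : ℕ, s ^ k / k.factorial * a k)
      (∑' k : ℕ, s ^ k / k.factorial * a (k + 1)) s := by
    set R : ℝ := |s| + 1 with hR
    have hR0 : 0 < R := by positivity
    have h1 : Summable fun k : ℕ => R ^ (k - 1) * (k / k.factorial) := by
      rw [← summable_nat_add_iff 1]
      refine (NormedSpace.expSeries_div_summable R).congr fun k => ?_
      rw [Nat.add_sub_cancel, Nat.factorial_succ]
      push_cast
      have := Nat.cast_add_one_ne_zero (R := ℝ) k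
      field_simp
    have h2 := hasDerivAt_tsum_of_isPreconnected (𝕜 := ℝ) (t := Metric.ball 0 R)
      (g := fun (k : ℕ) (s : ℝ) => s ^ k / k.factorial * a k)
      (g' := fun (k : ℕ) (s : ℝ) => k * s ^ (k - 1) / k.factorial * a k) (y₀ := 0) (y := s)
      h1 Metric.isOpen_ball (convex_ball (0 : ℝ) R).isPreconnected
      (fun k y _ => ((hasDerivAt_pow k y).div_const _).mul_const _) (fun k y hy => ?_)
      (Metric.mem_ball_self hR0) ?_ (by simp [hR])
    · refine h2.congr_deriv ?_
      have h3 : Summable fun k : ℕ => (k : ℝ) * s ^ (k - 1) / k.factorial * a k := by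
        refine Summable.of_norm_bounded h1 fun k => ?_
        rw [Real.norm_eq_abs, abs_mul, abs_div, abs_mul, abs_pow, Nat.abs_cast, Nat.abs_cast]
        refine (mul_le_of_le_one_right (by positivity) (ha k)).trans ?_
        rw [mul_comm (k : ℝ), mul_div_assoc]
        gcongr
        simp [hR]
      rw [h3.tsum_eq_zero_add]
      simp only [Nat.cast_zero, zero_mul, zero_div, zero_add]
      refine tsum_congr fun k => ?_
      rw [Nat.add_sub_cancel, Nat.factorial_succ]
      push_cast
      have := Nat.cast_add_one_ne_zero (R := ℝ) k
      field_simp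
    · rw [Metric.mem_ball, dist_zero_right, Real.norm_eq_abs] at hy
      rw [Real.norm_eq_abs, abs_mul, abs_div, abs_mul, abs_pow, Nat.abs_cast, Nat.abs_cast]
      refine (mul_le_of_le_one_right (by positivity) (ha k)).trans ?_
      rw [mul_comm (k : ℝ), mul_div_assoc]
      gcongr
    · refine summable_of_ne_finset_zero (s := {0}) fun k hk => ?_
      rw [Finset.mem_singleton] at hk
      simp [hk]
  have h1 : HasDerivAt (fun s : ℝ => Real.exp (-s)) (-Real.exp (-s)) s := by
    simpa using (hasDerivAt_neg s).exp
  have h2 := h1.mul hF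
  rw [hE (fun k => a (k + 1)) s, hE a s, show poissonMean a = _ from funext (hE a)]
  refine h2.congr_deriv ?_
  ring

/-- Borel summation is regular: the Poisson means of a convergent sequence have the same limit. -/
lemma tendsto_poissonMean {a : ℕ → ℝ} {l : ℝ} (ha : ∀ k, |a k| ≤ 1)
    (hl : Tendsto a atTop (𝓝 l)) : Tendsto (poissonMean a) atTop (𝓝 l) := by
  have hl1 : |l| ≤ 1 := le_of_tendsto hl.abs (Eventually.of_forall ha)
  rw [Metric.tendsto_atTop]
  intro ε hε
  obtain ⟨K, hK⟩ := Metric.tendsto_atTop.1 hl (ε / 2) (half_pos hε)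
  have h0 : Tendsto (fun s => ∑ k ∈ Finset.range K, poissonWeight s k * 2) atTop (𝓝 0) := by
    have : ∀ k ∈ Finset.range K, Tendsto (fun s => poissonWeight s k * 2) atTop (𝓝 0) := by
      intro k _
      have := ((Real.tendsto_pow_mul_exp_neg_atTop_nhds_zero k).div_const
        (k.factorial : ℝ)).mul_const 2
      rw [zero_div, zero_mul] at this
      refine this.congr fun s => ?_
      rw [poissonWeight]
      ring
    simpa using tendsto_finsetSum _ this
  obtain ⟨s₀, hs₀⟩ := (Metric.tendsto_atTop.1 h0 (ε / 2) (half_pos hε))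
  refine ⟨max s₀ 0, fun s hs => ?_⟩
  have hs0 : 0 ≤ s := (le_max_right _ _).trans hs
  have h1 := hs₀ s ((le_max_left _ _).trans hs)
  rw [Real.dist_eq, sub_zero] at h1
  have h2 : poissonMean a s - l = ∑' k, poissonWeight s k * (a k - l) := by
    have h3 := (hasSum_poissonWeight s).mul_right l
    rw [one_mul] at h3
    exact (hasSum_of_eq ((summable_poissonWeight_mul ha s).hasSum.sub h3)
      (fun k => by ring) rfl).tsum_eq.symm
  rw [Real.dist_eq, h2]
  have hb : ∀ k, |poissonWeight s k * (a k - l)| ≤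
      (if k ∈ Finset.range K then poissonWeight s k * 2 else 0) + poissonWeight s k * (ε / 2) := by
    intro k
    have hw := poissonWeight_nonneg hs0 k
    rw [abs_mul, abs_of_nonneg hw]
    split_ifs with hk
    · have : |a k - l| ≤ 2 := by
        have := abs_sub (a k) l
        linarith [ha k]
      nlinarith
    · rw [zero_add]
      rw [Finset.mem_range, not_lt] at hk
      have := hK k hk
      rw [Real.dist_eq] at this
      exact mul_le_mul_of_nonneg_left this.le hw
  have hS : HasSum (fun k => (if k ∈ Finset.range K then poissonWeight s k * 2 else 0) +
      poissonWeight s k * (ε / 2))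
      (∑ k ∈ Finset.range K, poissonWeight s k * 2 + 1 * (ε / 2)) := by
    refine HasSum.add ?_ ((hasSum_poissonWeight s).mul_right _)
    have : HasSum (fun k => if k ∈ Finset.range K then poissonWeight s k * 2 else 0)
        (∑ k ∈ Finset.range K, if k ∈ Finset.range K then poissonWeight s k * 2 else 0) :=
      hasSum_sum_of_ne_finset_zero fun k hk => if_neg hk
    rwa [Finset.sum_ite_mem, Finset.inter_self] at this
  have h5 := tsum_of_norm_bounded (f := fun k => poissonWeight s k * (a k - l)) hS hb
  rw [Real.norm_eq_abs] at h5
  have := le_abs_self (∑ k ∈ Finset.range K, poissonWeight s k * 2)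
  linarith

/-- A mixture of probability distributions is a probability distribution. -/
lemma hasSum_mixture {ι κ : Type*} {w : ι → ℝ} {f : ι → κ → ℝ} (hw : ∀ k, 0 ≤ w k)
    (hw1 : HasSum w 1) (hf : ∀ k x, 0 ≤ f k x) (hf1 : ∀ k, HasSum (f k) 1) :
    HasSum (fun x => ∑' k, w k * f k x) 1 := by
  have h0 : ∀ k, HasSum (fun x => w k * f k x) (w k) := fun k => by
    simpa using (hf1 k).mul_left (w k)
  have h1 : Summable fun z : ι × κ => w z.1 * f z.1 z.2 := by
    rw [summable_prod_of_nonneg fun z => mul_nonneg (hw z.1) (hf z.1 z.2)]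
    refine ⟨fun k => (h0 k).summable, ?_⟩
    simpa only [fun k => (h0 k).tsum_eq] using hw1.summable
  have h2 := h1.hasSum.prod_fiberwise h0
  have h3 := h1.hasSum
  rw [h2.unique hw1] at h3
  have h4 := (Equiv.prodComm κ ι).hasSum_iff.2 h3
  exact h4.prod_fiberwise fun x => (h4.summable.prod_factor x).hasSum

/-! ### Uniqueness in continuous time -/

section Matrices

variable {N : ℕ∞} {A : Matrix (Lattice N) (Lattice N) ℝ}

/-- A family of functions with bounded `ℓ¹` norm that solves the evolution equation with initial
value `0` vanishes, as Picard iteration bounds its norm by `2 (2 c t)^j / j!` for all `j`. -/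
lemma IsStochastic.eq_zero_of_hasDerivWithinAt (hA : IsStochastic A) {c : ℝ} (hc : 0 ≤ c)
    {u : ℝ → Lattice N → ℝ} (h0 : u 0 = 0) (hs : ∀ t, 0 ≤ t → Summable fun x => |u t x|)
    (hb : ∀ t, 0 ≤ t → ∑' x, |u t x| ≤ 2)
    (hd : ∀ t, 0 ≤ t → ∀ x, HasDerivWithinAt (fun s => u s x) (c * (act A (u t) x - u t x))
      (Set.Ici 0) t) {t : ℝ} (ht : 0 ≤ t) (x : Lattice N) : u t x = 0 := by
  have key : ∀ j : ℕ, ∀ t, 0 ≤ t →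
      ∑' x, |u t x| ≤ 2 * (2 * c) ^ j / j.factorial * t ^ j := by
    intro j
    induction j with
    | zero => intro t ht; simpa using hb t ht
    | succ j ih =>
      intro t ht
      refine (hs t ht).tsum_le_of_sum_le fun F => ?_
      set σ : Lattice N → ℝ := fun x => if 0 ≤ u t x then 1 else -1 with hσ
      have hσ1 : ∀ x, |σ x| = 1 := fun x => by simp only [hσ]; split_ifs <;> simp
      have hσu : ∀ x, |u t x| = σ x * u t x := fun x => by
        simp only [hσ]
        split_ifs with h
        · rw [abs_of_nonneg h, one_mul]
        · rw [abs_of_neg (not_le.1 h), neg_one_mul]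
      have hf : ∀ s, 0 ≤ s → HasDerivWithinAt (fun s => ∑ x ∈ F, σ x * u s x)
          (∑ x ∈ F, σ x * (c * (act A (u s) x - u s x))) (Set.Ici 0) s := fun s hs0 =>
        HasDerivWithinAt.fun_sum fun x _ => (hd s hs0 x).const_mul (σ x)
      have hB : ∀ s : ℝ, HasDerivAt
          (fun s : ℝ => 2 * (2 * c) ^ (j + 1) / (j + 1).factorial * s ^ (j + 1))
          (2 * (2 * c) ^ (j + 1) / (j + 1).factorial * ((j + 1 : ℕ) * s ^ j)) s := fun s =>
        (hasDerivAt_pow (j + 1) s).const_mul _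
      have := image_le_of_deriv_right_le_deriv_boundary (a := 0) (b := t)
        (f := fun s => ∑ x ∈ F, σ x * u s x)
        (B := fun s => 2 * (2 * c) ^ (j + 1) / (j + 1).factorial * s ^ (j + 1))
        (fun s hs1 => ((hf s hs1.1).continuousWithinAt).mono fun r hr => hr.1)
        (fun s hs1 => (hf s hs1.1).mono (Set.Ici_subset_Ici.2 hs1.1))
        (by simp [h0]) (fun s _ => (hB s).continuousAt.continuousWithinAt)
        (fun s _ => (hB s).hasDerivWithinAt) (fun s hs1 => ?_) (Set.right_mem_Icc.2 ht)
      · rw [Finset.sum_congr rfl fun x _ => hσu x]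
        exact this
      · have e1 : ∑ x ∈ F, σ x * (c * (act A (u s) x - u s x)) ≤
            ∑ x ∈ F, c * (act A (fun y => |u s y|) x + |u s x|) := by
          refine Finset.sum_le_sum fun x _ => (le_abs_self _).trans ?_
          rw [abs_mul, hσ1, one_mul, abs_mul, abs_of_nonneg hc]
          refine mul_le_mul_of_nonneg_left ((abs_sub _ _).trans ?_) hc
          exact add_le_add (hA.abs_act_le _ _) le_rfl
        have hs' := (hs s hs1.1).hasSum
        have e2 := (((hA.hasSum_act (fun x => abs_nonneg (u s x)) hs').add hs').mul_left c)
        have e3 : ∑ x ∈ F, c * (act A (fun y => |u s y|) x + |u s x|) ≤ _ :=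
          sum_le_hasSum F (fun x _ => mul_nonneg hc (add_nonneg
            (hA.act_nonneg (fun y => abs_nonneg _) x) (abs_nonneg _))) e2
        have e4 := mul_le_mul_of_nonneg_left (ih s hs1.1) hc
        refine e1.trans (e3.trans ?_)
        have e5 : 2 * (2 * c) ^ (j + 1) / (j + 1).factorial * ((j + 1 : ℕ) * s ^ j) =
            2 * (c * (2 * (2 * c) ^ j / j.factorial * s ^ j)) := by
          rw [Nat.factorial_succ]
          push_cast
          have := Nat.cast_add_one_ne_zero (R := ℝ) j
          field_simp
          ring
        rw [e5]
        linarith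
  have h1 : Tendsto (fun j : ℕ => 2 * (2 * c) ^ j / j.factorial * t ^ j) atTop (𝓝 0) := by
    have := (FloorSemiring.tendsto_pow_div_factorial_atTop (2 * c * t)).const_mul 2
    rw [mul_zero] at this
    refine this.congr fun j => ?_
    rw [mul_pow]
    ring
  have h2 : ∑' x, |u t x| ≤ 0 := ge_of_tendsto' h1 fun j => key j t ht
  have h3 := le_hasSum (hs t ht).hasSum x fun y _ => abs_nonneg (u t y)
  exact abs_nonpos_iff.1 (h3.trans h2)

end Matrices

/-! ### The process in continuous time -/

namespace Data.IsDiagonalized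

variable {S : Data}

lemma exists_scale (h : S.IsDiagonalized) :
    ∃ r : ℝ, 0 < r ∧ ∀ x : Lattice S.N, r * (S.B x + S.D x) < 1 := by
  obtain ⟨M, hM⟩ := h.bounded
  refine ⟨1 / (|M| + 1), by positivity, fun x => ?_⟩
  rw [one_div_mul_eq_div, div_lt_one (by positivity)]
  linarith [hM x, le_abs_self M]

lemma act_gen {r : ℝ} (hr : r ≠ 0) (v : Lattice S.N → ℝ) (x : Lattice S.N) :
    act (gen S.N S.B S.D) v x = r⁻¹ * (act (S.L r) v x - v x) := by
  have h1 := hasSum_single (f := fun y => (1 : Matrix (Lattice S.N) (Lattice S.N) ℝ) x y * v y) x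
    fun y hy => by rw [Matrix.one_apply_ne hy.symm, zero_mul]
  rw [Matrix.one_apply_eq, one_mul] at h1
  have h2 := (h1.add (((rowFinite_gen (N := S.N) (B := S.B) (D := S.D)).hasSum_act v x).mul_left r))
  have h3 : act (S.L r) v x = v x + r * act (gen S.N S.B S.D) v x := by
    refine (hasSum_of_eq h2 (fun y => ?_) rfl).tsum_eq
    rw [L_eq, Matrix.add_apply, Matrix.smul_apply, smul_eq_mul, LBD]
    ring
  rw [h3]
  field_simp
  ring

/-- The solution of the initial value problem as a Poisson mixture of the process in discrete
time. -/
lemma isContinuousSolution_poissonMean (h : S.IsDiagonalized) {r : ℝ} (hr : 0 < r)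
    (hr1 : ∀ x : Lattice S.N, r * (S.B x + S.D x) < 1) {p : Lattice S.N → ℝ} (hp : IsProb p) :
    IsContinuousSolution S.N S.B S.D p fun t x =>
      poissonMean (fun k => evolve (S.L r) p k x) (r⁻¹ * t) := by
  have hL := h.isStochastic_L hr hr1
  have hev := fun k => hL.isProb_evolve hp k
  have habs : ∀ x k, |evolve (S.L r) p k x| ≤ 1 := fun x k => by
    rw [abs_of_nonneg ((hev k).nonneg x)]
    exact (hev k).le_one x
  refine ⟨funext fun x => ?_, fun t ht => ⟨fun x => ?_, ?_⟩, fun t ht x => ?_⟩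
  · rw [mul_zero, poissonMean_zero]
    rfl
  · exact tsum_nonneg fun k => mul_nonneg
      (poissonWeight_nonneg (mul_nonneg (inv_nonneg.2 hr.le) ht) k) ((hev k).nonneg x)
  · have hs0 : 0 ≤ r⁻¹ * t := mul_nonneg (inv_nonneg.2 hr.le) ht
    exact hasSum_mixture (poissonWeight_nonneg hs0) (hasSum_poissonWeight _)
      (fun k => (hev k).nonneg) fun k => (hev k).sum_eq_one
  · have h0 : HasDerivAt (fun t : ℝ => r⁻¹ * t) (r⁻¹ * 1) t := (hasDerivAt_id' t).const_mul r⁻¹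
    have h1 : HasDerivAt (fun t => poissonMean (fun k => evolve (S.L r) p k x) (r⁻¹ * t)) _ t :=
      HasDerivAt.comp (h₂ := poissonMean fun k => evolve (S.L r) p k x) t
        (hasDerivAt_poissonMean (habs x) (r⁻¹ * t)) h0
    refine (h1.congr_deriv ?_).hasDerivWithinAt
    rw [act_gen hr.ne', mul_one, mul_comm]
    congr 2
    have h2 := (rowFinite_L S r).hasSum_act_apply
      (fun y => (summable_poissonWeight_mul (habs y) (r⁻¹ * t)).hasSum) x
    refine (hasSum_of_eq h2 (fun k => ?_) rfl).tsum_eq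
    rw [(rowFinite_L S r).act_smul]
    rfl

lemma solution_unique (h : S.IsDiagonalized) {p : Lattice S.N → ℝ} {P Q : ℝ → Lattice S.N → ℝ}
    (hP : IsContinuousSolution S.N S.B S.D p P) (hQ : IsContinuousSolution S.N S.B S.D p Q)
    {t : ℝ} (ht : 0 ≤ t) (x : Lattice S.N) : P t x = Q t x := by
  obtain ⟨r, hr, hr1⟩ := h.exists_scale
  have hs : ∀ t, 0 ≤ t → Summable fun x => |P t x - Q t x| := fun t ht =>
    ((hP.prob t ht).sum_eq_one.summable.sub (hQ.prob t ht).sum_eq_one.summable).abs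
  refine sub_eq_zero.1 ((h.isStochastic_L hr hr1).eq_zero_of_hasDerivWithinAt
    (inv_nonneg.2 hr.le) (u := fun t x => P t x - Q t x) (funext fun x => ?_) hs
    (fun t ht => ?_) (fun t ht x => ?_) ht x)
  · rw [hP.init, hQ.init, sub_self]
    rfl
  · refine (hasSum_le (fun x => ?_) (hs t ht).hasSum
      ((hP.prob t ht).sum_eq_one.add (hQ.prob t ht).sum_eq_one)).trans (by norm_num)
    refine (abs_sub _ _).trans (add_le_add (le_of_eq ?_) (le_of_eq ?_))
    · exact abs_of_nonneg ((hP.prob t ht).nonneg x)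
    · exact abs_of_nonneg ((hQ.prob t ht).nonneg x)
  · refine ((hP.evol t ht x).sub (hQ.evol t ht x)).congr_deriv ?_
    rw [act_gen hr.ne', act_gen hr.ne', (rowFinite_L S r).act_sub]
    ring

/-- The expansion of the solution of the initial value problem. -/
lemma hasSum_solution (h : S.IsDiagonalized) {p : Lattice S.N → ℝ} (hp : IsProb p)
    {c : Lattice S.N → ℝ} (hc : ∀ x : Lattice S.N,
      HasSum (fun n : Lattice S.N => c n * (S.phihat 0 x * S.phihat n x)) (p x))
    {P : ℝ → Lattice S.N → ℝ} (hP : IsContinuousSolution S.N S.B S.D p P) {t : ℝ} (ht : 0 ≤ t)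
    (x : Lattice S.N) :
    HasSum (fun n : Lattice S.N => c n * Real.exp (-S.E n * t) * (S.phihat 0 x * S.phihat n x))
      (P t x) := by
  obtain ⟨r, hr, hr1⟩ := h.exists_scale
  rw [h.solution_unique hP (h.isContinuousSolution_poissonMean hr hr1 hp) ht x]
  set s := r⁻¹ * t with hs
  have hs0 : 0 ≤ s := mul_nonneg (inv_nonneg.2 hr.le) ht
  have h1 : Summable fun z : Lattice S.N × ℕ =>
      c z.1 * (S.phihat 0 x * S.phihat z.1 x) * (poissonWeight s z.2 * S.kappa r z.1 ^ z.2) := by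
    refine Summable.of_norm_bounded ((hc x).summable.abs.mul_of_nonneg
      (hasSum_poissonWeight s).summable (fun _ => abs_nonneg _)
      (poissonWeight_nonneg hs0)) fun z => ?_
    rw [Real.norm_eq_abs, abs_mul, abs_mul (poissonWeight s z.2), abs_pow,
      abs_of_nonneg (poissonWeight_nonneg hs0 z.2)]
    refine mul_le_mul_of_nonneg_left ?_ (abs_nonneg _)
    exact mul_le_of_le_one_right (poissonWeight_nonneg hs0 _)
      (pow_le_one₀ (abs_nonneg _) (h.abs_kappa_le_one hr hr1 z.1))
  have h2 := h1.hasSum.prod_fiberwise fun n =>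
    (hasSum_poissonWeight_mul_pow s (S.kappa r n)).mul_left
      (c n * (S.phihat 0 x * S.phihat n x))
  have h3 := ((Equiv.prodComm ℕ (Lattice S.N)).hasSum_iff.2 h1.hasSum).prod_fiberwise fun k =>
    hasSum_of_eq ((h.hasSum_evolve hr.ne' hc k x).mul_left (poissonWeight s k))
      (fun n => by simp; ring) rfl
  rw [poissonMean, h3.tsum_eq]
  refine hasSum_of_eq h2 (fun n => ?_) rfl
  have h4 : -(s * (1 - S.kappa r n)) = -S.E n * t := by
    rw [hs, kappa]
    field_simp
    ring
  rw [h4]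
  ring

lemma solvesContinuous (h : S.IsDiagonalized)
    (hphi : ∀ x : Lattice S.N, phi0 S.B S.D x ^ 2 = S.phi0sq x) : S.SolvesContinuous where
  eigensystem := by simpa only [hphi] using h.eigensystem_LBD
  stationary := h.act_stat
  exists_solution p hp := by
    obtain ⟨r, hr, hr1⟩ := h.exists_scale
    exact ⟨_, h.isContinuousSolution_poissonMean hr hr1 hp⟩
  initial_value p P hp hp2 hP t ht x := hasSum_of_eq
    (h.hasSum_solution hp (h.expansion_prob hp hp2).2.2 hP ht x) (fun n => by ring) rfl
  transition y P hP t ht x := by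
    rw [show (Pi.single y 1 : Lattice S.N → ℝ) = fun z => if z = y then 1 else 0 from
      funext fun z => Pi.single_apply y 1 z] at hP
    exact hasSum_of_eq
      (h.hasSum_solution (isProb_single y) (fun x => h.hasSum_pointMass x y) hP ht x)
      (fun n => by ring) rfl
  limit p P hp hP x := by
    obtain ⟨r, hr, hr1⟩ := h.exists_scale
    have hL := h.isStochastic_L hr hr1
    have h1 := tendsto_poissonMean (fun k => (by
      rw [abs_of_nonneg ((hL.isProb_evolve hp k).nonneg x)]
      exact (hL.isProb_evolve hp k).le_one x : |evolve (S.L r) p k x| ≤ 1))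
      (h.tendsto_evolve hr hr1 hp x)
    refine (h1.comp (tendsto_id.const_mul_atTop (inv_pos.2 hr))).congr' ?_
    filter_upwards [eventually_ge_atTop 0] with t ht
    exact (h.solution_unique hP (h.isContinuousSolution_poissonMean hr hr1 hp) ht x).symm
  spectral x y := ⟨h.spectral_LBD x y,
    hasSum_of_eq (h.spectral_LBD x y) (fun n => by rw [h.spectral_term]) rfl⟩

end Data.IsDiagonalized

/-! ### Finite lattices -/

lemma hasSum_lattice_of_eq {M : ℕ∞} {N : ℕ} (h : M = N) (f : ℕ → ℝ) :
    HasSum (fun x : Lattice M => f x.1) (∑ x ∈ Finset.range (N + 1), f x) := by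
  subst h
  exact hasSum_lattice_coe N f

namespace Data

/-- The conclusion for one of the examples. -/
def IsSolved (S : Data) : Prop :=
  S.IsSpectralData ∧ S.SolvesContinuous ∧
    ∀ t : ℝ, 0 < t → (∀ x : Lattice S.N, t * (S.B x + S.D x) < 1) → S.SolvesDiscrete t

lemma IsDiagonalized.isSolved {S : Data} (h : S.IsDiagonalized) (heta : S.eta 0 = 0)
    (hpoly : ∀ n : Lattice S.N, ∃ p : Polynomial ℝ, p.degree = (n.1 : WithBot ℕ) ∧
      ∀ x : Lattice S.N, S.P n x = p.eval (S.eta x))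
    (hphi : ∀ x : Lattice S.N, phi0 S.B S.D x ^ 2 = S.phi0sq x) : S.IsSolved :=
  ⟨h.isSpectralData heta hpoly hphi, h.solvesContinuous hphi,
    fun _ ht ht1 => h.solvesDiscrete hphi ht ht1⟩

lemma phi0_sq_eq_phi0sq {S : Data} (hbd : IsBirthDeath S.N S.B S.D) (h0 : S.phi0sq 0 = 1)
    (h : ∀ x : ℕ, ((x + 1 : ℕ) : ℕ∞) ≤ S.N → S.phi0sq (x + 1) * S.D (x + 1) = S.phi0sq x * S.B x)
    (x : Lattice S.N) : phi0 S.B S.D x ^ 2 = S.phi0sq x := by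
  obtain ⟨x, hx⟩ := x
  induction x with
  | zero => simp [h0]
  | succ x ih =>
    have hx' : (x : ℕ∞) ≤ S.N := le_trans (by exact_mod_cast x.le_succ) hx
    have hD := hbd.death_pos ⟨x + 1, hx⟩ x.succ_ne_zero
    refine mul_right_cancel₀ hD.ne' ?_
    change phi0 S.B S.D (x + 1) ^ 2 * S.D (x + 1) = S.phi0sq (x + 1) * S.D (x + 1)
    rw [phi0_sq_succ hbd hx, h x hx]
    rw [show phi0 S.B S.D x ^ 2 = S.phi0sq x from ih hx']

/-- The criterion for a finite lattice: the rates and the spectra form a ladder, and also the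
rates `A`, `C` of the dual problem, in which the rôles of `x` and `n` are exchanged; `φ₀²` and the
quotients `d_n² / d_0²` satisfy detailed balance for the two pairs of rates; and `d_0²` is the
inverse of the total mass. -/
theorem isSolved_of_ladder {S : Data} {N : ℕ} (hN : S.N = N) {A C φ : ℕ → ℝ}
    (lad : IsLadder S.B S.D S.eta S.E φ) (lad' : IsLadder A C S.E S.eta φ)
    (hη : StrictMono S.eta) (hE : StrictMono S.E)
    (hB : ∀ x < N, 0 < S.B x) (hBN : S.B N = 0) (hD : ∀ x < N, 0 < S.D (x + 1))
    (hP : (∀ k < N, φ k ≠ 0) → ∀ n ≤ N, ∀ x ≤ N, S.P n x = splitPoly S.eta S.E φ n x)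
    (hphi0 : S.phi0sq 0 = 1)
    (hphi : ∀ x < N, S.phi0sq (x + 1) * S.D (x + 1) = S.phi0sq x * S.B x)
    (hdr0 : S.dratio 0 = 1) (hdr : ∀ n < N, S.dratio (n + 1) * C (n + 1) = S.dratio n * A n)
    (hC : ∀ n < N, C (n + 1) ≠ 0) (hAN : A N = 0)
    (hmass : S.d0sq * ∏ k ∈ Finset.range N, S.E (k + 1) = ∏ k ∈ Finset.range N, S.D (k + 1)) :
    S.IsSolved := by
  have hle : ∀ {x : ℕ}, (x : ℕ∞) ≤ S.N ↔ x ≤ N := fun {x} => by rw [hN, Nat.cast_le]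
  have hbd : IsBirthDeath S.N S.B S.D :=
    { birth_pos := fun x hx => hB x (lt_of_le_of_ne (hle.1 x.2) fun e => hx (by rw [e, hN]))
      birth_end := fun x hx => by
        have hx' : x.1 = N := by exact_mod_cast hx.trans hN
        rw [hx', hBN]
      death_pos := fun x hx => by
        obtain ⟨k, hk⟩ := Nat.exists_eq_succ_of_ne_zero hx
        have := hle.1 x.2
        rw [hk]
        exact hD k (by omega)
      death_zero := lad.death_zero }
  have hφ : ∀ k < N, φ k ≠ 0 := fun k hk => lad.ne_zero hη (hB k hk).ne'
  replace hP := hP hφ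
  have hphi' := phi0_sq_eq_phi0sq hbd hphi0 fun x hx => hphi x (by have := hle.1 hx; omega)
  set w : ℕ → ℝ := fun x => phi0 S.B S.D x ^ 2 with hw
  set p : ℕ → ℕ → ℝ := splitPoly S.eta S.E φ with hp
  have hww : ∀ x < N, w (x + 1) * S.D (x + 1) = w x * S.B x := fun x hx =>
    phi0_sq_succ hbd (hle.2 hx)
  have hsum : ∀ f : ℕ → ℝ, Summable fun x : Lattice S.N => f x.1 := fun f =>
    (hasSum_lattice_of_eq hN f).summable
  obtain ⟨M, hM⟩ : ∃ M : ℝ, ∀ x : Lattice S.N, S.B x + S.D x ≤ M := by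
    refine ⟨∑ x ∈ Finset.range (N + 1), |S.B x + S.D x|, fun x => (le_abs_self _).trans ?_⟩
    exact Finset.single_le_sum (f := fun x => |S.B x + S.D x|) (fun _ _ => abs_nonneg _)
      (Finset.mem_range.2 (Nat.lt_succ_iff.2 (hle.1 x.2)))
  have hop : ∀ n ≤ N, ∀ x, diffOp S.B S.D (p n) x = S.E n * p n x := fun n hn x =>
    lad.diffOp_splitPoly (fun k hk => hφ k (by omega)) x
  have horth : ∀ n ≤ N, ∀ m ≤ N, n ≠ m →
      HasSum (fun x : Lattice S.N => w x * p n x * p m x) 0 := fun n hn m hm hnm =>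
    hasSum_mul_eq_zero hbd hM (fun x => sq_nonneg _)
      (fun x hx => hww x (by have := hle.1 hx; omega)) (fun x => hop n hn x)
      (fun x => hop m hm x) (fun e => hnm (hE.injective e))
      (hsum fun x => w x * p n x ^ 2) (hsum fun x => w x * p m x ^ 2)
  have hrec : ∀ n, ∀ x : Lattice S.N, A n * (p n x - p (n + 1) x) + C n * (p n x - p (n - 1) x) =
      S.eta x * p n x := fun n x => by
    have := lad'.diffOp_splitPoly (n := x) (fun k hk => hφ k (by have := hle.1 x.2; omega)) n
    simp only [diffOp, splitPoly_symm S.E S.eta φ] at this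
    exact this
  set H : ℕ → ℝ := fun n => ∑ x ∈ Finset.range (N + 1), w x * p n x * p n x with hH
  have hnorm : ∀ n, HasSum (fun x : Lattice S.N => w x * p n x * p n x) (H n) := fun n =>
    hasSum_lattice_of_eq hN fun x => w x * p n x * p n x
  have hmass' := lad.total_mass (w := w) (by simp [hw]) hww hBN hφ
  have hDprod : (∏ k ∈ Finset.range N, S.D (k + 1)) ≠ 0 :=
    Finset.prod_ne_zero_iff.2 fun k hk => (hD k (Finset.mem_range.1 hk)).ne'
  have hH1 : ∀ n ≤ N, H n * S.dsq n = 1 := by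
    intro n hn
    induction n with
    | zero =>
      have : H 0 = ∑ x ∈ Finset.range (N + 1), w x := by
        simp [hH, hp, splitPoly]
      rw [this, dsq, hdr0, one_mul]
      refine mul_right_cancel₀ hDprod ?_
      linear_combination S.d0sq * hmass' + hmass
    | succ n ih =>
      have h1 := norm_recurrence (w := fun x : Lattice S.N => w x) (t := fun x => S.eta x)
        (p := fun n x => p n x) (hrec n) (hrec (n + 1)) (hnorm n) (hnorm (n + 1))
        (horth n (by omega) (n + 1) hn (by omega))
        (horth (n - 1) (by omega) (n + 1) hn (by omega)) (by
          rcases Nat.lt_or_ge (n + 1) N with h | h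
          · exact Or.inr (horth n (by omega) (n + 2) (by omega) (by omega))
          · rw [show n + 1 = N by omega]
            exact Or.inl hAN)
      have h2 := hdr n (by omega)
      refine mul_right_cancel₀ (hC n (by omega)) ?_
      have h3 := ih (by omega)
      rw [dsq] at h3 ⊢
      linear_combination (H (n + 1) * S.d0sq) * h2 + S.dratio n * S.d0sq * h1 + C (n + 1) * h3
  have hdpos : ∀ n ≤ N, 0 < S.dsq n := fun n hn => by
    have h0 : 0 ≤ H n := Finset.sum_nonneg fun x _ => by
      rw [mul_assoc]
      exact mul_nonneg (sq_nonneg _) (mul_self_nonneg _)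
    have := hH1 n hn
    by_contra hcon
    nlinarith [not_lt.1 hcon]
  have hPn : ∀ n x : Lattice S.N, S.P n x = p n x := fun n x => hP n (hle.1 n.2) x (hle.1 x.2)
  have hnorm' : ∀ n m : Lattice S.N,
      HasSum (fun x : Lattice S.N => phi0 S.B S.D x ^ 2 * S.P n x * S.P m x)
        (if n = m then 1 / S.dsq n else 0) := by
    intro n m
    simp only [hPn]
    split_ifs with e
    · subst e
      have h1 := hH1 n (hle.1 n.2)
      refine hasSum_of_eq (hnorm n) (fun x => rfl) ?_
      rw [div_eq_iff (hdpos n (hle.1 n.2)).ne', h1]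
    · exact horth n (hle.1 n.2) m (hle.1 m.2) fun e' => e (Subtype.ext e')
  have hdpos' : ∀ n : Lattice S.N, 0 < S.dsq n := fun n => hdpos n (hle.1 n.2)
  have hdual : ∀ x y : Lattice S.N,
      HasSum (fun n : Lattice S.N => S.phihat n x * S.phihat n y) (if x = y then 1 else 0) := by
    intro x y
    have : Finite (Lattice S.N) := by
      refine Set.Finite.subset (Set.finite_Iic N) fun x hx => ?_
      exact hle.1 hx
    have : Fintype (Lattice S.N) := Fintype.ofFinite _
    set U : Matrix (Lattice S.N) (Lattice S.N) ℝ := fun n x => S.phihat n x with hU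
    have h1 : U * U.transpose = 1 := by
      ext n m
      rw [Matrix.mul_apply, Matrix.one_apply]
      exact (hasSum_fintype _).unique (orthonormal_of_norm hdpos' hnorm' n m)
    have h2 := congrArg (fun V : Matrix (Lattice S.N) (Lattice S.N) ℝ => V x y)
      (mul_eq_one_comm.1 h1)
    rw [Matrix.mul_apply, Matrix.one_apply] at h2
    rw [← h2]
    exact hasSum_fintype _
  have hdiag : S.IsDiagonalized :=
    { isBirthDeath := hbd
      bounded := ⟨M, hM⟩
      P_zero := fun x => by rw [hP 0 (Nat.zero_le _) x (hle.1 x.2)]; simp [hp, splitPoly]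
      P_at_zero := fun n => by
        rw [hP n (hle.1 n.2) 0 (Nat.zero_le _), hp, splitPoly_at_zero]
      difference_eq := fun n x => by
        rw [hPn, ← hop n (hle.1 n.2) x, diffOp, diffOp, hPn,
          hP n (hle.1 n.2) (x - 1) (by have := hle.1 x.2; omega)]
        rcases Nat.lt_or_ge x N with h | h
        · rw [hP n (hle.1 n.2) (x + 1) h]
        · rw [show x.1 = N by have := hle.1 x.2; omega, hBN, zero_mul, zero_mul]
      E_zero := lad.ev_zero
      E_pos := fun n hn => by
        rw [← lad.ev_zero]
        exact hE (Nat.pos_of_ne_zero hn)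
      E_injective := fun n m e => Subtype.ext (hE.injective e)
      d0sq_pos := by
        have := hdpos 0 (Nat.zero_le _)
        rwa [dsq, hdr0, one_mul] at this
      dratio_zero := hdr0
      dsq_pos := hdpos'
      norm := hnorm'
      dual := hdual }
  refine hdiag.isSolved lad'.ev_zero (fun n => ?_) hphi'
  obtain ⟨r, hr1, hr2⟩ := exists_polynomial_splitPoly (η := S.eta) hE (n := n)
    fun k hk => hφ k (by have := hle.1 n.2; omega)
  exact ⟨r, hr1, fun x => by rw [hPn, ← hr2]⟩

end Data

/-! ### Shifted factorials and hypergeometric series -/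

@[simp] lemma poch_zero (a : ℝ) : poch a 0 = 1 := by simp [poch]

lemma poch_succ (a : ℝ) (k : ℕ) : poch a (k + 1) = poch a k * (a + k) :=
  ascPochhammer_succ_eval k a

lemma poch_eq_prod (a : ℝ) (k : ℕ) : poch a k = ∏ i ∈ Finset.range k, (a + i) := by
  induction k with
  | zero => simp
  | succ k ih => rw [poch_succ, ih, Finset.prod_range_succ]

lemma poch_pos {a : ℝ} (ha : 0 < a) (k : ℕ) : 0 < poch a k := ascPochhammer_pos k a ha

lemma poch_shift (a : ℝ) (k : ℕ) : a * poch (a + 1) k = poch a k * (a + k) := by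
  induction k with
  | zero => simp
  | succ k ih =>
    rw [poch_succ, poch_succ, ← mul_assoc, ih]
    push_cast
    ring

lemma poch_two_mul (a : ℝ) (k : ℕ) :
    poch a (2 * k) = ∏ i ∈ Finset.range k, ((2 * i + a) * (2 * i + 1 + a)) := by
  induction k with
  | zero => simp
  | succ k ih =>
    rw [Finset.prod_range_succ, ← ih, Nat.mul_succ, poch_succ, poch_succ]
    push_cast
    ring

lemma poch_add (a : ℝ) (k l : ℕ) : poch a (k + l) = poch a k * poch (a + k) l := by
  induction l with
  | zero => simp
  | succ l ih =>
    rw [← add_assoc, poch_succ, poch_succ, ih]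
    push_cast
    ring

lemma poch_eq_prod_reflect (a : ℝ) (N : ℕ) :
    poch a N = ∏ k ∈ Finset.range N, (a + N - (k + 1)) := by
  rw [poch_eq_prod, ← Finset.prod_range_reflect]
  refine Finset.prod_congr rfl fun k hk => ?_
  have := Finset.mem_range.1 hk
  rw [Nat.sub_sub, Nat.cast_sub (by omega)]
  push_cast
  ring

@[simp] lemma qpoch_zero (a q : ℝ) : qpoch a q 0 = 1 := by simp [qpoch]

lemma qpoch_succ (a q : ℝ) (k : ℕ) : qpoch a q (k + 1) = qpoch a q k * (1 - a * q ^ k) :=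
  Finset.prod_range_succ _ _

lemma qpoch_pos {a q : ℝ} (hq : 0 < q) (hq1 : q < 1) (ha : a < 1) (k : ℕ) : 0 < qpoch a q k := by
  refine Finset.prod_pos fun i _ => sub_pos.2 ?_
  have h1 := pow_pos hq i
  have h2 := pow_le_one₀ (n := i) hq.le hq1.le
  nlinarith

lemma qpoch_shift (a q : ℝ) (k : ℕ) :
    (1 - a) * qpoch (a * q) q k = qpoch a q k * (1 - a * q ^ k) := by
  induction k with
  | zero => simp
  | succ k ih =>
    rw [qpoch_succ, qpoch_succ, ← mul_assoc, ih]
    ring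

lemma qpoch_two_mul (a q : ℝ) (k : ℕ) :
    qpoch a q (2 * k) =
      ∏ i ∈ Finset.range k, ((1 - a * q ^ (2 * i)) * (1 - a * q ^ (2 * i + 1))) := by
  induction k with
  | zero => simp
  | succ k ih =>
    rw [Finset.prod_range_succ, ← ih, Nat.mul_succ, qpoch_succ, qpoch_succ]
    ring

lemma qpoch_add (a q : ℝ) (k l : ℕ) :
    qpoch a q (k + l) = qpoch a q k * qpoch (a * q ^ k) q l := by
  induction l with
  | zero => simp
  | succ l ih =>
    rw [← add_assoc, qpoch_succ, qpoch_succ, ih]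
    ring

@[simp] lemma binom_zero (N : ℕ) : binom N 0 = 1 := by
  have : (N.factorial : ℝ) ≠ 0 := Nat.cast_ne_zero.2 N.factorial_ne_zero
  simp [binom, this]

lemma binom_succ {N x : ℕ} (h : x < N) :
    binom N (x + 1) * (x + 1) = binom N x * (N - x) := by
  obtain ⟨m, rfl⟩ := Nat.exists_eq_add_of_lt h
  have e1 : x + m + 1 - (x + 1) = m := by omega
  have e2 : x + m + 1 - x = m + 1 := by omega
  have h1 : (m.factorial : ℝ) ≠ 0 := Nat.cast_ne_zero.2 m.factorial_ne_zero
  have h2 : (x.factorial : ℝ) ≠ 0 := Nat.cast_ne_zero.2 x.factorial_ne_zero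
  rw [binom, binom, e1, e2, Nat.factorial_succ x, Nat.factorial_succ m]
  push_cast
  have h3 : (m : ℝ) + 1 ≠ 0 := by positivity
  have h4 : (x : ℝ) + 1 ≠ 0 := by positivity
  field_simp
  ring

lemma qfactorial_pos {q : ℝ} (hq : 0 < q) (hq1 : q < 1) (k : ℕ) : 0 < qpoch q q k :=
  qpoch_pos hq hq1 hq1 k

@[simp] lemma qbinom_zero {q : ℝ} (hq : 0 < q ∧ q < 1) (N : ℕ) : qbinom q N 0 = 1 := by
  have := (qfactorial_pos hq.1 hq.2 N).ne'
  simp [qbinom, this]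

lemma qbinom_succ {q : ℝ} (hq : 0 < q ∧ q < 1) {N x : ℕ} (h : x < N) :
    qbinom q N (x + 1) * (1 - q * q ^ x) = qbinom q N x * (1 - q ^ N / q ^ x) := by
  obtain ⟨m, rfl⟩ := Nat.exists_eq_add_of_lt h
  have e1 : x + m + 1 - (x + 1) = m := by omega
  have e2 : x + m + 1 - x = m + 1 := by omega
  have h1 := (qfactorial_pos hq.1 hq.2 m).ne'
  have h2 := (qfactorial_pos hq.1 hq.2 x).ne'
  have h5 := (pow_pos hq.1 x).ne'
  have h3 : 1 - q * q ^ m ≠ 0 := right_ne_zero_of_mul (qpoch_succ q q m ▸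
    (qfactorial_pos hq.1 hq.2 (m + 1)).ne')
  have h4 : 1 - q * q ^ x ≠ 0 := right_ne_zero_of_mul (qpoch_succ q q x ▸
    (qfactorial_pos hq.1 hq.2 (x + 1)).ne')
  have h6 : q ^ (x + m + 1) / q ^ x = q * q ^ m := by
    rw [add_assoc, pow_add, mul_div_cancel_left₀ _ h5, pow_succ']
  rw [qbinom, qbinom, e1, e2, h6, qpoch_succ q q m, qpoch_succ q q x]
  field_simp

lemma quot_pos {s : ℝ} (hs : -1 < s) (x : ℕ) : 0 < quot s x := by
  rw [quot]
  split_ifs with h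
  · exact one_pos
  · have : (1 : ℝ) ≤ x := Nat.one_le_cast.2 (Nat.one_le_iff_ne_zero.2 h)
    exact div_pos (by linarith) (by linarith)

lemma quot_of_ne {s : ℝ} {x : ℕ} (h : x ≠ 0) : quot s x = (x + s) / (2 * x + s) := if_neg h

@[simp] lemma quot_zero (s : ℝ) : quot s 0 = 1 := if_pos rfl

lemma qquot_of_ne {s q : ℝ} {x : ℕ} (h : x ≠ 0) :
    qquot s q x = (1 - s * q ^ x) / (1 - s * q ^ (2 * x)) := if_neg h

@[simp] lemma qquot_zero (s q : ℝ) : qquot s q 0 = 1 := if_pos rfl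

lemma qquot_pos {s q : ℝ} (hq : 0 < q) (hq1 : q < 1) (hs : s * q < 1) (x : ℕ) :
    0 < qquot s q x := by
  have key : ∀ k : ℕ, k ≠ 0 → 0 < 1 - s * q ^ k := fun k hk => by
    obtain ⟨k, rfl⟩ := Nat.exists_eq_succ_of_ne_zero hk
    have h1 := pow_pos hq k
    have h2 := pow_le_one₀ (n := k) hq.le hq1.le
    rw [pow_succ]
    nlinarith
  rw [qquot]
  split_ifs with h
  · exact one_pos
  · exact div_pos (key x h) (key (2 * x) (by omega))

/-- A terminating hypergeometric series in split form. -/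
lemma hyp_eq_splitPoly {as bs : List ℝ} {z : ℝ} {n x : ℕ} {η E φ : ℕ → ℝ}
    (hφ : ∀ k < n, φ k ≠ 0) (hb : ∀ k < n, (bs.map fun b => b + (k : ℝ)).prod ≠ 0)
    (h : ∀ k < n, (as.map fun a => a + (k : ℝ)).prod * z * φ k =
      (E n - E k) * (η x - η k) * ((bs.map fun b => b + (k : ℝ)).prod * (k + 1))) :
    hyp as bs z n = splitPoly η E φ n x := by
  have hs : ∀ (l : List ℝ) (k : ℕ), (l.map fun a => poch a (k + 1)).prod =
      (l.map fun a => poch a k).prod * (l.map fun a => a + (k : ℝ)).prod := fun l k => by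
    rw [← List.prod_map_mul]
    simp only [poch_succ]
  refine sum_eq_splitPoly (by simp) hφ fun k hk => ?_
  have h1 := hb k hk
  have h2 : (k : ℝ) + 1 ≠ 0 := by positivity
  have h3 : (k.factorial : ℝ) ≠ 0 := Nat.cast_ne_zero.2 k.factorial_ne_zero
  rw [hs, hs, Nat.factorial_succ, pow_succ]
  push_cast
  have h4 := h k hk
  generalize (as.map fun a => poch a k).prod = u at *
  generalize (bs.map fun a => poch a k).prod = v at *
  generalize (as.map fun a => a + (k : ℝ)).prod = u' at *
  generalize (bs.map fun a => a + (k : ℝ)).prod = v' at *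
  rcases eq_or_ne v 0 with rfl | hv
  · simp
  field_simp
  linear_combination u * z ^ k * h4

/-- A terminating basic hypergeometric series in split form. -/
lemma qhyp_eq_splitPoly {as bs : List ℝ} {q z : ℝ} (hq : 0 < q ∧ q < 1) {n x : ℕ}
    {η E φ : ℕ → ℝ} (hφ : ∀ k < n, φ k ≠ 0)
    (hb : ∀ k < n, (bs.map fun b => 1 - b * q ^ k).prod ≠ 0)
    (h : ∀ k < n, (as.map fun a => 1 - a * q ^ k).prod *
      (-q ^ k) ^ (1 + (bs.length : ℤ) - (as.length : ℤ)) * z * φ k =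
      (E n - E k) * (η x - η k) * ((bs.map fun b => 1 - b * q ^ k).prod * (1 - q * q ^ k))) :
    qhyp as bs q z n = splitPoly η E φ n x := by
  have hs : ∀ (l : List ℝ) (k : ℕ), (l.map fun a => qpoch a q (k + 1)).prod =
      (l.map fun a => qpoch a q k).prod * (l.map fun a => 1 - a * q ^ k).prod := fun l k => by
    rw [← List.prod_map_mul]
    simp only [qpoch_succ]
  refine sum_eq_splitPoly (by simp) hφ fun k hk => ?_
  have h1 := hb k hk
  have h2 := (qfactorial_pos hq.1 hq.2 (k + 1)).ne'
  have hsign : (-1 : ℝ) ^ (k + 1) * q ^ ((k + 1) * (k + 1 - 1) / 2) =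
      (-1) ^ k * q ^ (k * (k - 1) / 2) * (-q ^ k) := by
    have : (k + 1) * (k + 1 - 1) / 2 = k * (k - 1) / 2 + k := by
      rcases k with _ | k
      · rfl
      · simp only [Nat.add_sub_cancel]
        rw [show (k + 1 + 1) * (k + 1) = (k + 1) * k + (k + 1) * 2 by ring,
          Nat.add_mul_div_right _ _ two_pos]
    rw [this, pow_succ, pow_add]
    ring
  rw [hs, hs, hsign, mul_zpow, pow_succ z]
  rw [qpoch_succ] at h2 ⊢
  have h3 := left_ne_zero_of_mul h2
  have h5 := right_ne_zero_of_mul h2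
  have h4 := h k hk
  generalize (as.map fun a => qpoch a q k).prod = u at *
  generalize (bs.map fun a => qpoch a q k).prod = v at *
  generalize (as.map fun a => 1 - a * q ^ k).prod = u' at *
  generalize (bs.map fun a => 1 - a * q ^ k).prod = v' at *
  generalize ((-1 : ℝ) ^ k * q ^ (k * (k - 1) / 2)) ^ (1 + (bs.length : ℤ) - (as.length : ℤ)) = y
    at *
  generalize (-q ^ k) ^ (1 + (bs.length : ℤ) - (as.length : ℤ)) = y' at *
  rcases eq_or_ne v 0 with rfl | hv
  · simp
  field_simp
  linear_combination u * y * z ^ k * h4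

/-! ### Krawtchouk, Hahn, dual Hahn and Racah -/

/-- The total mass identity `c ∏ f = ∏ g` may be checked factor by factor when the normalisation
constant `c` is a product too. -/
lemma mul_prod_eq_prod {N : ℕ} {c : ℝ} {f g r : ℕ → ℝ} (hc : c = ∏ k ∈ Finset.range N, r k)
    (h : ∀ k < N, r k * f k = g k) :
    c * ∏ k ∈ Finset.range N, f k = ∏ k ∈ Finset.range N, g k := by
  rw [hc, ← Finset.prod_mul_distrib]
  exact Finset.prod_congr rfl fun k hk => h k (Finset.mem_range.1 hk)

/-- The Krawtchouk polynomials are self-dual: both spectra are `0, 1, 2, …`, and the ladder is its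
own dual. -/
lemma isLadder_krawtchouk (N : ℕ) (p : ℝ) :
    IsLadder (krawtchouk N p).B (krawtchouk N p).D (fun x => (x : ℝ)) (fun n => (n : ℝ))
      (quadOff 0 1 0 1 p (-(p * N))) := by
  have h : (fun x : ℕ => (x : ℝ)) = quadSpec 0 1 := by
    funext x
    simp [quadSpec]
  rw [h]
  refine isLadder_quad (fun j hj => by norm_num) ?_ ?_ (fun x hx => ?_) (fun x hx => ?_) <;>
    simp [krawtchouk] <;> ring

lemma krawtchouk_weight_succ {N x : ℕ} {p : ℝ} (hp : p ≠ 1) (hx : x < N) :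
    (krawtchouk N p).phi0sq (x + 1) * (krawtchouk N p).D (x + 1) =
      (krawtchouk N p).phi0sq x * (krawtchouk N p).B x := by
  have hp' : 1 - p ≠ 0 := sub_ne_zero.2 hp.symm
  have h := binom_succ hx
  simp only [krawtchouk]
  push_cast
  rw [pow_succ]
  field_simp
  linear_combination (p / (1 - p)) ^ x * p * h

lemma isSolved_krawtchouk (N : ℕ) (p : ℝ) (hp : 0 < p ∧ p < 1) : (krawtchouk N p).IsSolved := by
  have hmono : StrictMono fun x : ℕ => (x : ℝ) := Nat.strictMono_cast
  have hp' : 0 < 1 - p := sub_pos.2 hp.2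
  refine Data.isSolved_of_ladder rfl (isLadder_krawtchouk N p) (isLadder_krawtchouk N p)
    hmono hmono (fun x hx => ?_) (by simp [krawtchouk]) (fun x hx => ?_) (fun hφ n hn x hx => ?_)
    (by simp [krawtchouk]) (fun x hx => krawtchouk_weight_succ hp.2.ne hx) (by simp [krawtchouk])
    (fun n hn => krawtchouk_weight_succ hp.2.ne hn) (fun n hn => ?_) (by simp [krawtchouk]) ?_
  · have : (x : ℝ) < N := Nat.cast_lt.2 hx
    exact mul_pos hp.1 (sub_pos.2 this)
  · exact mul_pos hp' (by positivity)
  · refine hyp_eq_splitPoly (fun k hk => hφ k (hk.trans_le hn)) (fun k hk => ?_) fun k hk => ?_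
    · have : (k : ℝ) < N := Nat.cast_lt.2 (hk.trans_le hn)
      simp only [List.map_cons, List.map_nil, List.prod_cons, List.prod_nil]
      exact mul_ne_zero (by linarith) one_ne_zero
    · have := hp.1.ne'
      simp only [List.map_cons, List.map_nil, List.prod_cons, List.prod_nil, quadOff, krawtchouk]
      field_simp
      ring
  · exact (mul_pos hp' (by positivity)).ne'
  · refine mul_prod_eq_prod (r := fun _ => 1 - p) ?_ fun k hk => ?_
    · simp [krawtchouk]
    · simp [krawtchouk]

lemma eta_hahn (N : ℕ) (a b : ℝ) : (hahn N a b).eta = quadSpec 0 1 := by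
  funext x
  simp [hahn, quadSpec]

lemma ev_hahn (N : ℕ) (a b : ℝ) : (hahn N a b).E = quadSpec 1 (a + b - 1) := by
  funext x
  simp only [hahn, quadSpec]
  ring

lemma hahn_gap {a b : ℝ} (ha : 0 < a) (hb : 0 < b) (j : ℕ) (hj : 1 ≤ j) :
    0 < 1 * (j : ℝ) + (a + b - 1) := by
  have : (1 : ℝ) ≤ j := Nat.one_le_cast.2 hj
  linarith

lemma isLadder_hahn {N : ℕ} {a b : ℝ} :
    IsLadder (hahn N a b).B (hahn N a b).D (quadSpec 0 1) (quadSpec 1 (a + b - 1))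
      (quadOff 0 1 1 (a + b - 1) (a - N) (-(a * N))) := by
  refine isLadder_quad (fun j hj => by norm_num) ?_ ?_ (fun x hx => ?_) (fun x hx => ?_) <;>
    simp only [hahn] <;> push_cast <;> ring

lemma isLadder_dualHahn {N : ℕ} {a b : ℝ} (ha : 0 < a) (hb : 0 < b) :
    IsLadder (dualHahn N a b).B (dualHahn N a b).D (quadSpec 1 (a + b - 1)) (quadSpec 0 1)
      (quadOff 0 1 1 (a + b - 1) (a - N) (-(a * N))) := by
  rw [quadOff_swap]
  refine isLadder_quad (hahn_gap ha hb) ?_ ?_ (fun x hx => ?_) (fun x hx => ?_)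
  · simp [dualHahn]
  · have : a + b ≠ 0 := by positivity
    simp [dualHahn]
    field_simp
  · have h1 : (1 : ℝ) ≤ x := Nat.one_le_cast.2 hx
    obtain ⟨u, hu⟩ : ∃ u : ℝ, u = 2 * x + (a + b - 1) := ⟨_, rfl⟩
    have h2 : u ≠ 0 := by linarith
    have h3 : u + 1 ≠ 0 := by linarith
    simp only [dualHahn]
    rw [quot_of_ne (by omega), show 2 * 1 * (x : ℝ) + (a + b - 1) = u by rw [hu]; ring,
      show 2 * 1 * (x : ℝ) + 1 + (a + b - 1) = u + 1 by rw [hu]; ring,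
      show 2 * (x : ℝ) + a + b = u + 1 by rw [hu]; ring, ← hu]
    field_simp
    ring
  · have h1 : (1 : ℝ) ≤ x := Nat.one_le_cast.2 hx
    obtain ⟨u, hu⟩ : ∃ u : ℝ, u = 2 * x - 2 + a + b := ⟨_, rfl⟩
    have h2 : u ≠ 0 := by linarith
    have h3 : u + 1 ≠ 0 := by linarith
    simp only [dualHahn]
    rw [show 2 * 1 * (x : ℝ) + (a + b - 1) - 1 = u by rw [hu]; ring,
      show 2 * 1 * (x : ℝ) + (a + b - 1) = u + 1 by rw [hu]; ring,
      show 2 * (x : ℝ) - 1 + a + b = u + 1 by rw [hu]; ring, ← hu]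
    field_simp
    ring

lemma hahn_weight_succ {N x : ℕ} (a : ℝ) {b : ℝ} (hb : 0 < b) (hx : x < N) :
    (hahn N a b).phi0sq (x + 1) * (hahn N a b).D (x + 1) =
      (hahn N a b).phi0sq x * (hahn N a b).B x := by
  have h := binom_succ hx
  have h1 := (poch_pos hb N).ne'
  have h2 : poch b (N - x) = poch b (N - (x + 1)) * (b + N - (x + 1)) := by
    rw [show N - x = N - (x + 1) + 1 by omega, poch_succ, Nat.cast_sub (by omega)]
    push_cast
    ring
  simp only [hahn]
  rw [h2, poch_succ]
  push_cast
  field_simp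
  linear_combination poch a x * (a + x) * poch b (N - (x + 1)) * (b + N - (x + 1)) * h

lemma dualHahn_weight_succ {N x : ℕ} {a b : ℝ} (ha : 0 < a) (hb : 0 < b) (hx : x < N) :
    (dualHahn N a b).phi0sq (x + 1) * (dualHahn N a b).D (x + 1) =
      (dualHahn N a b).phi0sq x * (dualHahn N a b).B x := by
  have h := binom_succ hx
  have h1 := (poch_pos hb x).ne'
  have h2 : (0 : ℝ) < x + a + b := by positivity
  have h3 := (poch_pos h2 N).ne'
  have h4 := poch_shift (x + a + b) N
  have h5 : (0 : ℝ) < x + a + b + 1 := by positivity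
  have h6 := (poch_pos h5 N).ne'
  have h7 := (quot_pos (s := a + b - 1) (by linarith) x).ne'
  have h8 : b + x ≠ 0 := by positivity
  have h9 : 2 * (x : ℝ) + a + b ≠ 0 := by positivity
  have h10 : 2 * (x : ℝ) + 1 + a + b ≠ 0 := by positivity
  have h11 : (x : ℝ) + a + b + N ≠ 0 := by positivity
  simp only [dualHahn]
  rw [quot_of_ne (Nat.succ_ne_zero x), poch_succ, poch_succ]
  push_cast
  rw [show (x : ℝ) + 1 + a + b = x + a + b + 1 by ring,
    show (x : ℝ) + 1 + (a + b - 1) = x + a + b by ring,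
    show 2 * ((x : ℝ) + 1) + (a + b - 1) = 2 * x + 1 + a + b by ring,
    show 2 * ((x : ℝ) + 1) - 2 + a + b = 2 * x + a + b by ring,
    show 2 * ((x : ℝ) + 1) - 1 + a + b = 2 * x + 1 + a + b by ring,
    show (x : ℝ) + 1 + b - 1 = b + x by ring,
    show (x : ℝ) + a + b + 1 + N - 1 = x + a + b + N by ring]
  have h12 : poch (x + a + b + 1 : ℝ) N =
      poch (x + a + b) N * (x + a + b + N) / (x + a + b) := by
    field_simp
    linear_combination h4
  rw [h12]
  field_simp
  linear_combination poch a x * poch (a + b) N * (a + x) * h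

lemma dualHahn_phi0sq_zero {N : ℕ} {a b : ℝ} (ha : 0 < a) (hb : 0 < b) :
    (dualHahn N a b).phi0sq 0 = 1 := by
  have := (poch_pos (add_pos ha hb) N).ne'
  simp [dualHahn, this]

lemma hahn_phi0sq_zero {N : ℕ} {a b : ℝ} (hb : 0 < b) : (hahn N a b).phi0sq 0 = 1 := by
  have := (poch_pos hb N).ne'
  simp [hahn, this]

lemma hahn_death_pos {N x : ℕ} (a : ℝ) {b : ℝ} (hb : 0 < b) (hx : x < N) :
    0 < (hahn N a b).D (x + 1) := by
  have : (x : ℝ) + 1 ≤ N := by exact_mod_cast hx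
  simp only [hahn]
  push_cast
  exact mul_pos (by positivity) (by linarith)

lemma dualHahn_death_pos {N x : ℕ} {a b : ℝ} (ha : 0 < a) (hb : 0 < b) :
    0 < (dualHahn N a b).D (x + 1) := by
  have : (0 : ℝ) ≤ x := x.cast_nonneg
  have : (0 : ℝ) ≤ N := N.cast_nonneg
  simp only [dualHahn]
  push_cast
  exact div_pos (mul_pos (mul_pos (by positivity) (by linarith)) (by linarith))
    (mul_pos (by linarith) (by linarith))

lemma isSolved_hahn (N : ℕ) (a b : ℝ) (ha : 0 < a) (hb : 0 < b) : (hahn N a b).IsSolved := by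
  refine Data.isSolved_of_ladder rfl (A := (dualHahn N a b).B) (C := (dualHahn N a b).D)
    (φ := quadOff 0 1 1 (a + b - 1) (a - N) (-(a * N))) ?_ ?_ ?_ ?_ (fun x hx => ?_)
    (by simp [hahn]) (fun x hx => hahn_death_pos a hb hx) (fun hφ n hn x hx => ?_)
    (hahn_phi0sq_zero hb)
    (fun x hx => hahn_weight_succ a hb hx) (dualHahn_phi0sq_zero ha hb)
    (fun n hn => dualHahn_weight_succ ha hb hn) (fun n hn => (dualHahn_death_pos ha hb).ne')
    (by simp [dualHahn]) ?_
  · rw [eta_hahn, ev_hahn]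
    exact isLadder_hahn
  · rw [eta_hahn, ev_hahn]
    exact isLadder_dualHahn ha hb
  · rw [eta_hahn]
    exact strictMono_quadSpec fun j hj => by norm_num
  · rw [ev_hahn]
    exact strictMono_quadSpec (hahn_gap ha hb)
  · have : (x : ℝ) < N := Nat.cast_lt.2 hx
    exact mul_pos (by positivity) (by linarith)
  · refine hyp_eq_splitPoly (fun k hk => hφ k (hk.trans_le hn)) (fun k hk => ?_) fun k hk => ?_
    · have : (k : ℝ) < N := Nat.cast_lt.2 (hk.trans_le hn)
      simp only [List.map_cons, List.map_nil, List.prod_cons, List.prod_nil]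
      exact mul_ne_zero (by positivity) (mul_ne_zero (by linarith) one_ne_zero)
    · simp only [List.map_cons, List.map_nil, List.prod_cons, List.prod_nil, quadOff, hahn]
      ring
  · refine mul_prod_eq_prod (r := fun k => (b + N - (k + 1)) / (a + b + k)) ?_ fun k hk => ?_
    · rw [Finset.prod_div_distrib, ← poch_eq_prod_reflect, ← poch_eq_prod]
      rfl
    · have : a + b + k ≠ 0 := by positivity
      simp only [hahn]
      push_cast
      field_simp
      ring

lemma isSolved_dualHahn (N : ℕ) (a b : ℝ) (ha : 0 < a) (hb : 0 < b) :
    (dualHahn N a b).IsSolved := by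
  have hη : (dualHahn N a b).eta = quadSpec 1 (a + b - 1) := ev_hahn N a b ▸ by
    funext x
    simp only [hahn, dualHahn]
  have hE : (dualHahn N a b).E = quadSpec 0 1 := eta_hahn N a b
  refine Data.isSolved_of_ladder rfl (A := (hahn N a b).B) (C := (hahn N a b).D)
    (φ := quadOff 0 1 1 (a + b - 1) (a - N) (-(a * N))) ?_ ?_ ?_ ?_ (fun x hx => ?_)
    (by simp [dualHahn]) (fun x hx => dualHahn_death_pos ha hb) (fun hφ n hn x hx => ?_)
    (dualHahn_phi0sq_zero ha hb)
    (fun x hx => dualHahn_weight_succ ha hb hx) ?_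
    (fun n hn => ?_) (fun n hn => (hahn_death_pos a hb hn).ne')
    (by simp [hahn]) ?_
  · rw [hη, hE]
    exact isLadder_dualHahn ha hb
  · rw [hη, hE]
    exact isLadder_hahn
  · rw [hη]
    exact strictMono_quadSpec (hahn_gap ha hb)
  · rw [hE]
    exact strictMono_quadSpec fun j hj => by norm_num
  · have : (x : ℝ) < N := Nat.cast_lt.2 hx
    exact mul_pos (quot_pos (by linarith) x)
      (div_pos (mul_pos (by positivity) (by linarith)) (by positivity))
  · refine hyp_eq_splitPoly (fun k hk => hφ k (hk.trans_le hn)) (fun k hk => ?_) fun k hk => ?_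
    · have : (k : ℝ) < N := Nat.cast_lt.2 (hk.trans_le hn)
      simp only [List.map_cons, List.map_nil, List.prod_cons, List.prod_nil]
      exact mul_ne_zero (by positivity) (mul_ne_zero (by linarith) one_ne_zero)
    · simp only [List.map_cons, List.map_nil, List.prod_cons, List.prod_nil, quadOff, dualHahn]
      ring
  · have := (poch_pos hb N).ne'
    simp [dualHahn, this]
  · have := hahn_weight_succ a hb hn
    simp only [hahn, dualHahn] at this ⊢
    rw [← mul_div_assoc, ← mul_div_assoc] at this ⊢
    exact this
  · have h2 : poch (a + b) (2 * N) = poch (a + b) N * poch (a + b + N) N := by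
      rw [two_mul, poch_add]
    have h3 := (poch_pos (add_pos ha hb) N).ne'
    have h4 := (poch_pos (show 0 < a + b + N by positivity) N).ne'
    refine mul_prod_eq_prod (r := fun k => (b + k) * (a + b + N + k) /
      ((2 * k + (a + b)) * (2 * k + 1 + (a + b)))) ?_ fun k hk => ?_
    · rw [Finset.prod_div_distrib, Finset.prod_mul_distrib, ← poch_eq_prod, ← poch_eq_prod,
        ← poch_two_mul, h2]
      simp only [dualHahn]
      field_simp
    · have : 2 * (k : ℝ) + (a + b) ≠ 0 := by positivity
      have : 2 * (k : ℝ) + 1 + (a + b) ≠ 0 := by positivity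
      simp only [dualHahn]
      push_cast
      rw [show 2 * ((k : ℝ) + 1) - 2 + a + b = 2 * k + (a + b) by ring,
        show 2 * ((k : ℝ) + 1) - 1 + a + b = 2 * k + 1 + (a + b) by ring]
      field_simp
      ring

/-- The birth rate of the Racah polynomials as a function of the four parameters, in a form that is
also valid for `d = 0`. -/
def racahBirth (a b c d : ℝ) (x : ℕ) : ℝ :=
  -(quot d x * ((x + a) * (x + b) * (x + c) / (2 * x + 1 + d)))

/-- The death rate of the Racah polynomials as a function of the four parameters. -/
def racahDeath (a b c d : ℝ) (x : ℕ) : ℝ :=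
  -((x + d - a) * (x + d - b) * (x + d - c) * x / ((2 * x - 1 + d) * (2 * x + d)))

/-- The weight of the Racah polynomials, in a form that is also valid for `d = 0`. -/
def racahWeight (a b c d : ℝ) (x : ℕ) : ℝ :=
  poch a x * poch b x * poch c x * (poch (d + 1) x / quot d x) /
    (poch (1 + d - a) x * poch (1 + d - b) x * poch (1 + d - c) x * poch 1 x)

lemma isLadder_racah {a b c d : ℝ} (hd : -1 < d) :
    IsLadder (racahBirth a b c d) (racahDeath a b c d) (quadSpec 1 d)
      (quadSpec 1 (a + b + c - d - 1))
      (quadOff 1 d 1 (a + b + c - d - 1) (a * b + a * c + b * c) (a * b * c)) := by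
  refine isLadder_quad (fun j hj => ?_) ?_ ?_ (fun x hx => ?_) (fun x hx => ?_)
  · have : (1 : ℝ) ≤ j := Nat.one_le_cast.2 hj
    linarith
  · simp [racahDeath]
  · have : 1 + d ≠ 0 := by linarith
    simp [racahBirth]
    field_simp
  · have h1 : (1 : ℝ) ≤ x := Nat.one_le_cast.2 hx
    obtain ⟨u, hu⟩ : ∃ u : ℝ, u = 2 * x + d := ⟨_, rfl⟩
    have h2 : u ≠ 0 := by linarith
    have h3 : u + 1 ≠ 0 := by linarith
    rw [racahBirth, quot_of_ne (by omega), show 2 * 1 * (x : ℝ) + d = u by rw [hu]; ring,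
      show 2 * 1 * (x : ℝ) + 1 + d = u + 1 by rw [hu]; ring,
      show 2 * (x : ℝ) + 1 + d = u + 1 by rw [hu]; ring, ← hu]
    field_simp
    ring
  · have h1 : (1 : ℝ) ≤ x := Nat.one_le_cast.2 hx
    obtain ⟨u, hu⟩ : ∃ u : ℝ, u = 2 * x - 1 + d := ⟨_, rfl⟩
    have h2 : u ≠ 0 := by linarith
    have h3 : u + 1 ≠ 0 := by linarith
    rw [racahDeath, show 2 * 1 * (x : ℝ) + d - 1 = u by rw [hu]; ring,
      show 2 * 1 * (x : ℝ) + d = u + 1 by rw [hu]; ring,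
      show 2 * (x : ℝ) + d = u + 1 by rw [hu]; ring, ← hu]
    field_simp
    ring

lemma racahWeight_zero (a b c d : ℝ) : racahWeight a b c d 0 = 1 := by
  simp [racahWeight]

lemma racahWeight_succ {a b c d : ℝ} {x : ℕ} (hd : -1 < d) (ha : 1 + d - a + x ≠ 0)
    (hb : 1 + d - b + x ≠ 0) (hc : 1 + d - c + x ≠ 0) :
    racahWeight a b c d (x + 1) * racahDeath a b c d (x + 1) =
      racahWeight a b c d x * racahBirth a b c d x := by
  have h1 : 1 + (x : ℝ) ≠ 0 := by positivity
  have hx : (0 : ℝ) ≤ x := x.cast_nonneg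
  obtain ⟨u, hu⟩ : ∃ u : ℝ, u = 2 * x + 1 + d := ⟨_, rfl⟩
  have h2 : u ≠ 0 := by linarith
  have h3 : u + 1 ≠ 0 := by linarith
  have h4 : d + 1 + x ≠ 0 := by linarith
  have h5 := (quot_pos hd x).ne'
  simp only [racahWeight, racahDeath, racahBirth, poch_succ]
  rw [quot_of_ne (Nat.succ_ne_zero x)]
  push_cast
  rw [show (x : ℝ) + 1 + d - a = 1 + d - a + x by ring,
    show (x : ℝ) + 1 + d - b = 1 + d - b + x by ring,
    show (x : ℝ) + 1 + d - c = 1 + d - c + x by ring,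
    show (x : ℝ) + 1 + d = d + 1 + x by ring,
    show 2 * ((x : ℝ) + 1) - 1 + d = u by rw [hu]; ring,
    show 2 * ((x : ℝ) + 1) + d = u + 1 by rw [hu]; ring, ← hu]
  generalize 1 + d - a + (x : ℝ) = u1 at *
  generalize 1 + d - b + (x : ℝ) = u2 at *
  generalize 1 + d - c + (x : ℝ) = u3 at *
  generalize d + 1 + (x : ℝ) = u4 at *
  have e1 : ∀ v1 v2 v3 v4 : ℝ, v1 * u1 * (v2 * u2) * (v3 * u3) * (v4 * (1 + x)) =
      v1 * v2 * v3 * v4 * (u1 * u2 * u3 * (1 + x)) := fun v1 v2 v3 v4 => by ring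
  have e2 : ∀ v1 v2 v3 v4 : ℝ, v1 * (a + x) * (v2 * (b + x)) * (v3 * (c + x)) *
      (v4 * u4 / (u4 / (u + 1))) =
      v1 * v2 * v3 * v4 * ((a + x) * (b + x) * (c + x) * (u + 1)) := fun v1 v2 v3 v4 => by
    field_simp
  have e3 : ∀ v1 v2 v3 v4 : ℝ, v1 * v2 * v3 * (v4 / quot d x) = v1 * v2 * v3 * v4 / quot d x :=
    fun v1 v2 v3 v4 => by ring
  rw [e1, e2, e3, mul_div_mul_comm]
  generalize poch a x * poch b x * poch c x * poch (d + 1) x = V1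
  generalize poch (1 + d - a) x * poch (1 + d - b) x * poch (1 + d - c) x * poch 1 x = V2
  generalize quot d x = r at *
  rw [div_right_comm V1]
  generalize V1 / V2 = V
  field_simp
  ring

lemma isSolved_racah (N : ℕ) (a b d : ℝ) (hd : 0 < d) (ha : N + d < a)
    (hb : 0 < b ∧ b < 1 + d) : (racah N a b d).IsSolved := by
  -- the dual family has the parameter `e` in the place of `d`
  obtain ⟨e, he⟩ : ∃ e : ℝ, e = a + b + -N - d - 1 := ⟨_, rfl⟩
  have hed : a + b + -N - e - 1 = d := by rw [he]; ring
  have hN : (0 : ℝ) ≤ N := N.cast_nonneg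
  have he1 : -1 < e := by linarith [hb.1]
  have hquot : ∀ x : ℕ, quot d x = (x + d) / (2 * x + d) := fun x => by
    rcases eq_or_ne x 0 with rfl | h
    · simp [hd.ne']
    · exact quot_of_ne h
  have hB : (racah N a b d).B = racahBirth a b (-N) d := by
    funext x
    have h1 : 2 * (x : ℝ) + d ≠ 0 := by positivity
    have h2 : 2 * (x : ℝ) + 1 + d ≠ 0 := by positivity
    simp only [racah, racahBirth, hquot]
    field_simp
  have hD : (racah N a b d).D = racahDeath a b (-N) d := rfl
  have hw : (racah N a b d).phi0sq = racahWeight a b (-N) d := by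
    funext x
    have h1 : 2 * (x : ℝ) + d ≠ 0 := by positivity
    have h2 : (x : ℝ) + d ≠ 0 := by positivity
    have h3 := poch_shift d x
    simp only [racah, racahWeight, hquot]
    rw [show poch d x = d * poch (d + 1) x / (x + d) by field_simp; linear_combination -h3]
    field_simp
  have hη : (racah N a b d).eta = quadSpec 1 d := by
    funext x
    simp [racah, quadSpec]
  have hE : (racah N a b d).E = quadSpec 1 e := by
    funext x
    simp [racah, quadSpec, he]
  have hdr : (racah N a b d).dratio = racahWeight a b (-N) e := by
    rw [he]
    rfl
  have hlt : ∀ x < N, (x : ℝ) + 1 ≤ N := fun x hx => by exact_mod_cast hx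
  have hDpos : ∀ x < N, 0 < (racah N a b d).D (x + 1) := fun x hx => by
    have h1 := hlt x hx
    have h2 : (0 : ℝ) ≤ x := x.cast_nonneg
    rw [hD, racahDeath, Left.neg_pos_iff]
    push_cast
    refine div_neg_of_neg_of_pos (mul_neg_of_neg_of_pos (mul_neg_of_neg_of_pos
      (mul_neg_of_neg_of_pos ?_ ?_) ?_) ?_) (mul_pos ?_ ?_) <;> linarith [hb.2]
  refine Data.isSolved_of_ladder rfl (A := racahBirth a b (-N) e) (C := racahDeath a b (-N) e)
    (φ := quadOff 1 d 1 e (a * b + a * -N + b * -N) (a * b * -N)) ?_ ?_ ?_ ?_ (fun x hx => ?_)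
    (by simp [hB, racahBirth]) hDpos (fun hφ n hn x hx => ?_) (by rw [hw, racahWeight_zero])
    (fun x hx => ?_) (by rw [hdr, racahWeight_zero]) (fun n hn => ?_) (fun n hn => ?_)
    (by simp [racahBirth]) ?_
  · rw [hη, hE, hB, hD, he]
    exact isLadder_racah (by linarith)
  · rw [hη, hE, quadOff_swap]
    have := isLadder_racah (a := a) (b := b) (c := -N) he1
    rw [hed] at this
    exact this
  · rw [hη]
    exact strictMono_quadSpec fun j hj => by positivity
  · rw [hE]
    refine strictMono_quadSpec fun j hj => ?_
    have : (1 : ℝ) ≤ j := Nat.one_le_cast.2 hj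
    linarith
  · have h1 := hlt x hx
    have h2 : (0 : ℝ) ≤ x := x.cast_nonneg
    rw [hB, racahBirth, Left.neg_pos_iff]
    refine mul_neg_of_pos_of_neg (quot_pos (by linarith) x) (div_neg_of_neg_of_pos
      (mul_neg_of_pos_of_neg (mul_pos ?_ ?_) ?_) ?_) <;> linarith [hb.1]
  · have hn' : (n : ℝ) ≤ N := Nat.cast_le.2 hn
    refine hyp_eq_splitPoly (fun k hk => hφ k (hk.trans_le hn)) (fun k hk => ?_) fun k hk => ?_
    · have h1 := hlt k (hk.trans_le hn)
      have h2 : (0 : ℝ) ≤ k := k.cast_nonneg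
      simp only [List.map_cons, List.map_nil, List.prod_cons, List.prod_nil]
      refine mul_ne_zero ?_ (mul_ne_zero ?_ (mul_ne_zero ?_ one_ne_zero))
      · linarith
      · linarith [hb.1]
      · linarith
    · simp only [List.map_cons, List.map_nil, List.prod_cons, List.prod_nil, quadOff, racah, he]
      ring
  · have h1 := hlt x hx
    have h2 : (0 : ℝ) ≤ x := x.cast_nonneg
    rw [hw, hB, hD]
    refine racahWeight_succ (by linarith) ?_ ?_ ?_ <;> linarith [hb.2]
  · have h1 := hlt n hn
    have h2 : (0 : ℝ) ≤ n := n.cast_nonneg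
    rw [hdr]
    refine racahWeight_succ (by linarith) ?_ ?_ ?_ <;> linarith [hb.1, hb.2]
  · have h1 := hlt n hn
    have h2 : (0 : ℝ) ≤ n := n.cast_nonneg
    rw [racahDeath]
    push_cast
    refine neg_ne_zero.2 (div_ne_zero (mul_ne_zero (mul_ne_zero (mul_ne_zero ?_ ?_) ?_) ?_)
      (mul_ne_zero ?_ ?_)) <;> linarith [hb.1, hb.2]
  · refine mul_prod_eq_prod (r := fun k => -1 * ((1 + d - a + k) * (1 + d - b + k) *
      (1 + d - -N + k)) / ((e + 1 + k) * ((2 * k + (d + 1)) * (2 * k + 1 + (d + 1))))) ?_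
      fun k hk => ?_
    · rw [Finset.prod_div_distrib, Finset.prod_mul_distrib, Finset.prod_mul_distrib,
        Finset.prod_mul_distrib, Finset.prod_mul_distrib, ← poch_eq_prod, ← poch_eq_prod,
        ← poch_eq_prod, ← poch_eq_prod, ← poch_two_mul, Finset.prod_const, Finset.card_range, he]
      rfl
    · have h2 : (0 : ℝ) ≤ k := k.cast_nonneg
      have h3 : e + 1 + k ≠ 0 := by linarith
      rw [hE, hD, racahDeath, quadSpec]
      push_cast
      rw [show 2 * ((k : ℝ) + 1) - 1 + d = 2 * k + (d + 1) by ring,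
        show 2 * ((k : ℝ) + 1) + d = 2 * k + 1 + (d + 1) by ring,
        show 1 * ((k : ℝ) + 1) + e = e + 1 + k by ring]
      have h4 : 2 * (k : ℝ) + (d + 1) ≠ 0 := by positivity
      have h5 : 2 * (k : ℝ) + 1 + (d + 1) ≠ 0 := by positivity
      generalize 2 * (k : ℝ) + (d + 1) = u1 at *
      generalize 2 * (k : ℝ) + 1 + (d + 1) = u2 at *
      generalize e + 1 + (k : ℝ) = u3 at *
      field_simp
      ring

/-! ### The `q`-Krawtchouk polynomials -/

section Powers

variable {q : ℝ}

lemma zpow_cast_sub (hq : q ≠ 0) (x N : ℕ) : q ^ ((x : ℤ) - N) = q ^ x / q ^ N := by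
  rw [zpow_sub₀ hq, zpow_natCast, zpow_natCast]

lemma zpow_cast_sub_one (hq : q ≠ 0) (x : ℕ) : q ^ ((x : ℤ) - 1) = q ^ x / q := by
  rw [zpow_sub₀ hq, zpow_natCast, zpow_one]

lemma zpow_neg_cast (x : ℕ) : q ^ (-(x : ℤ)) = (q ^ x)⁻¹ := by
  rw [zpow_neg, zpow_natCast]

lemma pow_two_mul (x : ℕ) : q ^ (2 * x) = (q ^ x) ^ 2 := by
  rw [mul_comm, pow_mul]

lemma prod_pow_sq (q : ℝ) (N : ℕ) :
    ∏ k ∈ Finset.range N, (q * q ^ k) ^ 2 = q ^ N * (q ^ N) ^ N := by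
  induction N with
  | zero => simp
  | succ N ih =>
    rw [Finset.prod_range_succ, ih]
    ring

lemma prod_pow_triangle (q : ℝ) (N : ℕ) :
    ∏ k ∈ Finset.range N, (q * q ^ k) = q ^ (N * (N + 1) / 2) := by
  induction N with
  | zero => simp
  | succ N ih =>
    rw [Finset.prod_range_succ, ih, show (N + 1) * (N + 1 + 1) = N * (N + 1) + (N + 1) * 2 by ring,
      Nat.add_mul_div_right _ _ two_pos]
    ring

lemma pow_mul_lt_one (hq : 0 < q) (hq1 : q < 1) {a : ℝ} (ha : a < 1) (k : ℕ) : a * q ^ k < 1 := by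
  have h1 := pow_pos hq k
  have h2 := pow_le_one₀ (n := k) hq.le hq1.le
  nlinarith

lemma one_lt_pow_div (hq : 0 < q) (hq1 : q < 1) {x N : ℕ} (hx : x < N) : 1 < q ^ x / q ^ N :=
  (one_lt_div (pow_pos hq N)).2 (pow_lt_pow_right_of_lt_one₀ hq hq1 hx)

end Powers

lemma eta_eq_qSpec {η : ℕ → ℝ} {q : ℝ} (h : ∀ x, η x = q ^ (-(x : ℤ)) - 1) : η = qSpec q 1 0 := by
  funext x
  simp [h, qSpec]

lemma affineQKrawtchouk_weight_succ {N x : ℕ} {q p : ℝ} (hq : 0 < q ∧ q < 1) (hp : 0 < p)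
    (hx : x < N) :
    (affineQKrawtchouk N q p).phi0sq (x + 1) * (affineQKrawtchouk N q p).D (x + 1) =
      (affineQKrawtchouk N q p).phi0sq x * (affineQKrawtchouk N q p).B x := by
  have h := qbinom_succ hq hx
  have h0 := hq.1.ne'
  have h1 := (pow_pos hq.1 x).ne'
  have h2 := (pow_pos hq.1 N).ne'
  have h3 := (pow_pos (mul_pos hp hq.1) x).ne'
  have h4 := hp.ne'
  simp only [affineQKrawtchouk, zpow_cast_sub h0]
  rw [qpoch_succ, pow_succ' q x, pow_succ (p * q)]
  generalize q ^ x = X at *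
  generalize q ^ N = Q at *
  generalize (p * q) ^ x = Y at *
  generalize qpoch (p * q) q x = Z
  field_simp at h ⊢
  linear_combination Z * (1 - p * q * X) * h

lemma isSolved_affineQKrawtchouk (N : ℕ) (q p : ℝ) (hq : 0 < q ∧ q < 1) (hp : 0 < p ∧ p < q⁻¹) :
    (affineQKrawtchouk N q p).IsSolved := by
  have h0 := hq.1.ne'
  have hQ := pow_pos hq.1 N
  have hpq : p * q < 1 := by
    have := mul_lt_mul_of_pos_right hp.2 hq.1
    rwa [inv_mul_cancel₀ h0] at this
  have hη : (affineQKrawtchouk N q p).eta = qSpec q 1 0 := eta_eq_qSpec fun _ => rfl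
  have hE : (affineQKrawtchouk N q p).E = qSpec q 1 0 := eta_eq_qSpec fun _ => rfl
  have hgap : ∀ j ≥ 1, 0 < 1 - 0 * q ^ j := fun j _ => by norm_num
  have lad : IsLadder (affineQKrawtchouk N q p).B (affineQKrawtchouk N q p).D
      (qSpec q 1 0) (qSpec q 1 0) (qOff q 1 0 1 0 (-((q ^ N)⁻¹ + p * q)) (p * (q ^ N)⁻¹)) := by
    refine isLadder_q hq.1 hgap ?_ ?_ (fun x hx => ?_) (fun x hx => ?_) <;>
      simp only [affineQKrawtchouk, zpow_cast_sub h0] <;> simp <;> ring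
  have hmono : StrictMono (qSpec q 1 0) := strictMono_qSpec hq.1 hq.2 hgap
  have hDpos : ∀ x < N, 0 < (affineQKrawtchouk N q p).D (x + 1) := fun x hx => by
    simp only [affineQKrawtchouk, zpow_cast_sub h0]
    exact mul_pos (mul_pos hp.1 (div_pos (pow_pos hq.1 _) hQ))
      (sub_pos.2 (pow_lt_one₀ hq.1.le hq.2 x.succ_ne_zero))
  refine Data.isSolved_of_ladder rfl (A := (affineQKrawtchouk N q p).B)
    (C := (affineQKrawtchouk N q p).D) (by rw [hη, hE]; exact lad) (by rw [hη, hE]; exact lad)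
    (by rw [hη]; exact hmono) (by rw [hE]; exact hmono) (fun x hx => ?_)
    (by simp [affineQKrawtchouk]) hDpos (fun hφ n hn x hx => ?_)
    (by simp [affineQKrawtchouk, hq]) (fun x hx => affineQKrawtchouk_weight_succ hq hp.1 hx)
    (by simp [affineQKrawtchouk, hq]) (fun n hn => affineQKrawtchouk_weight_succ hq hp.1 hn)
    (fun n hn => (hDpos n hn).ne') (by simp [affineQKrawtchouk]) ?_
  · simp only [affineQKrawtchouk, zpow_cast_sub h0]
    refine mul_pos (sub_pos.2 (one_lt_pow_div hq.1 hq.2 hx)) (sub_pos.2 ?_)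
    rw [pow_succ', ← mul_assoc]
    exact pow_mul_lt_one hq.1 hq.2 hpq x
  · refine qhyp_eq_splitPoly hq (fun k hk => hφ k (hk.trans_le hn)) (fun k hk => ?_) fun k hk => ?_
    · simp only [List.map_cons, List.map_nil, List.prod_cons, List.prod_nil, zpow_neg_cast]
      refine mul_ne_zero (sub_pos.2 (pow_mul_lt_one hq.1 hq.2 hpq k)).ne'
        (mul_ne_zero (sub_neg.2 ?_).ne one_ne_zero)
      rw [mul_comm]
      exact one_lt_pow_div hq.1 hq.2 (hk.trans_le hn)
    · have h1 := (pow_pos hq.1 n).ne'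
      have h2 := (pow_pos hq.1 x).ne'
      have h3 := (pow_pos hq.1 k).ne'
      simp only [List.map_cons, List.map_nil, List.prod_cons, List.prod_nil, List.length_cons,
        List.length_nil, qOff, affineQKrawtchouk, zpow_neg_cast]
      norm_num
      field_simp
      ring
  · refine mul_prod_eq_prod (r := fun k => p * (q ^ N)⁻¹ * (q * q ^ k) ^ 2) ?_ fun k hk => ?_
    · rw [Finset.prod_mul_distrib, prod_pow_sq, Finset.prod_const, Finset.card_range]
      simp only [affineQKrawtchouk]
      rw [mul_pow, mul_pow, inv_pow]
      field_simp
    · have h3 := (pow_pos hq.1 k).ne'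
      simp only [affineQKrawtchouk, zpow_cast_sub h0, zpow_neg_cast, pow_succ' q k]
      field_simp

lemma isSolved_qKrawtchouk (N : ℕ) (q p : ℝ) (hq : 0 < q ∧ q < 1) (hp : 0 < p) :
    (qKrawtchouk N q p).IsSolved := by
  have h0 := hq.1.ne'
  have hQ := (pow_pos hq.1 N).ne'
  have hX : ∀ x : ℕ, 0 < q ^ x := pow_pos hq.1
  have hp0 := hp.ne'
  have hη : (qKrawtchouk N q p).eta = qSpec q 1 0 := eta_eq_qSpec fun _ => rfl
  have hE : (qKrawtchouk N q p).E = qSpec q 1 (-p) := by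
    funext x
    simp [qKrawtchouk, qSpec]
  have hgap : ∀ j ≥ 1, 0 < 1 - 0 * q ^ j := fun j _ => by norm_num
  have hgap' : ∀ j ≥ 1, 0 < 1 - -p * q ^ j := fun j _ => by
    have := mul_pos hp (hX j)
    linarith
  -- the rates of the dual family, for the spectra exchanged
  set A : ℕ → ℝ := fun n => (1 + p * q ^ n) * (q ^ n / q ^ N - 1) /
    ((1 + p * (q ^ n) ^ 2) * (1 + p * q * (q ^ n) ^ 2)) with hA
  set C : ℕ → ℝ := fun n => (1 - q ^ n) * (p * (q ^ n) ^ 2 * (p * q ^ n + (q ^ N)⁻¹)) /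
    ((1 + p * (q ^ n) ^ 2) * (q + p * (q ^ n) ^ 2)) with hC
  have lad : IsLadder (qKrawtchouk N q p).B (qKrawtchouk N q p).D (qSpec q 1 0) (qSpec q 1 (-p))
      (qOff q 1 0 1 (-p) (-(q ^ N)⁻¹) 0) := by
    refine isLadder_q hq.1 hgap ?_ ?_ (fun x hx => ?_) (fun x hx => ?_) <;>
      simp only [qKrawtchouk, zpow_cast_sub h0] <;> simp <;> ring
  have lad' : IsLadder A C (qSpec q 1 (-p)) (qSpec q 1 0)
      (qOff q 1 (-p) 1 0 (-(q ^ N)⁻¹) 0) := by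
    refine isLadder_q hq.1 hgap' (by simp [hC]) ?_ (fun x hx => ?_) (fun x hx => ?_)
    · have h1 : 1 + p ≠ 0 := by positivity
      have h2 : 1 + p * q ≠ 0 := by have := hq.1; positivity
      simp only [hA, pow_zero]
      field_simp
      ring
    · have h1 : 1 + p * (q ^ x) ^ 2 ≠ 0 := by have := hX x; positivity
      have h2 : 1 + p * q * (q ^ x) ^ 2 ≠ 0 := by have := hX x; have := hq.1; positivity
      simp only [hA]
      rw [show (1 - -p * (q ^ x) ^ 2) * (1 - q * -p * (q ^ x) ^ 2) =
        (1 + p * (q ^ x) ^ 2) * (1 + p * q * (q ^ x) ^ 2) by ring,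
        div_mul_cancel₀ _ (mul_ne_zero h1 h2)]
      ring
    · have h1 : 1 + p * (q ^ x) ^ 2 ≠ 0 := by have := hX x; positivity
      have h2 : q + p * (q ^ x) ^ 2 ≠ 0 := by have := hX x; have := hq.1; positivity
      simp only [hC]
      rw [show (1 - -p * (q ^ x) ^ 2) * (q * 1 - -p * (q ^ x) ^ 2) =
        (1 + p * (q ^ x) ^ 2) * (q + p * (q ^ x) ^ 2) by ring,
        div_mul_cancel₀ _ (mul_ne_zero h1 h2)]
      ring
  have hDpos : ∀ x, 0 < (qKrawtchouk N q p).D (x + 1) := fun x =>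
    mul_pos hp (sub_pos.2 (pow_lt_one₀ hq.1.le hq.2 x.succ_ne_zero))
  refine Data.isSolved_of_ladder rfl (A := A) (C := C) (by rw [hη, hE]; exact lad)
    (by rw [hη, hE, qOff_swap]; exact lad') (by rw [hη]; exact strictMono_qSpec hq.1 hq.2 hgap)
    (by rw [hE]; exact strictMono_qSpec hq.1 hq.2 hgap') (fun x hx => ?_)
    (by simp [qKrawtchouk]) (fun x _ => hDpos x) (fun hφ n hn x hx => ?_)
    (by simp [qKrawtchouk, hq]) (fun x hx => ?_) ?_ (fun n hn => ?_)
    (fun n hn => ?_) (by simp [hA, hQ]) ?_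
  · simp only [qKrawtchouk, zpow_cast_sub h0]
    exact sub_pos.2 (one_lt_pow_div hq.1 hq.2 hx)
  · refine qhyp_eq_splitPoly hq (fun k hk => hφ k (hk.trans_le hn)) (fun k hk => ?_) fun k hk => ?_
    · simp only [List.map_cons, List.map_nil, List.prod_cons, List.prod_nil, zpow_neg_cast]
      refine mul_ne_zero (sub_neg.2 ?_).ne (by norm_num)
      rw [mul_comm]
      exact one_lt_pow_div hq.1 hq.2 (hk.trans_le hn)
    · have h1 := (hX n).ne'
      have h2 := (hX x).ne'
      have h3 := (hX k).ne'
      simp only [List.map_cons, List.map_nil, List.prod_cons, List.prod_nil, List.length_cons,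
        List.length_nil, qOff, qKrawtchouk, zpow_neg_cast]
      norm_num
      field_simp
      ring
  · have h := qbinom_succ hq hx
    have h1 := (hX x).ne'
    have e1 : q ^ (((x + 1 : ℕ) : ℤ) * ((x + 1 : ℕ) - 1) / 2 - (x + 1 : ℕ) * N) =
        q ^ ((x : ℤ) * (x - 1) / 2 - x * N) * (q ^ x / q ^ N) := by
      rw [← zpow_cast_sub h0, ← zpow_add₀ h0]
      congr 1
      push_cast
      rw [show ((x : ℤ) + 1) * (x + 1 - 1) = x * (x - 1) + x * 2 by ring,
        Int.add_mul_ediv_right _ _ two_ne_zero]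
      ring
    simp only [qKrawtchouk, zpow_cast_sub h0, e1, zpow_neg_cast]
    rw [pow_succ p, pow_succ' q]
    generalize q ^ ((x : ℤ) * (x - 1) / 2 - x * N) = Y
    field_simp at h ⊢
    linear_combination Y * h
  · have h1 : 1 + p ≠ 0 := by positivity
    simp [qKrawtchouk, hq, h1]
  · have h := qbinom_succ hq hn
    have h1 := (hX n).ne'
    have h2 : 1 + p * (q ^ n) ^ 2 ≠ 0 := by have := hX n; positivity
    have h3 : 1 + p * q * (q ^ n) ^ 2 ≠ 0 := by have := hX n; have := hq.1; positivity
    have h4 : 1 + p * (q * q ^ n) ^ 2 ≠ 0 := by have := hX n; have := hq.1; positivity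
    have h5 : 1 + p * (q * q ^ N) * q ^ n ≠ 0 := by
      have := hX n; have := hq.1; have := hX N; positivity
    have h6 : 1 + p ≠ 0 := by positivity
    have h7 : qpoch (-p * (q * q ^ N)) q n ≠ 0 := (qpoch_pos hq.1 hq.2 (by
      have := mul_pos hp (mul_pos hq.1 (hX N))
      linarith) n).ne'
    have e1 : q ^ ((n + 1) * (n + 1 + 1) / 2) = q ^ (n * (n + 1) / 2) * (q * q ^ n) := by
      rw [← prod_pow_triangle, ← prod_pow_triangle, Finset.prod_range_succ]
    have e2 : q + p * (q * q ^ n) ^ 2 = q * (1 + p * q * (q ^ n) ^ 2) := by ring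
    have e3 : p * (q * q ^ n) + (q ^ N)⁻¹ = (1 + p * (q * q ^ N) * q ^ n) / q ^ N := by
      field_simp
      ring
    simp only [qKrawtchouk, hA, hC, pow_two_mul, e1, qpoch_succ]
    rw [pow_succ p, pow_succ' q n, pow_succ' q N, e2, e3,
      show 1 - -p * (q * q ^ N) * q ^ n = 1 + p * (q * q ^ N) * q ^ n by ring,
      show 1 - -p * q ^ n = 1 + p * q ^ n by ring]
    generalize 1 + p * (q * q ^ N) * q ^ n = u1 at *
    generalize 1 + p * (q * q ^ n) ^ 2 = u2 at *
    generalize 1 + p * q * (q ^ n) ^ 2 = u3 at *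
    generalize 1 + p * (q ^ n) ^ 2 = u4 at *
    generalize qpoch (-p * (q * q ^ N)) q n = u5 at *
    generalize qpoch (-p) q n = u6 at *
    have h8 := (hX (n * (n + 1) / 2)).ne'
    generalize q ^ (n * (n + 1) / 2) = u7 at *
    generalize qbinom q N (n + 1) = b1 at *
    generalize qbinom q N n = b2 at *
    have h9 := (pow_pos hp n).ne'
    generalize p ^ n = u8 at *
    generalize q ^ n = X at *
    generalize q ^ N = Q at *
    field_simp at h ⊢
    linear_combination (1 + p * X) * u6 * h
  · have h1 := pow_lt_one₀ hq.1.le hq.2 n.succ_ne_zero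
    have h2 := hX (n + 1)
    have h3 := hX N
    have h4 := hq.1
    have h5 : 0 < 1 - q ^ (n + 1) := sub_pos.2 h1
    simp only [hC]
    positivity
  · refine mul_prod_eq_prod (r := fun k => p * (q * q ^ k) / (1 - -p * q * q ^ k)) ?_
      fun k hk => ?_
    · rw [Finset.prod_div_distrib, Finset.prod_mul_distrib, Finset.prod_const, Finset.card_range,
        prod_pow_triangle]
      rfl
    · have h1 := (hX k).ne'
      have h2 : 1 + p * q * q ^ k ≠ 0 := by have := hX k; have := hq.1; positivity
      have e : 1 - -p * q * q ^ k = 1 + p * q * q ^ k := by ring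
      simp only [qKrawtchouk, zpow_neg_cast, pow_succ' q k]
      rw [e, ← mul_assoc p]
      generalize 1 + p * q * q ^ k = u at *
      field_simp

/-- The recurrence relation that splits off the first factor. -/
lemma qpoch_succ' (a q : ℝ) (k : ℕ) : qpoch a q (k + 1) = (1 - a) * qpoch (a * q) q k := by
  rw [qpoch_shift, qpoch_succ]

lemma isSolved_quantumQKrawtchouk (N : ℕ) (q p : ℝ) (hq : 0 < q ∧ q < 1)
    (hp : q ^ (-(N : ℤ)) < p) : (quantumQKrawtchouk N q p).IsSolved := by
  have h0 := hq.1.ne'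
  have hX : ∀ x : ℕ, 0 < q ^ x := pow_pos hq.1
  have hQ := (hX N).ne'
  rw [zpow_neg_cast] at hp
  have hp0 : 0 < p := (inv_pos.2 (hX N)).trans hp
  have hp1 : p⁻¹ < q ^ N := inv_lt_of_inv_lt₀ (hX N) hp
  have hp2 : p⁻¹ * (q ^ N)⁻¹ < 1 := by rwa [← div_eq_mul_inv, div_lt_one (hX N)]
  have hp3 := hp0.ne'
  have hη : (quantumQKrawtchouk N q p).eta = qSpec q 1 0 := eta_eq_qSpec fun _ => rfl
  have hE : (quantumQKrawtchouk N q p).E = qSpec q 0 (-1) := by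
    funext x
    have := (hX x).ne'
    simp only [quantumQKrawtchouk, qSpec]
    field_simp
    ring
  have hgap : ∀ j ≥ 1, 0 < 1 - 0 * q ^ j := fun j _ => by norm_num
  have hgap' : ∀ j ≥ 1, 0 < 0 - -1 * q ^ j := fun j _ => by
    have := hX j
    linarith
  -- the rates of the dual family, for the spectra exchanged
  set A : ℕ → ℝ := fun n => p⁻¹ * (q ^ n / q ^ N - 1) / (q * (q ^ n) ^ 2) with hA
  set C : ℕ → ℝ := fun n => (1 - q ^ n) * (q ^ n - p⁻¹) / (q ^ n) ^ 2 with hC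
  have lad : IsLadder (quantumQKrawtchouk N q p).B (quantumQKrawtchouk N q p).D (qSpec q 1 0)
      (qSpec q 0 (-1)) (qOff q 1 0 0 (-1) p⁻¹ (-(p⁻¹ * (q ^ N)⁻¹ / q))) := by
    refine isLadder_q hq.1 hgap ?_ ?_ (fun x hx => ?_) (fun x hx => ?_) <;>
      simp only [quantumQKrawtchouk, zpow_sub₀ h0, zpow_natCast, zpow_one] <;> simp <;>
      field_simp <;> ring
  have lad' : IsLadder A C (qSpec q 0 (-1)) (qSpec q 1 0)
      (qOff q 0 (-1) 1 0 p⁻¹ (-(p⁻¹ * (q ^ N)⁻¹ / q))) := by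
    refine isLadder_q hq.1 hgap' (by simp [hC]) ?_ (fun x hx => ?_) (fun x hx => ?_)
    · simp only [hA, pow_zero]
      field_simp
      ring
    · have h1 := (hX x).ne'
      simp only [hA]
      field_simp
      ring
    · have h1 := (hX x).ne'
      simp only [hC]
      field_simp
      ring
  refine Data.isSolved_of_ladder rfl (A := A) (C := C) (by rw [hη, hE]; exact lad)
    (by rw [hη, hE, qOff_swap]; exact lad') (by rw [hη]; exact strictMono_qSpec hq.1 hq.2 hgap)
    (by rw [hE]; exact strictMono_qSpec hq.1 hq.2 hgap') (fun x hx => ?_)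
    (by simp [quantumQKrawtchouk]) (fun x _ => ?_) (fun hφ n hn x hx => ?_)
    (by simp [quantumQKrawtchouk, hq]) (fun x hx => ?_) (by simp [quantumQKrawtchouk, hq])
    (fun n hn => ?_) (fun n hn => ?_) (by simp [hA, hQ]) ?_
  · simp only [quantumQKrawtchouk, zpow_cast_sub h0]
    exact mul_pos (mul_pos (inv_pos.2 hp0) (hX x)) (sub_pos.2 (one_lt_pow_div hq.1 hq.2 hx))
  · simp only [quantumQKrawtchouk]
    refine mul_pos (sub_pos.2 (pow_lt_one₀ hq.1.le hq.2 x.succ_ne_zero)) (sub_pos.2 ?_)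
    rw [show ((x + 1 : ℕ) : ℤ) - N - 1 = x - N by push_cast; ring, zpow_cast_sub h0,
      div_eq_inv_mul, ← mul_assoc]
    exact pow_mul_lt_one hq.1 hq.2 hp2 x
  · refine qhyp_eq_splitPoly hq (fun k hk => hφ k (hk.trans_le hn)) (fun k hk => ?_) fun k hk => ?_
    · simp only [List.map_cons, List.map_nil, List.prod_cons, List.prod_nil, zpow_neg_cast]
      refine mul_ne_zero (sub_neg.2 ?_).ne one_ne_zero
      rw [mul_comm]
      exact one_lt_pow_div hq.1 hq.2 (hk.trans_le hn)
    · have h1 := (hX n).ne'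
      have h2 := (hX x).ne'
      have h3 := (hX k).ne'
      simp only [List.map_cons, List.map_nil, List.prod_cons, List.prod_nil, List.length_cons,
        List.length_nil, qOff, quantumQKrawtchouk, zpow_neg_cast, pow_succ q n]
      norm_num
      field_simp
      ring
  · have h := qbinom_succ hq hx
    have h1 := (hX x).ne'
    have h2 : 1 - p⁻¹ * (q ^ N)⁻¹ * q ^ x ≠ 0 :=
      (sub_pos.2 (pow_mul_lt_one hq.1 hq.2 hp2 x)).ne'
    have h3 : qpoch (p⁻¹ * (q ^ N)⁻¹) q x ≠ 0 := (qpoch_pos hq.1 hq.2 hp2 x).ne'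
    have e1 : q ^ (((x + 1 : ℕ) : ℤ) * ((x + 1 : ℕ) - 1 - N)) =
        q ^ ((x : ℤ) * (x - 1 - N)) * (q ^ x * (q ^ x / q ^ N)) := by
      rw [← zpow_cast_sub h0, ← zpow_natCast q x, ← zpow_add₀ h0, ← zpow_add₀ h0]
      congr 1
      push_cast
      ring
    simp only [quantumQKrawtchouk, e1, zpow_cast_sub h0, zpow_neg_cast]
    rw [show ((x + 1 : ℕ) : ℤ) - N - 1 = x - N by push_cast; ring, zpow_cast_sub h0, qpoch_succ,
      pow_succ p, pow_succ' q x,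
      show 1 - p⁻¹ * (q ^ x / q ^ N) = 1 - p⁻¹ * (q ^ N)⁻¹ * q ^ x by ring]
    generalize q ^ ((x : ℤ) * (x - 1 - N)) = Y
    generalize 1 - p⁻¹ * (q ^ N)⁻¹ * q ^ x = u1 at *
    generalize qpoch (p⁻¹ * (q ^ N)⁻¹) q x = u2 at *
    field_simp at h ⊢
    linear_combination Y * h
  · have h := qbinom_succ hq hn
    have h1 := (hX n).ne'
    have hlt : ∀ k ≤ N, p⁻¹ * (q ^ k)⁻¹ < 1 := fun k hk => by
      rw [← div_eq_mul_inv, div_lt_one (hX k)]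
      exact hp1.trans_le (pow_le_pow_of_le_one hq.1.le hq.2.le hk)
    have h2 := (sub_pos.2 (hlt (n + 1) hn)).ne'
    have h3 : qpoch (p⁻¹ * (q ^ n)⁻¹) q n ≠ 0 := (qpoch_pos hq.1 hq.2 (hlt n hn.le) n).ne'
    have e1 : q ^ (-(N : ℤ) * (n + 1 : ℕ)) = q ^ (-(N : ℤ) * n) * (q ^ N)⁻¹ := by
      rw [← zpow_neg_cast, ← zpow_add₀ h0]
      congr 1
      push_cast
      ring
    have e2 : p⁻¹ * (q * q ^ n)⁻¹ * q = p⁻¹ * (q ^ n)⁻¹ := by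
      field_simp
    have e3 : q * q ^ n - p⁻¹ = (1 - p⁻¹ * (q * q ^ n)⁻¹) * (q * q ^ n) := by
      field_simp
    rw [pow_succ'] at h2
    simp only [quantumQKrawtchouk, e1, zpow_neg_cast, hA, hC]
    rw [qpoch_succ', pow_succ' q n, e2, e3, pow_succ p]
    generalize q ^ (-(N : ℤ) * n) = Y
    generalize 1 - p⁻¹ * (q * q ^ n)⁻¹ = u1 at *
    generalize qpoch (p⁻¹ * (q ^ n)⁻¹) q n = u2 at *
    field_simp at h ⊢
    linear_combination Y * h
  · have h1 := hp1.trans_le (pow_le_pow_of_le_one hq.1.le hq.2.le (Nat.succ_le_of_lt hn))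
    have h2 := hX (n + 1)
    simp only [hC]
    exact (div_pos (mul_pos (sub_pos.2 (pow_lt_one₀ hq.1.le hq.2 n.succ_ne_zero)) (sub_pos.2 h1))
      (by positivity)).ne'
  · refine mul_prod_eq_prod (r := fun k => 1 - p⁻¹ * (q ^ N)⁻¹ * q ^ k) ?_ fun k hk => ?_
    · simp only [quantumQKrawtchouk, zpow_neg_cast]
      rfl
    · simp only [quantumQKrawtchouk]
      rw [show ((k + 1 : ℕ) : ℤ) - N - 1 = k - N by push_cast; ring, zpow_cast_sub h0]
      ring

/-! ### The `q`-Hahn and dual `q`-Hahn polynomials -/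

lemma eta_qHahn (N : ℕ) (q a b : ℝ) : (qHahn N q a b).eta = qSpec q 1 0 :=
  eta_eq_qSpec fun _ => rfl

lemma ev_qHahn {q : ℝ} (hq : q ≠ 0) (N : ℕ) (a b : ℝ) :
    (qHahn N q a b).E = qSpec q 1 (a * b / q) := by
  funext x
  simp only [qHahn, qSpec, zpow_neg_cast, zpow_cast_sub_one hq]
  ring

lemma qHahn_gap {q a b : ℝ} (hq : 0 < q ∧ q < 1) (hab : a * b < 1) (j : ℕ) (hj : 1 ≤ j) :
    0 < 1 - a * b / q * q ^ j := by
  obtain ⟨k, rfl⟩ := Nat.exists_eq_add_of_le' hj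
  rw [pow_succ', ← mul_assoc, div_mul_cancel₀ _ hq.1.ne']
  exact sub_pos.2 (pow_mul_lt_one hq.1 hq.2 hab k)

lemma isLadder_qHahn {q : ℝ} (hq : 0 < q ∧ q < 1) (N : ℕ) (a b : ℝ) :
    IsLadder (qHahn N q a b).B (qHahn N q a b).D (qSpec q 1 0) (qSpec q 1 (a * b / q))
      (qOff q 1 0 1 (a * b / q) (-(a + (q ^ N)⁻¹)) (a * (q ^ N)⁻¹ / q)) := by
  have h0 := hq.1.ne'
  refine isLadder_q hq.1 (fun j _ => by norm_num) ?_ ?_ (fun x hx => ?_) (fun x hx => ?_) <;>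
    simp only [qHahn, zpow_cast_sub h0] <;> simp <;> field_simp <;> ring

lemma isLadder_dualQHahn {q a b : ℝ} (hq : 0 < q ∧ q < 1) (hab : a * b < 1) (N : ℕ) :
    IsLadder (dualQHahn N q a b).B (dualQHahn N q a b).D (qSpec q 1 (a * b / q)) (qSpec q 1 0)
      (qOff q 1 0 1 (a * b / q) (-(a + (q ^ N)⁻¹)) (a * (q ^ N)⁻¹ / q)) := by
  have h0 := hq.1.ne'
  have hQ := (pow_pos hq.1 N).ne'
  have hs : a * b / q * q = a * b := div_mul_cancel₀ _ h0
  rw [qOff_swap]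
  refine isLadder_q hq.1 (qHahn_gap hq hab) ?_ ?_ (fun x hx => ?_) (fun x hx => ?_)
  · simp [dualQHahn]
  · have h1 : 1 - a * b ≠ 0 := (sub_pos.2 hab).ne'
    simp only [dualQHahn, qquot_zero, zpow_cast_sub h0, mul_zero, pow_zero, mul_one]
    rw [show q * (a * b / q) = a * b by field_simp]
    field_simp
    ring
  · have h1 := qHahn_gap hq hab (2 * x) (by omega)
    have h2 := qHahn_gap hq hab (2 * x + 1) (by omega)
    rw [pow_succ', ← mul_assoc, hs] at h2
    rw [pow_two_mul] at h1 h2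
    simp only [dualQHahn, qquot_of_ne (show x ≠ 0 by omega), zpow_cast_sub h0, pow_two_mul,
      ← div_eq_mul_inv]
    rw [show q * (a * b / q) = a * b by field_simp]
    generalize 1 - a * b / q * (q ^ x) ^ 2 = u1 at *
    generalize 1 - a * b * (q ^ x) ^ 2 = u2 at *
    have h1 := h1.ne'
    have h2 := h2.ne'
    field_simp
    ring
  · obtain ⟨k, rfl⟩ := Nat.exists_eq_add_of_le' hx
    have h1 : 1 - a * b * q ^ (2 * k) ≠ 0 := (sub_pos.2 (pow_mul_lt_one hq.1 hq.2 hab _)).ne'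
    have h2 : 1 - a * b * q ^ (2 * k + 1) ≠ 0 :=
      (sub_pos.2 (pow_mul_lt_one hq.1 hq.2 hab _)).ne'
    have h3 := (pow_pos hq.1 k).ne'
    simp only [dualQHahn]
    rw [show 2 * ((k + 1 : ℕ) : ℤ) - 2 = (2 * k : ℕ) by push_cast; ring,
      show 2 * ((k + 1 : ℕ) : ℤ) - 1 = (2 * k + 1 : ℕ) by push_cast; ring,
      show ((k + 1 : ℕ) : ℤ) - N - 1 = k - N by push_cast; ring,
      show ((k + 1 : ℕ) : ℤ) + N - 1 = (k + N : ℕ) by push_cast; ring,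
      show ((k + 1 : ℕ) : ℤ) - 1 = k by push_cast; ring, zpow_cast_sub h0, zpow_natCast,
      zpow_natCast, zpow_natCast, zpow_natCast,
      show 1 - a * b / q * (q ^ (k + 1)) ^ 2 = 1 - a * b * q ^ (2 * k + 1) by
        field_simp
        ring,
      show q * 1 - a * b / q * (q ^ (k + 1)) ^ 2 = q * (1 - a * b * q ^ (2 * k)) by
        field_simp
        ring]
    generalize 1 - a * b * q ^ (2 * k) = u1 at *
    generalize 1 - a * b * q ^ (2 * k + 1) = u2 at *
    rw [pow_add q k N, pow_succ' q k]
    field_simp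
    ring

lemma qHahn_weight_succ {N x : ℕ} {q a b : ℝ} (hq : 0 < q ∧ q < 1) (ha : 0 < a)
    (hb : b < 1) (hx : x < N) :
    (qHahn N q a b).phi0sq (x + 1) * (qHahn N q a b).D (x + 1) =
      (qHahn N q a b).phi0sq x * (qHahn N q a b).B x := by
  have h := qbinom_succ hq hx
  have h0 := hq.1.ne'
  have h1 := (qpoch_pos hq.1 hq.2 hb N).ne'
  have h2 := (pow_pos hq.1 x).ne'
  have h3 := (pow_pos hq.1 N).ne'
  have h4 := (pow_pos ha x).ne'
  have e1 : qpoch b q (N - x) = qpoch b q (N - (x + 1)) * (1 - b * (q ^ N / (q * q ^ x))) := by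
    rw [show N - x = N - (x + 1) + 1 by omega, qpoch_succ, pow_sub₀ _ h0 hx, pow_succ']
    rfl
  simp only [qHahn, zpow_cast_sub h0]
  rw [e1, qpoch_succ, pow_succ a, pow_succ' q x]
  generalize qpoch b q (N - (x + 1)) = u1
  field_simp at h ⊢
  linear_combination qpoch a q x * u1 * (1 - a * q ^ x) * (q * q ^ x - q ^ N * b) * h

lemma dualQHahn_weight_succ {N x : ℕ} {q a b : ℝ} (hq : 0 < q ∧ q < 1) (ha : 0 < a)
    (hb : b < 1) (hab : a * b < 1) (hN : a * b * q ^ N < 1) (hx : x < N) :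
    (dualQHahn N q a b).phi0sq (x + 1) * (dualQHahn N q a b).D (x + 1) =
      (dualQHahn N q a b).phi0sq x * (dualQHahn N q a b).B x := by
  have h := qbinom_succ hq hx
  have h0 := hq.1.ne'
  have h1 := (qpoch_pos hq.1 hq.2 hb x).ne'
  have h2 := (pow_pos hq.1 x).ne'
  have h3 := (pow_pos hq.1 N).ne'
  have h4 := (pow_pos ha x).ne'
  have h5 := (qpoch_pos hq.1 hq.2 hN x).ne'
  have h6 := (sub_pos.2 (pow_mul_lt_one hq.1 hq.2 hN x)).ne'
  have h7 := (sub_pos.2 (pow_mul_lt_one hq.1 hq.2 hb x)).ne'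
  have h8 := (sub_pos.2 (pow_mul_lt_one hq.1 hq.2 hab x)).ne'
  have h9 := (sub_pos.2 (pow_mul_lt_one hq.1 hq.2 hab (2 * x))).ne'
  have h10 := (sub_pos.2 (pow_mul_lt_one hq.1 hq.2 hab (2 * x + 1))).ne'
  have h11 := (qquot_pos hq.1 hq.2 (s := a * b * q⁻¹) (by
    rwa [inv_mul_cancel_right₀ h0]) x).ne'
  simp only [dualQHahn]
  rw [show 2 * ((x + 1 : ℕ) : ℤ) - 2 = (2 * x : ℕ) by push_cast; ring,
    show 2 * ((x + 1 : ℕ) : ℤ) - 1 = (2 * x + 1 : ℕ) by push_cast; ring,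
    show ((x + 1 : ℕ) : ℤ) - N - 1 = x - N by push_cast; ring,
    show ((x + 1 : ℕ) : ℤ) + N - 1 = (x + N : ℕ) by push_cast; ring,
    show ((x + 1 : ℕ) : ℤ) - 1 = x by push_cast; ring, zpow_cast_sub h0, zpow_natCast,
    zpow_natCast, zpow_natCast, zpow_natCast, qquot_of_ne x.succ_ne_zero,
    show 1 - a * b * q⁻¹ * q ^ (x + 1) = 1 - a * b * q ^ x by
      field_simp
      ring,
    show 1 - a * b * q⁻¹ * q ^ (2 * (x + 1)) = 1 - a * b * q ^ (2 * x + 1) by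
      field_simp
      ring,
    show 1 - a * b * q ^ (x + N) = 1 - a * b * q ^ N * q ^ x by ring]
  simp only [qpoch_succ]
  rw [pow_succ a, pow_succ' q x]
  generalize 1 - a * b * q ^ (2 * x) = u1 at *
  generalize 1 - a * b * q ^ (2 * x + 1) = u2 at *
  generalize 1 - a * b * q ^ x = u3 at *
  generalize 1 - a * b * q ^ N * q ^ x = u4 at *
  generalize 1 - b * q ^ x = u5 at *
  generalize qquot (a * b * q⁻¹) q x = u6 at *
  generalize qpoch b q x = u7 at *
  generalize qpoch (a * b * q ^ N) q x = u8 at *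
  generalize qpoch (a * b) q x = u9 at *
  generalize qpoch a q x = u10 at *
  field_simp at h ⊢
  linear_combination u10 * u9 * (1 - a * q ^ x) * h

lemma qHahn_phi0sq_zero {q a b : ℝ} (hq : 0 < q ∧ q < 1) (hb : b < 1) (N : ℕ) :
    (qHahn N q a b).phi0sq 0 = 1 := by
  have := (qpoch_pos hq.1 hq.2 hb N).ne'
  simp [qHahn, hq, this]

lemma dualQHahn_phi0sq_zero {q : ℝ} (hq : 0 < q ∧ q < 1) (N : ℕ) (a b : ℝ) :
    (dualQHahn N q a b).phi0sq 0 = 1 := by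
  simp [dualQHahn, hq]

lemma qHahn_death_pos {N x : ℕ} {q a b : ℝ} (hq : 0 < q ∧ q < 1) (ha : 0 < a) (hb : b < 1)
    (hx : x < N) : 0 < (qHahn N q a b).D (x + 1) := by
  simp only [qHahn, zpow_cast_sub hq.1.ne']
  refine mul_pos (mul_pos (mul_pos ha (inv_pos.2 hq.1))
    (sub_pos.2 (pow_lt_one₀ hq.1.le hq.2 x.succ_ne_zero))) (sub_pos.2 (hb.trans_le ?_))
  exact (one_le_div (pow_pos hq.1 N)).2 (pow_le_pow_of_le_one hq.1.le hq.2.le hx)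

lemma dualQHahn_death_pos {q a b : ℝ} (hq : 0 < q ∧ q < 1) (ha : 0 < a) (hb : b < 1)
    (hab : a * b < 1) (N x : ℕ) : 0 < (dualQHahn N q a b).D (x + 1) := by
  simp only [dualQHahn]
  rw [show 2 * ((x + 1 : ℕ) : ℤ) - 2 = (2 * x : ℕ) by push_cast; ring,
    show 2 * ((x + 1 : ℕ) : ℤ) - 1 = (2 * x + 1 : ℕ) by push_cast; ring,
    show ((x + 1 : ℕ) : ℤ) + N - 1 = (x + N : ℕ) by push_cast; ring,
    show ((x + 1 : ℕ) : ℤ) - 1 = x by push_cast; ring, zpow_natCast,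
    zpow_natCast, zpow_natCast, zpow_natCast]
  have key : ∀ k, 0 < 1 - a * b * q ^ k := fun k => sub_pos.2 (pow_mul_lt_one hq.1 hq.2 hab k)
  exact mul_pos (mul_pos ha (zpow_pos hq.1 _)) (div_pos (mul_pos (mul_pos
    (sub_pos.2 (pow_lt_one₀ hq.1.le hq.2 x.succ_ne_zero)) (key _))
    (sub_pos.2 (pow_mul_lt_one hq.1 hq.2 hb x))) (mul_pos (key _) (key _)))

lemma isSolved_qHahn (N : ℕ) (q a b : ℝ) (hq : 0 < q ∧ q < 1) (ha : 0 < a ∧ a < 1)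
    (hb : 0 < b ∧ b < 1) : (qHahn N q a b).IsSolved := by
  have h0 := hq.1.ne'
  have hX : ∀ x : ℕ, 0 < q ^ x := pow_pos hq.1
  have hQ := (hX N).ne'
  have hab : a * b < 1 := mul_lt_one_of_nonneg_of_lt_one_left ha.1.le ha.2 hb.2.le
  have hN : a * b * q ^ N < 1 := pow_mul_lt_one hq.1 hq.2 hab N
  refine Data.isSolved_of_ladder rfl (A := (dualQHahn N q a b).B) (C := (dualQHahn N q a b).D)
    (by rw [eta_qHahn, ev_qHahn h0]; exact isLadder_qHahn hq N a b)
    (by rw [eta_qHahn, ev_qHahn h0]; exact isLadder_dualQHahn hq hab N)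
    (by rw [eta_qHahn]; exact strictMono_qSpec hq.1 hq.2 fun j _ => by norm_num)
    (by rw [ev_qHahn h0]; exact strictMono_qSpec hq.1 hq.2 (qHahn_gap hq hab)) (fun x hx => ?_)
    (by simp [qHahn]) (fun x hx => qHahn_death_pos hq ha.1 hb.2 hx) (fun hφ n hn x hx => ?_)
    (qHahn_phi0sq_zero hq hb.2 N) (fun x hx => qHahn_weight_succ hq ha.1 hb.2 hx)
    (dualQHahn_phi0sq_zero hq N a b) (fun n hn => dualQHahn_weight_succ hq ha.1 hb.2 hab hN hn)
    (fun n hn => (dualQHahn_death_pos hq ha.1 hb.2 hab N n).ne') (by simp [dualQHahn]) ?_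
  · simp only [qHahn, zpow_cast_sub h0]
    exact mul_pos (sub_pos.2 (pow_mul_lt_one hq.1 hq.2 ha.2 x))
      (sub_pos.2 (one_lt_pow_div hq.1 hq.2 hx))
  · refine qhyp_eq_splitPoly hq (fun k hk => hφ k (hk.trans_le hn)) (fun k hk => ?_) fun k hk => ?_
    · simp only [List.map_cons, List.map_nil, List.prod_cons, List.prod_nil, zpow_neg_cast]
      refine mul_ne_zero (sub_pos.2 (pow_mul_lt_one hq.1 hq.2 ha.2 k)).ne'
        (mul_ne_zero (sub_neg.2 ?_).ne one_ne_zero)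
      rw [mul_comm]
      exact one_lt_pow_div hq.1 hq.2 (hk.trans_le hn)
    · have h1 := (hX n).ne'
      have h2 := (hX x).ne'
      have h3 := (hX k).ne'
      simp only [List.map_cons, List.map_nil, List.prod_cons, List.prod_nil, List.length_cons,
        List.length_nil, qOff, qHahn, zpow_neg_cast, zpow_cast_sub_one h0]
      norm_num
      field_simp
      ring
  · refine mul_prod_eq_prod (r := fun k => (1 - b * (q ^ N / (q * q ^ k))) *
      ((q * q ^ k) ^ 2 * (a * (q * q ^ N)⁻¹)) / (1 - a * b * q ^ k)) ?_ fun k hk => ?_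
    · have e1 : qpoch b q N = ∏ k ∈ Finset.range N, (1 - b * (q ^ N / (q * q ^ k))) := by
        rw [qpoch, ← Finset.prod_range_reflect]
        refine Finset.prod_congr rfl fun k hk => ?_
        rw [Nat.sub_sub, pow_sub₀ _ h0 (by have := Finset.mem_range.1 hk; omega), pow_add,
          pow_one]
        rfl
      rw [Finset.prod_div_distrib, Finset.prod_mul_distrib, Finset.prod_mul_distrib, ← e1,
        prod_pow_sq, Finset.prod_const, Finset.card_range]
      simp only [qHahn]
      rw [mul_pow a, inv_pow, mul_pow q]
      have h1 := (hX N).ne'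
      have h2 := (pow_pos (hX N) N).ne'
      rw [show q ^ N * (q ^ N) ^ N * (a ^ N * (q ^ N * (q ^ N) ^ N)⁻¹) = a ^ N by field_simp]
      rfl
    · have h1 := (hX k).ne'
      have h2 := (sub_pos.2 (pow_mul_lt_one hq.1 hq.2 hab k)).ne'
      simp only [qHahn, zpow_cast_sub h0, zpow_neg_cast]
      rw [show ((k + 1 : ℕ) : ℤ) - 1 = k by push_cast; ring, zpow_natCast, pow_succ' q k]
      generalize 1 - a * b * q ^ k = u at *
      field_simp

lemma isSolved_dualQHahn (N : ℕ) (q a b : ℝ) (hq : 0 < q ∧ q < 1) (ha : 0 < a ∧ a < 1)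
    (hb : 0 < b ∧ b < 1) : (dualQHahn N q a b).IsSolved := by
  have h0 := hq.1.ne'
  have hX : ∀ x : ℕ, 0 < q ^ x := pow_pos hq.1
  have hQ := (hX N).ne'
  have hab : a * b < 1 := mul_lt_one_of_nonneg_of_lt_one_left ha.1.le ha.2 hb.2.le
  have hN : a * b * q ^ N < 1 := pow_mul_lt_one hq.1 hq.2 hab N
  have hη : (dualQHahn N q a b).eta = qSpec q 1 (a * b / q) := ev_qHahn h0 N a b
  have hE : (dualQHahn N q a b).E = qSpec q 1 0 := eta_eq_qSpec fun _ => rfl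
  refine Data.isSolved_of_ladder rfl (A := (qHahn N q a b).B) (C := (qHahn N q a b).D)
    (by rw [hη, hE]; exact isLadder_dualQHahn hq hab N)
    (by rw [hη, hE]; exact isLadder_qHahn hq N a b)
    (by rw [hη]; exact strictMono_qSpec hq.1 hq.2 (qHahn_gap hq hab))
    (by rw [hE]; exact strictMono_qSpec hq.1 hq.2 fun j _ => by norm_num) (fun x hx => ?_)
    (by simp [dualQHahn]) (fun x hx => dualQHahn_death_pos hq ha.1 hb.2 hab N x)
    (fun hφ n hn x hx => ?_)
    (dualQHahn_phi0sq_zero hq N a b) (fun x hx => dualQHahn_weight_succ hq ha.1 hb.2 hab hN hx)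
    (qHahn_phi0sq_zero (a := a) hq hb.2 N) (fun n hn => qHahn_weight_succ hq ha.1 hb.2 hn)
    (fun n hn => (qHahn_death_pos hq ha.1 hb.2 hn).ne') (by simp [qHahn]) ?_
  · simp only [dualQHahn, zpow_cast_sub h0]
    exact mul_pos (qquot_pos hq.1 hq.2 (by rwa [inv_mul_cancel_right₀ h0]) x)
      (div_pos (mul_pos (sub_pos.2 (one_lt_pow_div hq.1 hq.2 hx))
        (sub_pos.2 (pow_mul_lt_one hq.1 hq.2 ha.2 x)))
        (sub_pos.2 (pow_mul_lt_one hq.1 hq.2 hab _)))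
  · refine qhyp_eq_splitPoly hq (fun k hk => hφ k (hk.trans_le hn)) (fun k hk => ?_) fun k hk => ?_
    · simp only [List.map_cons, List.map_nil, List.prod_cons, List.prod_nil, zpow_neg_cast]
      refine mul_ne_zero (sub_pos.2 (pow_mul_lt_one hq.1 hq.2 ha.2 k)).ne'
        (mul_ne_zero (sub_neg.2 ?_).ne one_ne_zero)
      rw [mul_comm]
      exact one_lt_pow_div hq.1 hq.2 (hk.trans_le hn)
    · have h1 := (hX n).ne'
      have h2 := (hX x).ne'
      have h3 := (hX k).ne'
      simp only [List.map_cons, List.map_nil, List.prod_cons, List.prod_nil, List.length_cons,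
        List.length_nil, qOff, dualQHahn, zpow_neg_cast, zpow_cast_sub_one h0]
      norm_num
      field_simp
      ring
  · refine mul_prod_eq_prod (r := fun k => (1 - b * q ^ k) * (1 - a * b * q ^ N * q ^ k) *
      ((q * q ^ k) ^ 2 * (a * (q * q ^ N)⁻¹)) /
      ((1 - a * b * q ^ (2 * k)) * (1 - a * b * q ^ (2 * k + 1)))) ?_ fun k hk => ?_
    · have h1 := (hX N).ne'
      have h2 := (pow_pos (hX N) N).ne'
      have h3 := (qpoch_pos hq.1 hq.2 hab N).ne'
      have h4 := (qpoch_pos hq.1 hq.2 hN N).ne'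
      rw [Finset.prod_div_distrib, Finset.prod_mul_distrib, Finset.prod_mul_distrib,
        Finset.prod_mul_distrib, ← qpoch_two_mul, two_mul, qpoch_add,
        prod_pow_sq, Finset.prod_const, Finset.card_range, mul_pow a, inv_pow, mul_pow q,
        show q ^ N * (q ^ N) ^ N * (a ^ N * (q ^ N * (q ^ N) ^ N)⁻¹) = a ^ N by field_simp]
      change qpoch b q N * a ^ N / qpoch (a * b) q N =
        qpoch b q N * qpoch (a * b * q ^ N) q N * a ^ N / _
      field_simp
    · have h1 := (hX k).ne'
      have h2 := (sub_pos.2 (pow_mul_lt_one hq.1 hq.2 hab (2 * k))).ne'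
      have h3 := (sub_pos.2 (pow_mul_lt_one hq.1 hq.2 hab (2 * k + 1))).ne'
      simp only [dualQHahn, zpow_neg_cast]
      rw [show 2 * ((k + 1 : ℕ) : ℤ) - 2 = (2 * k : ℕ) by push_cast; ring,
        show 2 * ((k + 1 : ℕ) : ℤ) - 1 = (2 * k + 1 : ℕ) by push_cast; ring,
        show ((k + 1 : ℕ) : ℤ) - N - 1 = k - N by push_cast; ring,
        show ((k + 1 : ℕ) : ℤ) + N - 1 = (k + N : ℕ) by push_cast; ring,
        show ((k + 1 : ℕ) : ℤ) - 1 = k by push_cast; ring, zpow_cast_sub h0, zpow_natCast,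
        zpow_natCast, zpow_natCast, zpow_natCast, pow_add q k N]
      generalize 1 - a * b * q ^ (2 * k) = u1 at *
      generalize 1 - a * b * q ^ (2 * k + 1) = u2 at *
      rw [pow_succ' q k]
      field_simp

/-! ### The `q`-Racah polynomials -/

/-- The birth rate of the `q`-Racah polynomials as a function of the four parameters, in a form
that is also valid for `d = 1`. -/
def qRacahBirth (q a b c d : ℝ) (x : ℕ) : ℝ :=
  -(qquot d q x * ((1 - a * q ^ x) * (1 - b * q ^ x) * (1 - c * q ^ x) /
    (1 - d * q ^ (2 * x + 1))))

/-- The death rate of the `q`-Racah polynomials as a function of the four parameters and of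
`e = a b c d⁻¹ q⁻¹`. -/
def qRacahDeath (q a b c d e : ℝ) (x : ℕ) : ℝ :=
  -e * ((1 - a⁻¹ * d * q ^ x) * (1 - b⁻¹ * d * q ^ x) * (1 - c⁻¹ * d * q ^ x) * (1 - q ^ x) /
    ((1 - d * q ^ (2 * (x : ℤ) - 1)) * (1 - d * q ^ (2 * x))))

/-- The weight of the `q`-Racah polynomials, in a form that is also valid for `d = 1`. -/
def qRacahWeight (q a b c d e : ℝ) (x : ℕ) : ℝ :=
  qpoch a q x * qpoch b q x * qpoch c q x * (qpoch (d * q) q x / qquot d q x) /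
    (qpoch (a⁻¹ * d * q) q x * qpoch (b⁻¹ * d * q) q x * qpoch (c⁻¹ * d * q) q x *
      qpoch q q x * e ^ x)

lemma qRacah_gap {q d : ℝ} (hq : 0 < q ∧ q < 1) (hd : d * q < 1) (j : ℕ) (hj : 1 ≤ j) :
    0 < 1 - d * q ^ j := by
  obtain ⟨k, rfl⟩ := Nat.exists_eq_add_of_le' hj
  rw [pow_succ', ← mul_assoc]
  exact sub_pos.2 (pow_mul_lt_one hq.1 hq.2 hd k)

lemma isLadder_qRacah {q a b c d e : ℝ} (hq : 0 < q ∧ q < 1) (hd : d * q < 1) (ha : a ≠ 0)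
    (hb : b ≠ 0) (hc : c ≠ 0) (he : a * b * c = d * e * q) :
    IsLadder (qRacahBirth q a b c d) (qRacahDeath q a b c d e) (qSpec q 1 d) (qSpec q 1 e)
      (qOff q 1 d 1 e (-(a + b + c)) ((a * b + a * c + b * c) / q)) := by
  have h0 := hq.1.ne'
  refine isLadder_q hq.1 (qRacah_gap hq hd) ?_ ?_ (fun x hx => ?_) (fun x hx => ?_)
  · simp [qRacahDeath]
  · have h1 := (qRacah_gap hq hd 1 le_rfl).ne'
    rw [pow_one] at h1
    simp only [qRacahBirth, qquot_zero, pow_zero, mul_one, mul_zero, zero_add, pow_one, one_mul]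
    rw [mul_comm q d]
    field_simp
    linear_combination he
  · have h1 := (qRacah_gap hq hd (2 * x) (by omega)).ne'
    have h2 := (qRacah_gap hq hd (2 * x + 1) (by omega)).ne'
    have e1 : 1 - d * q ^ (2 * x) = 1 - d * (q ^ x) ^ 2 := by rw [pow_two_mul]
    have e2 : 1 - d * q ^ (2 * x + 1) = 1 - q * d * (q ^ x) ^ 2 := by
      rw [pow_succ, pow_two_mul]
      ring
    rw [e1] at h1
    rw [e2] at h2
    rw [qRacahBirth, qquot_of_ne (show x ≠ 0 by omega), e1, e2, one_mul]
    generalize 1 - d * (q ^ x) ^ 2 = u1 at *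
    generalize 1 - q * d * (q ^ x) ^ 2 = u2 at *
    generalize 1 - d * q ^ x = u3 at *
    generalize q ^ x = X at *
    field_simp
    linear_combination u3 * X ^ 3 * he
  · obtain ⟨k, rfl⟩ := Nat.exists_eq_add_of_le' hx
    have h1 := (qRacah_gap hq hd (2 * k + 1) (by omega)).ne'
    have h2 := (qRacah_gap hq hd (2 * (k + 1)) (by omega)).ne'
    have e1 : 1 * 1 - d * (q ^ (k + 1)) ^ 2 = 1 - d * q ^ (2 * (k + 1)) := by
      rw [pow_two_mul]
      ring
    have e2 : q * 1 - d * (q ^ (k + 1)) ^ 2 = q * (1 - d * q ^ (2 * k + 1)) := by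
      rw [pow_succ q (2 * k), pow_two_mul]
      ring
    rw [one_mul] at e1
    rw [qRacahDeath, show 2 * ((k + 1 : ℕ) : ℤ) - 1 = (2 * k + 1 : ℕ) by push_cast; ring,
      zpow_natCast, e1, e2]
    generalize 1 - d * q ^ (2 * (k + 1)) = u1 at *
    generalize 1 - d * q ^ (2 * k + 1) = u2 at *
    generalize q ^ (k + 1) = X at *
    -- the death rate involves the inverses of the parameters, whose product is fixed by `he`
    have e3 : q * e * ((1 - a⁻¹ * d * X) * (1 - b⁻¹ * d * X) * (1 - c⁻¹ * d * X)) =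
        q * e - (a * b + a * c + b * c) * X + d * (a + b + c) * X ^ 2 - d ^ 2 * X ^ 3 := by
      rcases eq_or_ne d 0 with rfl | hd0
      · simp [ha, hb, hc] at he
      have : e = a * b * c / (d * q) := by
        field_simp
        linear_combination -he
      rw [this]
      field_simp
      ring
    have e4 : -e * ((1 - a⁻¹ * d * X) * (1 - b⁻¹ * d * X) * (1 - c⁻¹ * d * X) * (1 - X) /
        (u2 * u1)) * (u1 * (q * u2)) =
        -(q * e * ((1 - a⁻¹ * d * X) * (1 - b⁻¹ * d * X) * (1 - c⁻¹ * d * X))) * (1 - X) := by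
      generalize (1 - a⁻¹ * d * X) * (1 - b⁻¹ * d * X) * (1 - c⁻¹ * d * X) = W
      field_simp
    rw [e4, e3]
    field_simp
    ring

lemma qRacahWeight_zero (q a b c d e : ℝ) : qRacahWeight q a b c d e 0 = 1 := by
  simp [qRacahWeight]

lemma qRacahWeight_succ {q a b c d e : ℝ} {x : ℕ} (hq : 0 < q ∧ q < 1) (hd : d * q < 1)
    (he : e ≠ 0) (ha : 1 - a⁻¹ * d * q * q ^ x ≠ 0) (hb : 1 - b⁻¹ * d * q * q ^ x ≠ 0)
    (hc : 1 - c⁻¹ * d * q * q ^ x ≠ 0) :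
    qRacahWeight q a b c d e (x + 1) * qRacahDeath q a b c d e (x + 1) =
      qRacahWeight q a b c d e x * qRacahBirth q a b c d x := by
  have h1 : 1 - q * q ^ x ≠ 0 := (sub_pos.2 (pow_mul_lt_one hq.1 hq.2 hq.2 x)).ne'
  have h2 := (qRacah_gap hq hd (2 * x + 1) (by omega)).ne'
  have h3 := (qRacah_gap hq hd (2 * (x + 1)) (by omega)).ne'
  have h4 := (qRacah_gap hq hd (x + 1) (by omega)).ne'
  have h5 := (qquot_pos hq.1 hq.2 hd x).ne'
  simp only [qRacahWeight, qRacahDeath, qRacahBirth, qpoch_succ]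
  rw [qquot_of_ne (Nat.succ_ne_zero x),
    show 2 * ((x + 1 : ℕ) : ℤ) - 1 = (2 * x + 1 : ℕ) by push_cast; ring, zpow_natCast,
    show 1 - d * q * q ^ x = 1 - d * q ^ (x + 1) by ring,
    show 1 - a⁻¹ * d * q ^ (x + 1) = 1 - a⁻¹ * d * q * q ^ x by ring,
    show 1 - b⁻¹ * d * q ^ (x + 1) = 1 - b⁻¹ * d * q * q ^ x by ring,
    show 1 - c⁻¹ * d * q ^ (x + 1) = 1 - c⁻¹ * d * q * q ^ x by ring,
    show 1 - q ^ (x + 1) = 1 - q * q ^ x by ring, pow_succ e]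
  generalize 1 - a⁻¹ * d * q * q ^ x = u1 at *
  generalize 1 - b⁻¹ * d * q * q ^ x = u2 at *
  generalize 1 - c⁻¹ * d * q * q ^ x = u3 at *
  generalize 1 - q * q ^ x = u4 at *
  generalize 1 - d * q ^ (2 * x + 1) = u5 at *
  generalize 1 - d * q ^ (2 * (x + 1)) = u6 at *
  generalize 1 - d * q ^ (x + 1) = u7 at *
  generalize 1 - a * q ^ x = w1 at *
  generalize 1 - b * q ^ x = w2 at *
  generalize 1 - c * q ^ x = w3 at *
  have e1 : ∀ v1 v2 v3 v4 v5 : ℝ, v1 * u1 * (v2 * u2) * (v3 * u3) * (v4 * u4) * (v5 * e) =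
      v1 * v2 * v3 * v4 * v5 * (u1 * u2 * u3 * u4 * e) := fun v1 v2 v3 v4 v5 => by ring
  have e2 : ∀ v1 v2 v3 v4 : ℝ, v1 * w1 * (v2 * w2) * (v3 * w3) * (v4 * u7 / (u7 / u6)) =
      v1 * v2 * v3 * v4 * (w1 * w2 * w3 * u6) := fun v1 v2 v3 v4 => by
    field_simp
  have e3 : ∀ v1 v2 v3 v4 : ℝ, v1 * v2 * v3 * (v4 / qquot d q x) =
      v1 * v2 * v3 * v4 / qquot d q x := fun v1 v2 v3 v4 => by ring
  rw [e1, e2, e3, mul_div_mul_comm]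
  generalize qpoch a q x * qpoch b q x * qpoch c q x * qpoch (d * q) q x = V1
  generalize qpoch (a⁻¹ * d * q) q x * qpoch (b⁻¹ * d * q) q x * qpoch (c⁻¹ * d * q) q x *
    qpoch q q x * e ^ x = V2
  generalize qquot d q x = r at *
  rw [div_right_comm V1]
  generalize V1 / V2 = V
  field_simp

lemma isSolved_qRacah (N : ℕ) (q a b d : ℝ) (hq : 0 < q ∧ q < 1) (hd : 0 < d ∧ d < 1)
    (ha : 0 < a ∧ a < q ^ N * d) (hb : q * d < b ∧ b < 1) : (qRacah N q a b d).IsSolved := by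
  have h0 := hq.1.ne'
  have hX : ∀ x : ℕ, 0 < q ^ x := pow_pos hq.1
  have hX1 : ∀ x : ℕ, q ^ x ≤ 1 := fun x => pow_le_one₀ hq.1.le hq.2.le
  have hQ := hX N
  have hqd : 0 < q * d := mul_pos hq.1 hd.1
  have hb0 : 0 < b := hqd.trans hb.1
  obtain ⟨c, hc⟩ : ∃ c : ℝ, c = (q ^ N)⁻¹ := ⟨_, rfl⟩
  have hc' : q ^ (-(N : ℤ)) = c := by rw [zpow_neg_cast, hc]
  have hc0 : 0 < c := hc ▸ inv_pos.2 hQ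
  have hcN : c * q ^ N = 1 := by rw [hc, inv_mul_cancel₀ hQ.ne']
  -- the dual family has the parameters `d` and `e` exchanged
  obtain ⟨e, he⟩ : ∃ e : ℝ, e = a * b * c * d⁻¹ * q⁻¹ := ⟨_, rfl⟩
  have hd0 := hd.1.ne'
  have he0 : 0 < e := by
    rw [he]
    exact mul_pos (mul_pos (mul_pos (mul_pos ha.1 hb0) hc0) (inv_pos.2 hd.1)) (inv_pos.2 hq.1)
  have hed : a * b * c = d * e * q := by
    rw [he]
    field_simp
  have hdq : d * q < 1 := mul_lt_one_of_nonneg_of_lt_one_left hd.1.le hd.2 hq.2.le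
  have hac : a * c < d := by
    have := mul_lt_mul_of_pos_right ha.2 hc0
    rwa [mul_right_comm, mul_comm (q ^ N), hcN, one_mul] at this
  have heb : e * q < b := by
    have : d * (e * q) < d * b := by nlinarith
    exact lt_of_mul_lt_mul_left this hd.1.le
  have heq : e * q < 1 := heb.trans hb.2
  have ha1 : a < 1 := ha.2.trans_le ((mul_le_mul_of_nonneg_right (hX1 N) hd.1.le).trans
    (by linarith [hd.2]))
  have ha0 := ha.1.ne'
  have hb0' := hb0.ne'
  have hc0' := hc0.ne'
  have h1d : 1 - d ≠ 0 := (sub_pos.2 hd.2).ne'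
  have hquot : ∀ x : ℕ, qquot d q x = (1 - d * q ^ x) / (1 - d * q ^ (2 * x)) := fun x => by
    rcases eq_or_ne x 0 with rfl | h
    · simp [h1d]
    · exact qquot_of_ne h
  have hdx : ∀ x : ℕ, 1 - d * q ^ x ≠ 0 := fun x =>
    (sub_pos.2 (pow_mul_lt_one hq.1 hq.2 hd.2 x)).ne'
  have hB : (qRacah N q a b d).B = qRacahBirth q a b c d := by
    funext x
    simp only [qRacah, qRacahBirth, hquot, hc']
    have h1 := hdx (2 * x)
    have h2 := hdx (2 * x + 1)
    generalize 1 - d * q ^ (2 * x) = u1 at *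
    generalize 1 - d * q ^ (2 * x + 1) = u2 at *
    field_simp
  have hD : (qRacah N q a b d).D = qRacahDeath q a b c d e := by
    funext x
    simp only [qRacah, qRacahDeath, hc', he]
  have hw : (qRacah N q a b d).phi0sq = qRacahWeight q a b c d e := by
    funext x
    have h1 := hdx x
    have h2 := hdx (2 * x)
    have h3 := qpoch_shift d q x
    simp only [qRacah, qRacahWeight, hquot, hc', ← he]
    generalize 1 - d * q ^ (2 * x) = u1 at *
    generalize 1 - d * q ^ x = u2 at *
    rw [show qpoch d q x = (1 - d) * qpoch (d * q) q x / u2 by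
      field_simp
      linear_combination -h3]
    rw [div_mul_eq_mul_div]
    congr 1
    field_simp
  have hη : (qRacah N q a b d).eta = qSpec q 1 d := by
    funext x
    simp [qRacah, qSpec]
  have hE : (qRacah N q a b d).E = qSpec q 1 e := by
    funext x
    simp only [qRacah, qSpec, zpow_neg_cast, he, hc]
  have hdr : (qRacah N q a b d).dratio = qRacahWeight q a b c e d := by
    funext x
    simp only [qRacah, qRacahWeight, hc', he]
  -- the signs of the factors of the rates
  have sa : ∀ x < N, 1 - a⁻¹ * d * q * q ^ x < 0 := fun x hx => by
    have h1 : q ^ N ≤ q * q ^ x := by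
      rw [← pow_succ']
      exact pow_le_pow_of_le_one hq.1.le hq.2.le hx
    have h2 : a < d * (q * q ^ x) := by
      have := mul_le_mul_of_nonneg_right h1 hd.1.le
      linarith [ha.2]
    rw [sub_neg, mul_assoc, mul_assoc, lt_inv_mul_iff₀ ha.1, mul_one]
    exact h2
  have sb : ∀ x, 0 < 1 - b⁻¹ * d * q * q ^ x := fun x => by
    refine sub_pos.2 (pow_mul_lt_one hq.1 hq.2 ?_ x)
    rw [mul_assoc, inv_mul_lt_one₀ hb0]
    linarith [hb.1]
  have sc : ∀ {s : ℝ}, s * q < 1 → 0 < s → ∀ x, 0 < 1 - c⁻¹ * s * q * q ^ x := fun hs hs0 x => by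
    refine sub_pos.2 (pow_mul_lt_one hq.1 hq.2 ?_ x)
    rw [hc, inv_inv, mul_assoc]
    exact mul_lt_one_of_nonneg_of_lt_one_right (hX1 N) (mul_pos hs0 hq.1).le hs
  have sc' : ∀ x < N, 1 - c * q ^ x < 0 := fun x hx => by
    rw [sub_neg, mul_comm, hc]
    exact one_lt_pow_div hq.1 hq.2 hx
  have sa' : ∀ x < N, 1 - a⁻¹ * e * q * q ^ x < 0 := fun x hx => by
    have h1 : 1 ≤ c * (q * q ^ x) := by
      rw [← hcN, ← pow_succ']
      exact mul_le_mul_of_nonneg_left (pow_le_pow_of_le_one hq.1.le hq.2.le hx) hc0.le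
    have h2 : a⁻¹ * e * q * q ^ x = b * (c * (q * q ^ x)) / (d * q) := by
      rw [he]
      field_simp
    rw [h2, sub_neg, one_lt_div (mul_pos hd.1 hq.1)]
    nlinarith [hb.1]
  have sb' : ∀ x, 0 < 1 - b⁻¹ * e * q * q ^ x := fun x => by
    refine sub_pos.2 (pow_mul_lt_one hq.1 hq.2 ?_ x)
    rwa [mul_assoc, inv_mul_lt_one₀ hb0]
  have sq : ∀ x, 0 < 1 - q ^ (x + 1) := fun x =>
    sub_pos.2 (pow_lt_one₀ hq.1.le hq.2 x.succ_ne_zero)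
  have death_pos : ∀ {s t : ℝ}, 0 < t → s * q < 1 → ∀ x, 1 - a⁻¹ * s * q * q ^ x < 0 →
      0 < 1 - b⁻¹ * s * q * q ^ x → 0 < 1 - c⁻¹ * s * q * q ^ x →
      0 < qRacahDeath q a b c s t (x + 1) := fun {s t} ht hs x h1 h2 h3 => by
    rw [qRacahDeath, show 2 * ((x + 1 : ℕ) : ℤ) - 1 = (2 * x + 1 : ℕ) by push_cast; ring,
      zpow_natCast, show 1 - a⁻¹ * s * q ^ (x + 1) = 1 - a⁻¹ * s * q * q ^ x by ring,
      show 1 - b⁻¹ * s * q ^ (x + 1) = 1 - b⁻¹ * s * q * q ^ x by ring,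
      show 1 - c⁻¹ * s * q ^ (x + 1) = 1 - c⁻¹ * s * q * q ^ x by ring]
    exact mul_pos_of_neg_of_neg (neg_neg_of_pos ht) (div_neg_of_neg_of_pos
      (mul_neg_of_neg_of_pos (mul_neg_of_neg_of_pos (mul_neg_of_neg_of_pos h1 h2) h3) (sq x))
      (mul_pos (qRacah_gap hq hs _ (by omega)) (qRacah_gap hq hs _ (by omega))))
  refine Data.isSolved_of_ladder rfl (A := qRacahBirth q a b c e) (C := qRacahDeath q a b c e d)
    (by rw [hη, hE, hB, hD]; exact isLadder_qRacah hq hdq ha0 hb0' hc0' hed)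
    (by
      rw [hη, hE, qOff_swap]
      exact isLadder_qRacah hq heq ha0 hb0' hc0' (by rw [hed]; ring))
    (by rw [hη]; exact strictMono_qSpec hq.1 hq.2 (qRacah_gap hq hdq))
    (by rw [hE]; exact strictMono_qSpec hq.1 hq.2 (qRacah_gap hq heq)) (fun x hx => ?_)
    (by simp [hB, qRacahBirth, hcN])
    (fun x hx => by rw [hD]; exact death_pos he0 hdq x (sa x hx) (sb x) (sc hdq hd.1 x))
    (fun hφ n hn x hx => ?_) (by rw [hw, qRacahWeight_zero])
    (fun x hx => by
      rw [hw, hB, hD]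
      exact qRacahWeight_succ hq hdq he0.ne' (sa x hx).ne (sb x).ne' (sc hdq hd.1 x).ne')
    (by rw [hdr, qRacahWeight_zero])
    (fun n hn => by
      rw [hdr]
      exact qRacahWeight_succ hq heq hd0 (sa' n hn).ne (sb' n).ne' (sc heq he0 n).ne')
    (fun n hn => (death_pos hd.1 heq n (sa' n hn) (sb' n) (sc heq he0 n)).ne')
    (by simp [qRacahBirth, hcN]) ?_
  · rw [hB, qRacahBirth, Left.neg_pos_iff]
    exact mul_neg_of_pos_of_neg (qquot_pos hq.1 hq.2 hdq x) (div_neg_of_neg_of_pos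
      (mul_neg_of_pos_of_neg (mul_pos (sub_pos.2 (pow_mul_lt_one hq.1 hq.2 ha1 x))
        (sub_pos.2 (pow_mul_lt_one hq.1 hq.2 hb.2 x))) (sc' x hx))
      (qRacah_gap hq hdq _ (by omega)))
  · refine qhyp_eq_splitPoly hq (fun k hk => hφ k (hk.trans_le hn)) (fun k hk => ?_) fun k hk => ?_
    · simp only [List.map_cons, List.map_nil, List.prod_cons, List.prod_nil, hc']
      exact mul_ne_zero (sub_pos.2 (pow_mul_lt_one hq.1 hq.2 ha1 k)).ne'
        (mul_ne_zero (sub_pos.2 (pow_mul_lt_one hq.1 hq.2 hb.2 k)).ne'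
          (mul_ne_zero (sc' k (hk.trans_le hn)).ne one_ne_zero))
    · have h1 := (hX n).ne'
      have h2 := (hX x).ne'
      have h3 := (hX k).ne'
      have hexp : (-q ^ k) ^ (1 + (([a, b, c] : List ℝ).length : ℤ) -
          (([(q ^ n)⁻¹, e * q ^ n, (q ^ x)⁻¹, d * q ^ x] : List ℝ).length : ℤ)) = 1 := by
        norm_num
      simp only [hc', ← he, zpow_neg_cast]
      rw [hexp, hη, hE]
      simp only [List.map_cons, List.map_nil, List.prod_cons, List.prod_nil, qOff, qSpec]
      generalize q ^ n = K at *
      generalize q ^ x = X at *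
      generalize q ^ k = Z at *
      have e1 : q * (1 * 1 / (q * Z ^ 2) + -(a + b + c) / (q * Z) +
          (a * b + a * c + b * c) / q - e * d * Z) =
          (1 - a * Z) * (1 - b * Z) * (1 - c * Z) / Z ^ 2 := by
        field_simp
        linear_combination Z ^ 3 * hed
      have e2 : (1 - K⁻¹ * Z) * (1 - e * K * Z) =
          -Z * ((K⁻¹ - 1) * (1 - e * K) - (Z⁻¹ - 1) * (1 - e * Z)) := by
        field_simp
        ring
      have e3 : (1 - X⁻¹ * Z) * (1 - d * X * Z) =
          -Z * ((X⁻¹ - 1) * (1 - d * X) - (Z⁻¹ - 1) * (1 - d * Z)) := by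
        field_simp
        ring
      calc _ = (1 - K⁻¹ * Z) * (1 - e * K * Z) * ((1 - X⁻¹ * Z) * (1 - d * X * Z)) *
            (1 - q * Z) * (q * (1 * 1 / (q * Z ^ 2) + -(a + b + c) / (q * Z) +
          (a * b + a * c + b * c) / q - e * d * Z)) := by ring
        _ = _ := by
          rw [e1, e2, e3]
          field_simp
  · refine mul_prod_eq_prod (r := fun k => -1 * ((1 - a⁻¹ * d * q * q ^ k) *
      (1 - b⁻¹ * d * q * q ^ k) * (1 - c⁻¹ * d * q * q ^ k)) * e * (q * q ^ k) /
      ((1 - e * q * q ^ k) * ((1 - d * q * q ^ (2 * k)) * (1 - d * q * q ^ (2 * k + 1))))) ?_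
      fun k hk => ?_
    · simp only [qRacah, hc', ← he]
      rw [← prod_pow_triangle, qpoch_two_mul]
      simp only [qpoch, Finset.prod_div_distrib, Finset.prod_mul_distrib, Finset.prod_const,
        Finset.card_range]
    · rw [hE, hD, qRacahDeath, qSpec,
        show 2 * ((k + 1 : ℕ) : ℤ) - 1 = (2 * k + 1 : ℕ) by push_cast; ring, zpow_natCast]
      have h1 := (qRacah_gap hq hdq (2 * k + 1) (by omega)).ne'
      have h2 := (qRacah_gap hq hdq (2 * (k + 1)) (by omega)).ne'
      have h3 := (qRacah_gap hq heq (k + 1) (by omega)).ne'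
      have h4 := (hX (k + 1)).ne'
      rw [show 1 - a⁻¹ * d * q * q ^ k = 1 - a⁻¹ * d * q ^ (k + 1) by ring,
        show 1 - b⁻¹ * d * q * q ^ k = 1 - b⁻¹ * d * q ^ (k + 1) by ring,
        show 1 - c⁻¹ * d * q * q ^ k = 1 - c⁻¹ * d * q ^ (k + 1) by ring,
        show 1 - e * q * q ^ k = 1 - e * q ^ (k + 1) by ring,
        show 1 - d * q * q ^ (2 * k) = 1 - d * q ^ (2 * k + 1) by ring,
        show 1 - d * q * q ^ (2 * k + 1) = 1 - d * q ^ (2 * (k + 1)) by ring,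
        ← pow_succ' q k]
      generalize 1 - e * q ^ (k + 1) = u3 at *
      generalize 1 - d * q ^ (2 * k + 1) = u4 at *
      generalize 1 - d * q ^ (2 * (k + 1)) = u5 at *
      generalize (1 - a⁻¹ * d * q ^ (k + 1)) * (1 - b⁻¹ * d * q ^ (k + 1)) *
        (1 - c⁻¹ * d * q ^ (k + 1)) = W
      generalize q ^ (k + 1) = X at *
      field_simp

/-! ### Infinite matrices with orthogonal rows and columns -/

/-- Bessel's inequality for the projections of a unit vector to the rows of a matrix which are
orthogonal with squared norm `α`: the squared norm of a column is at most `α`. -/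
lemma le_of_hasSum_mul {ι κ : Type*} [DecidableEq ι] {φ : ι → κ → ℝ} {α β : ℝ}
    (hr : ∀ n m, HasSum (fun x => φ n x * φ m x) (if n = m then α else 0)) {x : κ}
    (hc : HasSum (fun n => φ n x * φ n x) β) (n₀ : ι) : β ≤ α := by
  have hα : 0 ≤ α := (hr n₀ n₀).nonneg (fun x => mul_self_nonneg _) |>.trans_eq (if_pos rfl)
  refine hasSum_le_of_sum_le hc fun s => ?_
  set t := ∑ n ∈ s, φ n x * φ n x with ht
  have ht0 : 0 ≤ t := Finset.sum_nonneg fun n _ => mul_self_nonneg _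
  have h1 : HasSum (fun y => (∑ n ∈ s, φ n x * φ n y) * ∑ m ∈ s, φ m x * φ m y) (α * t) := by
    have h2 : HasSum (fun y => ∑ n ∈ s, ∑ m ∈ s, φ n x * φ m x * (φ n y * φ m y))
        (∑ n ∈ s, ∑ m ∈ s, φ n x * φ m x * (if n = m then α else 0)) :=
      hasSum_sum fun n _ => hasSum_sum fun m _ => (hr n m).mul_left _
    refine hasSum_of_eq h2 (fun y => ?_) ?_
    · rw [Finset.sum_mul_sum]
      exact Finset.sum_congr rfl fun n _ => Finset.sum_congr rfl fun m _ => by ring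
    · rw [ht, Finset.mul_sum]
      refine Finset.sum_congr rfl fun n hn => ?_
      simp only [mul_ite, mul_zero, Finset.sum_ite_eq, if_pos hn]
      ring
  have h3 : t * t ≤ α * t := le_hasSum h1 x fun y _ => mul_self_nonneg _
  rcases ht0.eq_or_lt with h | h
  · rwa [← h]
  · exact le_of_mul_le_mul_right h3 h

/-- If the rows of an infinite matrix are orthogonal with squared norm `α` and the columns are
orthogonal with squared norm `β`, then `α = β`, by Bessel's inequality for the rows and for the
columns. -/
lemma eq_of_hasSum_mul {ι κ : Type*} [DecidableEq ι] [DecidableEq κ] {φ : ι → κ → ℝ} {α β : ℝ}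
    (hr : ∀ n m, HasSum (fun x => φ n x * φ m x) (if n = m then α else 0))
    (hc : ∀ x y, HasSum (fun n => φ n x * φ n y) (if x = y then β else 0)) (n₀ : ι) (x₀ : κ) :
    α = β := by
  refine le_antisymm ?_ ?_
  · have := hr n₀ n₀
    rw [if_pos rfl] at this
    exact le_of_hasSum_mul (φ := fun x n => φ n x) hc this x₀
  · have := hc x₀ x₀
    rw [if_pos rfl] at this
    exact le_of_hasSum_mul hr this n₀

lemma summable_mul_eval {w η : ℕ → ℝ} (h : ∀ k, Summable fun x => w x * η x ^ k)
    (p : Polynomial ℝ) : Summable fun x => w x * p.eval (η x) := by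
  have : ∀ x, w x * p.eval (η x) =
      ∑ k ∈ Finset.range (p.natDegree + 1), p.coeff k * (w x * η x ^ k) := fun x => by
    rw [Polynomial.eval_eq_sum_range, Finset.mul_sum]
    exact Finset.sum_congr rfl fun k _ => by ring
  simp only [this]
  exact summable_sum fun k _ => (h k).mul_left _

/-! ### Euler's product -/

lemma tendsto_qpoch {z q : ℝ} (hq : 0 < q ∧ q < 1) :
    Tendsto (fun k => qpoch z q k) atTop (𝓝 (qpochInf z q)) := by
  have h : Multipliable fun i : ℕ => 1 - z * q ^ i := by
    have := Real.multipliable_one_add_of_summable (f := fun i : ℕ => -(z * q ^ i))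
      ((summable_geometric_of_lt_one hq.1.le hq.2).mul_left z).neg
    simpa [sub_eq_add_neg] using this
  exact h.hasProd.tendsto_prod_nat

lemma summable_pow_div_qpoch {z q : ℝ} (hq : 0 < q ∧ q < 1) (hz : 0 < z ∧ z < 1) :
    Summable fun n => z ^ n / qpoch q q n := by
  have hpos : ∀ n, 0 < z ^ n / qpoch q q n := fun n =>
    div_pos (pow_pos hz.1 n) (qfactorial_pos hq.1 hq.2 n)
  refine summable_of_ratio_test_tendsto_lt_one hz.2 (Eventually.of_forall fun n => (hpos n).ne') ?_
  have h1 : Tendsto (fun n : ℕ => z / (1 - q * q ^ n)) atTop (𝓝 (z / (1 - q * 0))) :=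
    tendsto_const_nhds.div (((tendsto_pow_atTop_nhds_zero_of_lt_one hq.1.le hq.2).const_mul
      q).const_sub 1) (by norm_num)
  rw [mul_zero, sub_zero, div_one] at h1
  refine h1.congr fun n => ?_
  have h2 := (qfactorial_pos hq.1 hq.2 n).ne'
  have h3 := (qfactorial_pos hq.1 hq.2 (n + 1)).ne'
  rw [Real.norm_of_nonneg (hpos _).le, Real.norm_of_nonneg (hpos _).le]
  rw [qpoch_succ] at h3 ⊢
  have h4 := right_ne_zero_of_mul h3
  have h5 := (pow_pos hz.1 n).ne'
  rw [pow_succ]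
  field_simp

/-- Euler's product for the `q`-exponential function, from the functional equation
`f(qz) = (1 - z) f(z)`. -/
lemma hasSum_pow_div_qpoch {z q : ℝ} (hq : 0 < q ∧ q < 1) (hz : 0 < z ∧ z < 1) :
    0 < qpochInf z q ∧ HasSum (fun n => z ^ n / qpoch q q n) (1 / qpochInf z q) := by
  set f : ℝ → ℝ := fun z => ∑' n, z ^ n / qpoch q q n with hf
  have hzk : ∀ k : ℕ, 0 < z * q ^ k ∧ z * q ^ k < 1 := fun k =>
    ⟨mul_pos hz.1 (pow_pos hq.1 k), pow_mul_lt_one hq.1 hq.2 hz.2 k⟩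
  have hfe : ∀ s, 0 < s ∧ s < 1 → f (s * q) = (1 - s) * f s := fun s hs => by
    have h1 := summable_pow_div_qpoch hq hs
    have h2 := summable_pow_div_qpoch hq (z := s * q) ⟨mul_pos hs.1 hq.1,
      mul_lt_one_of_nonneg_of_lt_one_left hs.1.le hs.2 hq.2.le⟩
    have h3 : HasSum (fun n => s ^ n / qpoch q q n - (s * q) ^ n / qpoch q q n)
        (f s - f (s * q)) := h1.hasSum.sub h2.hasSum
    have h4 := (hasSum_nat_add_iff' 1).2 h3
    simp only [Finset.sum_range_one, pow_zero, qpoch_zero, sub_self, sub_zero] at h4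
    have h5 : HasSum (fun n => s ^ (n + 1) / qpoch q q (n + 1) -
        (s * q) ^ (n + 1) / qpoch q q (n + 1)) (s * f s) := by
      refine hasSum_of_eq (h1.hasSum.mul_left s) (fun n => ?_) rfl
      have h6 := (qfactorial_pos hq.1 hq.2 (n + 1)).ne'
      rw [qpoch_succ] at h6 ⊢
      have h7 := right_ne_zero_of_mul h6
      have h8 := left_ne_zero_of_mul h6
      field_simp
      ring
    linarith [h4.unique h5]
  have h1 : ∀ k, qpoch z q k * f z = f (z * q ^ k) := fun k => by
    induction k with
    | zero => simp
    | succ k ih =>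
      rw [qpoch_succ, mul_right_comm, ih, pow_succ, ← mul_assoc, hfe _ (hzk k), mul_comm]
  have h2 : Tendsto (fun k => f (z * q ^ k)) atTop
      (𝓝 (∑' n : ℕ, if n = 0 then (1 : ℝ) else 0)) := by
    refine tendsto_tsum_of_dominated_convergence (summable_pow_div_qpoch hq hz) (fun n => ?_)
      (Eventually.of_forall fun k n => ?_)
    · rcases eq_or_ne n 0 with rfl | hn
      · simp
      · rw [if_neg hn]
        have h3 : Tendsto (fun k : ℕ => (z * q ^ k) ^ n / qpoch q q n) atTop
            (𝓝 ((z * 0) ^ n / qpoch q q n)) :=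
          (((tendsto_pow_atTop_nhds_zero_of_lt_one hq.1.le hq.2).const_mul z).pow n).div_const _
        simpa [hn] using h3
    · have h4 := qfactorial_pos hq.1 hq.2 n
      rw [Real.norm_of_nonneg (div_nonneg (pow_nonneg (hzk k).1.le n) h4.le)]
      exact div_le_div_of_nonneg_right (pow_le_pow_left₀ (hzk k).1.le
        (mul_le_of_le_one_right hz.1.le (pow_le_one₀ hq.1.le hq.2.le)) n) h4.le
  rw [tsum_ite_eq] at h2
  have h3 : qpochInf z q * f z = 1 :=
    tendsto_nhds_unique ((tendsto_qpoch hq).mul_const (f z)) (h2.congr fun k => (h1 k).symm)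
  have h4 : 0 < qpochInf z q := by
    refine lt_of_le_of_ne (ge_of_tendsto' (tendsto_qpoch hq)
      fun k => (qpoch_pos hq.1 hq.2 hz.2 k).le) fun h => ?_
    rw [← h, zero_mul] at h3
    exact zero_ne_one h3
  refine ⟨h4, ?_⟩
  rw [← eq_one_div_of_mul_eq_one_right h3]
  exact (summable_pow_div_qpoch hq hz).hasSum

/-! ### Al-Salam–Carlitz II -/

section AlSalamCarlitz

variable {q a : ℝ}

/-- The Al-Salam–Carlitz II polynomials in split form. -/
def ascPoly (q a : ℝ) : ℕ → ℕ → ℝ :=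
  splitPoly (qSpec q 1 0) (qSpec q 0 (-1)) (qOff q 1 0 0 (-1) 0 (-a))

lemma ev_asc (hq : q ≠ 0) : (alSalamCarlitzII q a).E = qSpec q 0 (-1) := by
  funext n
  have := pow_ne_zero n hq
  simp only [alSalamCarlitzII, qSpec]
  field_simp
  ring

lemma strictMono_ev_asc (hq : 0 < q ∧ q < 1) : StrictMono (qSpec q 0 (-1)) :=
  strictMono_qSpec hq.1 hq.2 fun j _ => by
    have := pow_pos hq.1 j
    linarith

lemma strictMono_eta_asc (hq : 0 < q ∧ q < 1) : StrictMono (qSpec q 1 0) :=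
  strictMono_qSpec hq.1 hq.2 fun j _ => by norm_num

lemma asc_off_ne_zero (hq : 0 < q ∧ q < 1) (ha : 0 < a) (k : ℕ) :
    qOff q 1 0 0 (-1) 0 (-a) k ≠ 0 := by
  have := (sub_pos.2 (pow_mul_lt_one hq.1 hq.2 hq.2 k)).ne'
  simp [qOff, this, ha.ne']

lemma isLadder_asc (hq : 0 < q ∧ q < 1) :
    IsLadder (alSalamCarlitzII q a).B (alSalamCarlitzII q a).D (qSpec q 1 0) (qSpec q 0 (-1))
      (qOff q 1 0 0 (-1) 0 (-a)) := by
  refine isLadder_q hq.1 (fun j _ => by norm_num) ?_ ?_ (fun x hx => ?_) (fun x hx => ?_) <;>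
    simp only [alSalamCarlitzII] <;> ring

/-- The rates of the dual problem are not bounded. -/
lemma isLadder_asc_dual (hq : 0 < q ∧ q < 1) :
    IsLadder (fun n => a / q ^ n) (fun n => (1 - q ^ n) / q ^ n) (qSpec q 0 (-1)) (qSpec q 1 0)
      (qOff q 1 0 0 (-1) 0 (-a)) := by
  have h0 := hq.1.ne'
  have hX : ∀ x : ℕ, q ^ x ≠ 0 := fun x => pow_ne_zero x h0
  rw [qOff_swap]
  refine isLadder_q hq.1 (fun j _ => ?_) (by simp) (by simp; ring) (fun x hx => ?_)
    (fun x hx => ?_)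
  · have := pow_pos hq.1 j
    linarith
  · have := hX x
    field_simp
    ring
  · have := hX x
    field_simp
    ring

lemma asc_diffOp (hq : 0 < q ∧ q < 1) (ha : 0 < a) (n x : ℕ) :
    diffOp (alSalamCarlitzII q a).B (alSalamCarlitzII q a).D (ascPoly q a n) x =
      qSpec q 0 (-1) n * ascPoly q a n x :=
  (isLadder_asc hq).diffOp_splitPoly (fun k _ => asc_off_ne_zero hq ha k) x

lemma asc_diffOp_dual (hq : 0 < q ∧ q < 1) (ha : 0 < a) (n x : ℕ) :
    diffOp (fun n => a / q ^ n) (fun n => (1 - q ^ n) / q ^ n) (fun n => ascPoly q a n x) n =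
      qSpec q 1 0 x * ascPoly q a n x := by
  have := (isLadder_asc_dual hq).diffOp_splitPoly (fun k (_ : k < x) => asc_off_ne_zero hq ha k) n
  simp only [diffOp, splitPoly_symm (qSpec q 0 (-1))] at this
  exact this

lemma asc_weight_pos (hq : 0 < q ∧ q < 1) (ha : 0 < a) (haq : a * q < 1) (x : ℕ) :
    0 < (alSalamCarlitzII q a).phi0sq x :=
  div_pos (mul_pos (pow_pos ha x) (pow_pos hq.1 _))
    (mul_pos (qfactorial_pos hq.1 hq.2 x) (qpoch_pos hq.1 hq.2 haq x))

lemma asc_death_pos (hq : 0 < q ∧ q < 1) (haq : a * q < 1) (x : ℕ) :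
    0 < (alSalamCarlitzII q a).D (x + 1) := by
  refine mul_pos (sub_pos.2 (pow_lt_one₀ hq.1.le hq.2 x.succ_ne_zero)) (sub_pos.2 ?_)
  rw [pow_succ', ← mul_assoc]
  exact pow_mul_lt_one hq.1 hq.2 haq x

lemma asc_weight_succ (hq : 0 < q ∧ q < 1) (haq : a * q < 1) (x : ℕ) :
    (alSalamCarlitzII q a).phi0sq (x + 1) * (alSalamCarlitzII q a).D (x + 1) =
      (alSalamCarlitzII q a).phi0sq x * (alSalamCarlitzII q a).B x := by
  have h1 := (sub_pos.2 (pow_mul_lt_one hq.1 hq.2 hq.2 x)).ne'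
  have h2 := (sub_pos.2 (pow_mul_lt_one hq.1 hq.2 haq x)).ne'
  have h3 := (qfactorial_pos hq.1 hq.2 x).ne'
  have h4 := (qpoch_pos hq.1 hq.2 haq x).ne'
  simp only [alSalamCarlitzII]
  rw [qpoch_succ, qpoch_succ, show 1 - q ^ (x + 1) = 1 - q * q ^ x by ring,
    show 1 - a * q ^ (x + 1) = 1 - a * q * q ^ x by ring,
    show q ^ (x + 1) ^ 2 = q ^ x ^ 2 * q ^ (2 * x + 1) by rw [← pow_add]; congr 1; ring]
  generalize 1 - q * q ^ x = u1 at *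
  generalize 1 - a * q * q ^ x = u2 at *
  field_simp
  ring

/-- All moments of the weight function are finite. -/
lemma asc_summable_weight (hq : 0 < q ∧ q < 1) (ha : 0 < a) (haq : a * q < 1) (k : ℕ) :
    Summable fun x => (alSalamCarlitzII q a).phi0sq x * qSpec q 1 0 x ^ k := by
  have hX : ∀ x : ℕ, 0 < q ^ x := pow_pos hq.1
  have hw := asc_weight_pos hq ha haq
  have hpos : ∀ x, 0 < (alSalamCarlitzII q a).phi0sq x * ((q ^ x)⁻¹) ^ k := fun x =>
    mul_pos (hw x) (pow_pos (inv_pos.2 (hX x)) k)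
  have h1 : Summable fun x => (alSalamCarlitzII q a).phi0sq x * ((q ^ x)⁻¹) ^ k := by
    refine summable_of_ratio_test_tendsto_lt_one zero_lt_one
      (Eventually.of_forall fun n => (hpos n).ne') ?_
    have h0 := tendsto_pow_atTop_nhds_zero_of_lt_one hq.1.le hq.2
    have h2 : Tendsto (fun x : ℕ => a * q * (q ^ x) ^ 2 /
        ((1 - q * q ^ x) * (1 - a * q * q ^ x)) * (q⁻¹) ^ k) atTop
        (𝓝 (a * q * 0 ^ 2 / ((1 - q * 0) * (1 - a * q * 0)) * (q⁻¹) ^ k)) :=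
      (((h0.pow 2).const_mul (a * q)).div (((h0.const_mul q).const_sub 1).mul
        ((h0.const_mul (a * q)).const_sub 1)) (by norm_num)).mul_const _
    rw [show a * q * 0 ^ 2 / ((1 - q * 0) * (1 - a * q * 0)) * (q⁻¹) ^ k = 0 by simp] at h2
    refine h2.congr fun x => ?_
    rw [Real.norm_of_nonneg (hpos _).le, Real.norm_of_nonneg (hpos _).le]
    have hD := (asc_death_pos hq haq x).ne'
    have e1 : (alSalamCarlitzII q a).phi0sq (x + 1) =
        (alSalamCarlitzII q a).phi0sq x * (alSalamCarlitzII q a).B x /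
          (alSalamCarlitzII q a).D (x + 1) := by
      rw [eq_div_iff hD, asc_weight_succ hq haq]
    have e2 : (alSalamCarlitzII q a).D (x + 1) = (1 - q * q ^ x) * (1 - a * q * q ^ x) := by
      simp only [alSalamCarlitzII]
      ring
    have e3 : (alSalamCarlitzII q a).B x = a * q * (q ^ x) ^ 2 := by
      simp only [alSalamCarlitzII]
      ring
    rw [e1, e2, e3, pow_succ q x, mul_inv, mul_pow]
    have h3 := (hw x).ne'
    have h4 := (pow_pos (inv_pos.2 (hX x)) k).ne'
    generalize (q ^ x)⁻¹ ^ k = Y at *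
    generalize q⁻¹ ^ k = Z at *
    field_simp
  refine Summable.of_norm_bounded h1 fun x => ?_
  have h2 : 1 ≤ (q ^ x)⁻¹ := (one_le_inv₀ (hX x)).2 (pow_le_one₀ hq.1.le hq.2.le)
  have h3 : qSpec q 1 0 x = (q ^ x)⁻¹ - 1 := by
    simp [qSpec]
  rw [h3, Real.norm_of_nonneg (mul_nonneg (hw x).le (pow_nonneg (by linarith) k))]
  exact mul_le_mul_of_nonneg_left (pow_le_pow_left₀ (by linarith) (by linarith) k) (hw x).le

lemma ev_asc_mem (hq : 0 < q ∧ q < 1) (n : ℕ) : qSpec q 0 (-1) n ∈ Set.Icc (0 : ℝ) 1 := by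
  have h1 := pow_pos hq.1 n
  have h2 := pow_le_one₀ (n := n) hq.1.le hq.2.le
  have h3 : qSpec q 0 (-1) n = 1 - q ^ n := by
    rw [← ev_asc (a := 1) hq.1.ne']
    rfl
  rw [h3]
  constructor <;> linarith

lemma asc_summable_dual (hq : 0 < q ∧ q < 1) (ha : 0 < a) (haq : a * q < 1) (k : ℕ) :
    Summable fun n => (alSalamCarlitzII q a).dratio n * qSpec q 0 (-1) n ^ k := by
  have h1 := summable_pow_div_qpoch hq ⟨mul_pos ha hq.1, haq⟩
  refine Summable.of_norm_bounded h1 fun n => ?_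
  have h2 := ev_asc_mem hq n
  have h3 : 0 ≤ (a * q) ^ n / qpoch q q n :=
    div_nonneg (pow_nonneg (mul_pos ha hq.1).le n) (qfactorial_pos hq.1 hq.2 n).le
  rw [norm_mul, norm_pow, Real.norm_of_nonneg h2.1]
  change ‖(a * q) ^ n / qpoch q q n‖ * _ ≤ _
  rw [Real.norm_of_nonneg h3]
  exact mul_le_of_le_one_right h3 (pow_le_one₀ h2.1 h2.2)

lemma exists_polynomial_asc (hq : 0 < q ∧ q < 1) (ha : 0 < a) (n : ℕ) :
    ∃ p : Polynomial ℝ, p.degree = (n : WithBot ℕ) ∧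
      ∀ x, ascPoly q a n x = p.eval (qSpec q 1 0 x) :=
  exists_polynomial_splitPoly (strictMono_ev_asc hq) fun k _ => asc_off_ne_zero hq ha k

lemma exists_polynomial_asc_dual (hq : 0 < q ∧ q < 1) (ha : 0 < a) (x : ℕ) :
    ∃ p : Polynomial ℝ, ∀ n, ascPoly q a n x = p.eval (qSpec q 0 (-1) n) := by
  obtain ⟨p, -, hp⟩ := exists_polynomial_splitPoly (η := qSpec q 0 (-1)) (strictMono_eta_asc hq)
    (n := x) fun k _ => asc_off_ne_zero hq ha k
  exact ⟨p, fun n => by rw [← hp, splitPoly_symm]; rfl⟩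

lemma summable_asc_mul (hq : 0 < q ∧ q < 1) (ha : 0 < a) (haq : a * q < 1) (n m : ℕ) :
    Summable fun x => (alSalamCarlitzII q a).phi0sq x * ascPoly q a n x * ascPoly q a m x := by
  obtain ⟨p, -, hp⟩ := exists_polynomial_asc hq ha n
  obtain ⟨r, -, hr⟩ := exists_polynomial_asc hq ha m
  refine (summable_mul_eval (asc_summable_weight hq ha haq) (p * r)).congr fun x => ?_
  rw [Polynomial.eval_mul, ← hp, ← hr, mul_assoc]

lemma summable_asc_mul_dual (hq : 0 < q ∧ q < 1) (ha : 0 < a) (haq : a * q < 1) (x y : ℕ) :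
    Summable fun n => (alSalamCarlitzII q a).dratio n * ascPoly q a n x * ascPoly q a n y := by
  obtain ⟨p, hp⟩ := exists_polynomial_asc_dual hq ha x
  obtain ⟨r, hr⟩ := exists_polynomial_asc_dual hq ha y
  refine (summable_mul_eval (asc_summable_dual hq ha haq) (p * r)).congr fun n => ?_
  rw [Polynomial.eval_mul, ← hp, ← hr, mul_assoc]

lemma asc_isBirthDeath (hq : 0 < q ∧ q < 1) (ha : 0 < a) (haq : a * q < 1) :
    IsBirthDeath ⊤ (alSalamCarlitzII q a).B (alSalamCarlitzII q a).D where
  birth_pos x _ := mul_pos ha (pow_pos hq.1 _)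
  birth_end x hx := (ENat.natCast_ne_top x.1 hx).elim
  death_pos x hx := by
    obtain ⟨k, hk⟩ := Nat.exists_eq_succ_of_ne_zero hx
    rw [hk]
    exact asc_death_pos hq haq k
  death_zero := by simp [alSalamCarlitzII]

lemma asc_bounded (hq : 0 < q ∧ q < 1) (ha : 0 < a) (haq : a * q < 1) (x : ℕ) :
    (alSalamCarlitzII q a).B x + (alSalamCarlitzII q a).D x ≤ 2 := by
  have h1 := pow_pos hq.1 x
  have h2 := pow_le_one₀ (n := x) hq.1.le hq.2.le
  have h3 : (alSalamCarlitzII q a).B x ≤ 1 := by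
    simp only [alSalamCarlitzII]
    rw [pow_succ', ← mul_assoc]
    exact mul_le_one₀ haq.le (pow_pos hq.1 _).le (pow_le_one₀ hq.1.le hq.2.le)
  have h4 : (alSalamCarlitzII q a).D x ≤ 1 := by
    rcases x with _ | x
    · simp [alSalamCarlitzII]
    · have h5 : a * q ^ (x + 1) < 1 := by
        rw [pow_succ', ← mul_assoc]
        exact pow_mul_lt_one hq.1 hq.2 haq x
      have h6 := mul_pos ha h1
      simp only [alSalamCarlitzII]
      nlinarith
  linarith

lemma asc_orthogonal (hq : 0 < q ∧ q < 1) (ha : 0 < a) (haq : a * q < 1) {n m : ℕ} (h : n ≠ m) :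
    HasSum (fun x => (alSalamCarlitzII q a).phi0sq x * ascPoly q a n x * ascPoly q a m x) 0 := by
  have hs : ∀ n, Summable fun x : Lattice ⊤ =>
      (alSalamCarlitzII q a).phi0sq x * ascPoly q a n x ^ 2 := fun n =>
    ((hasSum_lattice_top (f := fun x => (alSalamCarlitzII q a).phi0sq x * ascPoly q a n x *
      ascPoly q a n x)).2 (summable_asc_mul hq ha haq n n).hasSum).summable.congr fun x => by ring
  exact hasSum_lattice_top.1 (hasSum_mul_eq_zero (asc_isBirthDeath hq ha haq)
    (fun x => asc_bounded hq ha haq x) (fun x => (asc_weight_pos hq ha haq x).le)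
    (fun x _ => asc_weight_succ hq haq x) (fun x => asc_diffOp hq ha n x)
    (fun x => asc_diffOp hq ha m x) (fun e => h ((strictMono_ev_asc hq).injective e)) (hs n) (hs m))

lemma asc_dratio_succ (hq : 0 < q ∧ q < 1) (n : ℕ) :
    (alSalamCarlitzII q a).dratio (n + 1) * ((1 - q ^ (n + 1)) / q ^ (n + 1)) =
      (alSalamCarlitzII q a).dratio n * (a / q ^ n) := by
  have h1 := (sub_pos.2 (pow_mul_lt_one hq.1 hq.2 hq.2 n)).ne'
  have h2 := (qfactorial_pos hq.1 hq.2 n).ne'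
  have h3 := hq.1.ne'
  simp only [alSalamCarlitzII]
  rw [qpoch_succ, show 1 - q ^ (n + 1) = 1 - q * q ^ n by ring]
  generalize 1 - q * q ^ n = u at *
  field_simp
  ring

/-- The Christoffel–Darboux identity shows that the columns are orthogonal: the polynomials are
Lipschitz functions of `q^n`, so that the boundary term vanishes in the limit although the rates of
the dual problem are unbounded. -/
lemma asc_dual_orthogonal (hq : 0 < q ∧ q < 1) (ha : 0 < a) (haq : a * q < 1) {x y : ℕ}
    (h : x ≠ y) :
    HasSum (fun n => (alSalamCarlitzII q a).dratio n * ascPoly q a n x * ascPoly q a n y) 0 := by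
  set v := (alSalamCarlitzII q a).dratio with hv
  set f : ℕ → ℝ := fun n => ascPoly q a n x with hf
  set g : ℕ → ℝ := fun n => ascPoly q a n y with hg
  have hv0 : ∀ n, 0 ≤ v n := fun n =>
    div_nonneg (pow_nonneg (mul_pos ha hq.1).le n) (qfactorial_pos hq.1 hq.2 n).le
  have hlip : ∀ z, ∃ C K : ℝ, 0 ≤ C ∧ ∀ n, |ascPoly q a n z| ≤ C ∧
      |ascPoly q a (n + 1) z - ascPoly q a n z| ≤ K * q ^ n := fun z => by
    obtain ⟨p, hp⟩ := exists_polynomial_asc_dual hq ha z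
    obtain ⟨C, hC⟩ := (isCompact_Icc (a := (0 : ℝ)) (b := 1)).exists_bound_of_continuousOn
      p.continuousOn
    obtain ⟨K, hK⟩ := (isCompact_Icc (a := (0 : ℝ)) (b := 1)).exists_bound_of_continuousOn
      (Polynomial.derivative p).continuousOn
    refine ⟨C, K, (norm_nonneg _).trans (hC 0 (by simp)), fun n => ⟨?_, ?_⟩⟩
    · rw [hp]
      exact hC _ (ev_asc_mem hq n)
    · have h1 := Convex.norm_image_sub_le_of_norm_deriv_le (f := fun s => p.eval s)
        (fun s _ => p.differentiableAt) (fun s hs => by rw [Polynomial.deriv]; exact hK s hs)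
        (convex_Icc (0 : ℝ) 1) (ev_asc_mem hq n) (ev_asc_mem hq (n + 1))
      have h2 : qSpec q 0 (-1) (n + 1) - qSpec q 0 (-1) n = q ^ n * (1 - q) := by
        rw [← ev_asc (a := a) hq.1.ne']
        simp only [alSalamCarlitzII]
        ring
      have h3 := pow_pos hq.1 n
      have hK0 : 0 ≤ K := (norm_nonneg _).trans (hK 0 (by simp))
      rw [← hp, ← hp, h2, Real.norm_of_nonneg (mul_nonneg h3.le (sub_nonneg.2 hq.2.le))] at h1
      refine h1.trans (mul_le_mul_of_nonneg_left ?_ hK0)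
      exact mul_le_of_le_one_right h3.le (by linarith [hq.1])
  obtain ⟨C, K, hC0, hf'⟩ := hlip x
  obtain ⟨C', K', hC0', hg'⟩ := hlip y
  have hs := summable_asc_mul_dual hq ha haq x y
  have hvs : Summable v := by
    simpa using asc_summable_dual hq ha haq 0
  have hxy : qSpec q 1 0 x - qSpec q 1 0 y ≠ 0 :=
    sub_ne_zero.2 fun e => h ((strictMono_eta_asc hq).injective e)
  have key : ∀ M, (qSpec q 1 0 x - qSpec q 1 0 y) *
      ∑ n ∈ Finset.range (M + 1), v n * f n * g n =
      v M * (a / q ^ M) * (f M * g (M + 1) - f (M + 1) * g M) := fun M => by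
    have h0 := sum_diffOp_sub (B := fun n => a / q ^ n) (D := fun n => (1 - q ^ n) / q ^ n)
      (w := v) (M := M) (by simp) (fun n _ => asc_dratio_succ hq n) f g
    rw [← h0, Finset.mul_sum]
    refine Finset.sum_congr rfl fun n _ => ?_
    rw [asc_diffOp_dual hq ha n x, asc_diffOp_dual hq ha n y]
    ring
  have h1 : Tendsto (fun M : ℕ => (qSpec q 1 0 x - qSpec q 1 0 y) *
      ∑ n ∈ Finset.range (M + 1), v n * f n * g n) atTop (𝓝 (_ * _)) :=
    ((tendsto_add_atTop_iff_nat 1).2 hs.hasSum.tendsto_sum_nat).const_mul _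
  have h2 : Tendsto (fun M : ℕ => (qSpec q 1 0 x - qSpec q 1 0 y) *
      ∑ n ∈ Finset.range (M + 1), v n * f n * g n) atTop (𝓝 0) := by
    have h3 : Tendsto (fun M : ℕ => a * (C * K' + K * C') * v M) atTop
        (𝓝 (a * (C * K' + K * C') * 0)) := hvs.tendsto_atTop_zero.const_mul _
    rw [mul_zero] at h3
    refine squeeze_zero_norm (fun M => ?_) h3
    have hX := pow_pos hq.1 M
    have h4 : |f M * g (M + 1) - f (M + 1) * g M| ≤ (C * K' + K * C') * q ^ M := by
      rw [show f M * g (M + 1) - f (M + 1) * g M =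
        f M * (g (M + 1) - g M) - (f (M + 1) - f M) * g M by ring]
      refine (abs_sub _ _).trans ?_
      rw [abs_mul, abs_mul]
      have h5 := mul_le_mul (hf' M).1 (hg' M).2 (abs_nonneg _) hC0
      have h6 := mul_le_mul (hf' M).2 (hg' M).1 (abs_nonneg _) ((abs_nonneg _).trans (hf' M).2)
      calc _ ≤ C * (K' * q ^ M) + K * q ^ M * C' := add_le_add h5 h6
        _ = _ := by ring
    rw [key M, Real.norm_eq_abs, abs_mul, abs_of_nonneg (mul_nonneg (hv0 M) (div_pos ha hX).le)]
    calc _ ≤ v M * (a / q ^ M) * ((C * K' + K * C') * q ^ M) :=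
          mul_le_mul_of_nonneg_left h4 (mul_nonneg (hv0 M) (div_pos ha hX).le)
      _ = _ := by field_simp
  have h3 := (mul_eq_zero.1 (tendsto_nhds_unique h1 h2)).resolve_left hxy
  exact h3 ▸ hs.hasSum

/-- The squared norms of the columns. Euler's product is the case `x = 0`, and the difference
equation in `x`, read as the recurrence relation of the dual polynomials, gives the quotients. -/
lemma asc_norm_dual (hq : 0 < q ∧ q < 1) (ha : 0 < a) (haq : a * q < 1) (x : ℕ) :
    HasSum (fun n => (alSalamCarlitzII q a).dratio n * ascPoly q a n x * ascPoly q a n x)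
      (1 / (qpochInf (a * q) q * (alSalamCarlitzII q a).phi0sq x)) := by
  obtain ⟨hinf, heuler⟩ := hasSum_pow_div_qpoch hq ⟨mul_pos ha hq.1, haq⟩
  induction x with
  | zero =>
    refine hasSum_of_eq heuler (fun n => ?_) ?_
    · rw [ascPoly, splitPoly_at_zero, mul_one, mul_one]
      rfl
    · simp [alSalamCarlitzII]
  | succ x ih =>
    have hs := summable_asc_mul_dual hq ha haq (x + 1) (x + 1)
    have h1 := norm_recurrence (w := (alSalamCarlitzII q a).dratio) (t := qSpec q 0 (-1))
      (p := fun x n => ascPoly q a n x) (A := (alSalamCarlitzII q a).B)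
      (C := (alSalamCarlitzII q a).D) (n := x) (fun n => asc_diffOp hq ha n x)
      (fun n => asc_diffOp hq ha n (x + 1)) ih hs.hasSum
      (asc_dual_orthogonal hq ha haq (by omega)) (asc_dual_orthogonal hq ha haq (by omega))
      (Or.inr (asc_dual_orthogonal hq ha haq (by omega)))
    have hB : (alSalamCarlitzII q a).B x ≠ 0 := (mul_pos ha (pow_pos hq.1 _)).ne'
    have h2 := asc_weight_succ hq haq x
    have h3 := (asc_weight_pos hq ha haq x).ne'
    have h4 := (asc_weight_pos hq ha haq (x + 1)).ne'
    have h5 := hinf.ne'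
    convert hs.hasSum using 1
    refine mul_left_cancel₀ hB (Eq.trans ?_ h1.symm)
    field_simp
    linear_combination -h2

/-- The squared norms follow from the three term recurrence relation up to a common factor, and the
comparison with the dual problem fixes that factor. -/
lemma asc_norm (hq : 0 < q ∧ q < 1) (ha : 0 < a) (haq : a * q < 1) (n : ℕ) :
    HasSum (fun x => (alSalamCarlitzII q a).phi0sq x * ascPoly q a n x * ascPoly q a n x)
      (1 / (alSalamCarlitzII q a).dsq n) := by
  obtain ⟨hinf, -⟩ := hasSum_pow_div_qpoch hq ⟨mul_pos ha hq.1, haq⟩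
  set w := (alSalamCarlitzII q a).phi0sq with hw
  set v := (alSalamCarlitzII q a).dratio with hv
  have hw0 : ∀ x, 0 < w x := asc_weight_pos hq ha haq
  have hv0 : ∀ n, 0 < v n := fun n =>
    div_pos (pow_pos (mul_pos ha hq.1) n) (qfactorial_pos hq.1 hq.2 n)
  set H : ℕ → ℝ := fun n => ∑' x, w x * ascPoly q a n x * ascPoly q a n x with hH
  have hHs : ∀ n, HasSum (fun x => w x * ascPoly q a n x * ascPoly q a n x) (H n) := fun n =>
    (summable_asc_mul hq ha haq n n).hasSum
  have hvH : ∀ n, v n * H n = H 0 := fun n => by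
    induction n with
    | zero => simp [hv, alSalamCarlitzII]
    | succ n ih =>
      have h1 := norm_recurrence (w := w) (t := qSpec q 1 0) (p := fun n x => ascPoly q a n x)
        (A := fun n => a / q ^ n) (C := fun n => (1 - q ^ n) / q ^ n) (n := n)
        (fun x => asc_diffOp_dual hq ha n x) (fun x => asc_diffOp_dual hq ha (n + 1) x) (hHs n)
        (hHs (n + 1)) (asc_orthogonal hq ha haq (by omega)) (asc_orthogonal hq ha haq (by omega))
        (Or.inr (asc_orthogonal hq ha haq (by omega)))
      have h2 := asc_dratio_succ (a := a) hq n
      have h3 : (1 - q ^ (n + 1)) / q ^ (n + 1) ≠ 0 :=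
        (div_pos (sub_pos.2 (pow_lt_one₀ hq.1.le hq.2 n.succ_ne_zero)) (pow_pos hq.1 _)).ne'
      refine mul_left_cancel₀ h3 ?_
      rw [← ih]
      linear_combination H (n + 1) * h2 + v n * h1
  have hH0 : H 0 = 1 / qpochInf (a * q) q := by
    refine eq_of_hasSum_mul (φ := fun n x => √(v n) * √(w x) * ascPoly q a n x)
      (fun n m => ?_) (fun x y => ?_) 0 0
    · split_ifs with e
      · subst e
        refine hasSum_of_eq ((hHs n).mul_left (v n)) (fun x => ?_) (hvH n).symm
        linear_combination (√(w x) ^ 2 * ascPoly q a n x ^ 2) * Real.sq_sqrt (hv0 n).le +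
          (v n * ascPoly q a n x ^ 2) * Real.sq_sqrt (hw0 x).le
      · refine hasSum_of_eq ((asc_orthogonal hq ha haq e).mul_left (√(v n) * √(v m)))
          (fun x => ?_) (mul_zero _).symm
        linear_combination (√(v n) * √(v m) * ascPoly q a n x * ascPoly q a m x) *
          Real.sq_sqrt (hw0 x).le
    · split_ifs with e
      · subst e
        refine hasSum_of_eq ((asc_norm_dual hq ha haq x).mul_left (w x)) (fun n => ?_) ?_
        · linear_combination (√(w x) ^ 2 * ascPoly q a n x ^ 2) * Real.sq_sqrt (hv0 n).le +
            (v n * ascPoly q a n x ^ 2) * Real.sq_sqrt (hw0 x).le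
        · have := (hw0 x).ne'
          rw [← hw]
          field_simp
      · refine hasSum_of_eq ((asc_dual_orthogonal hq ha haq e).mul_left (√(w x) * √(w y)))
          (fun n => ?_) (mul_zero _).symm
        linear_combination (√(w x) * √(w y) * ascPoly q a n x * ascPoly q a n y) *
          Real.sq_sqrt (hv0 n).le
  have h := hvH n
  rw [hH0] at h
  have h1 := (hv0 n).ne'
  have h2 := hinf.ne'
  convert hHs n using 1
  change 1 / (v n * qpochInf (a * q) q) = H n
  field_simp at h ⊢
  linear_combination -h

lemma asc_eq_ascPoly (hq : 0 < q ∧ q < 1) (ha : 0 < a) (n x : ℕ) :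
    (alSalamCarlitzII q a).P n x = ascPoly q a n x := by
  refine qhyp_eq_splitPoly hq (fun k _ => asc_off_ne_zero hq ha k) (fun k _ => by simp)
    fun k hk => ?_
  have h1 := (pow_pos hq.1 n).ne'
  have h2 := (pow_pos hq.1 x).ne'
  have h3 := (pow_pos hq.1 k).ne'
  have h4 := ha.ne'
  simp only [List.map_cons, List.map_nil, List.prod_cons, List.prod_nil, List.length_cons,
    List.length_nil, qOff, qSpec, zpow_neg_cast]
  norm_num
  field_simp
  ring

lemma isSolved_alSalamCarlitzII (hq : 0 < q ∧ q < 1) (ha : 0 < a ∧ a < q⁻¹) :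
    (alSalamCarlitzII q a).IsSolved := by
  have haq : a * q < 1 := by
    have := mul_lt_mul_of_pos_right ha.2 hq.1
    rwa [inv_mul_cancel₀ hq.1.ne'] at this
  replace ha := ha.1
  obtain ⟨hinf, -⟩ := hasSum_pow_div_qpoch hq ⟨mul_pos ha hq.1, haq⟩
  have hη : (alSalamCarlitzII q a).eta = qSpec q 1 0 := eta_eq_qSpec fun _ => rfl
  have hE : (alSalamCarlitzII q a).E = qSpec q 0 (-1) := ev_asc hq.1.ne'
  have hbd := asc_isBirthDeath hq ha haq
  have hphi : ∀ x : ℕ, phi0 (alSalamCarlitzII q a).B (alSalamCarlitzII q a).D x ^ 2 =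
      (alSalamCarlitzII q a).phi0sq x := fun x =>
    Data.phi0_sq_eq_phi0sq (S := alSalamCarlitzII q a) hbd (by simp [alSalamCarlitzII])
      (fun x _ => asc_weight_succ hq haq x) ⟨x, le_top⟩
  have hv0 : ∀ n, 0 < (alSalamCarlitzII q a).dratio n := fun n =>
    div_pos (pow_pos (mul_pos ha hq.1) n) (qfactorial_pos hq.1 hq.2 n)
  have hd0 : ∀ n, 0 < (alSalamCarlitzII q a).dsq n := fun n => mul_pos (hv0 n) hinf
  have hP := asc_eq_ascPoly hq ha
  have hdiag : (alSalamCarlitzII q a).IsDiagonalized :=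
    { isBirthDeath := hbd
      bounded := ⟨2, fun x => asc_bounded hq ha haq x⟩
      P_zero := fun x => by
        rw [hP]
        simp [ascPoly, splitPoly]
      P_at_zero := fun n => by rw [hP, ascPoly, splitPoly_at_zero]
      difference_eq := fun n x => by
        rw [show (alSalamCarlitzII q a).P n = ascPoly q a n from funext (hP n), hE]
        exact asc_diffOp hq ha n x
      E_zero := by rw [hE]; exact (isLadder_asc (a := a) hq).ev_zero
      E_pos := fun n hn => by
        have h1 := strictMono_ev_asc hq (Nat.pos_of_ne_zero hn)
        rwa [(isLadder_asc (a := a) hq).ev_zero, ← hE] at h1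
      E_injective := fun n m e => Subtype.ext ((strictMono_ev_asc hq).injective (by
        simpa only [hE] using e))
      d0sq_pos := hinf
      dratio_zero := by simp [alSalamCarlitzII]
      dsq_pos := fun n => hd0 n
      norm := fun n m => by
        simp only [hphi, hP]
        split_ifs with e
        · subst e
          exact (hasSum_lattice_top (f := fun x => (alSalamCarlitzII q a).phi0sq x *
            ascPoly q a n x * ascPoly q a n x)).2 (asc_norm hq ha haq n)
        · exact (hasSum_lattice_top (f := fun x => (alSalamCarlitzII q a).phi0sq x *
            ascPoly q a n x * ascPoly q a m x)).2
            (asc_orthogonal hq ha haq fun e' => e (Subtype.ext e'))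
      dual := fun x y => by
        have hsq : ∀ n x y, (alSalamCarlitzII q a).phihat n x * (alSalamCarlitzII q a).phihat n y =
            qpochInf (a * q) q * (phi0 (alSalamCarlitzII q a).B (alSalamCarlitzII q a).D x *
              phi0 (alSalamCarlitzII q a).B (alSalamCarlitzII q a).D y) *
              ((alSalamCarlitzII q a).dratio n * ascPoly q a n x * ascPoly q a n y) :=
          fun n x y => by
            have h1 := Real.sq_sqrt (hd0 n).le
            have h2 : (alSalamCarlitzII q a).dsq n =
                (alSalamCarlitzII q a).dratio n * qpochInf (a * q) q := rfl
            simp only [Data.phihat, hP]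
            rw [h2] at h1 ⊢
            linear_combination (phi0 (alSalamCarlitzII q a).B (alSalamCarlitzII q a).D x *
              phi0 (alSalamCarlitzII q a).B (alSalamCarlitzII q a).D y * ascPoly q a n x *
                ascPoly q a n y) * h1
        simp only [hsq]
        split_ifs with e
        · subst e
          refine hasSum_of_eq (((hasSum_lattice_top (f := fun n =>
            (alSalamCarlitzII q a).dratio n * ascPoly q a n x * ascPoly q a n x)).2
            (asc_norm_dual hq ha haq x)).mul_left _) (fun n => rfl) ?_
          have h1 := (asc_weight_pos hq ha haq x).ne'
          have h2 := hinf.ne'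
          rw [← pow_two, hphi]
          field_simp
        · exact hasSum_of_eq (((hasSum_lattice_top (f := fun n =>
            (alSalamCarlitzII q a).dratio n * ascPoly q a n x * ascPoly q a n y)).2
            (asc_dual_orthogonal hq ha haq fun e' => e (Subtype.ext e'))).mul_left _)
            (fun n => rfl) (mul_zero _).symm }
  refine hdiag.isSolved (by simp [alSalamCarlitzII]) (fun n => ?_) fun x => hphi x
  obtain ⟨p, hp1, hp2⟩ := exists_polynomial_asc hq ha n
  exact ⟨p, hp1, fun x => by rw [hP, hη, hp2]⟩

end AlSalamCarlitz

end BD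

end

theorem theorem3p6 (S : BD.Data) (hS : BD.Listed S) :
    S.IsSpectralData ∧ S.SolvesContinuous ∧
      ∀ t : ℝ, 0 < t → (∀ x : BD.Lattice S.N, t * (S.B x + S.D x) < 1) →
        S.SolvesDiscrete t := by
  cases hS with
  | krawtchouk N p hp => exact BD.isSolved_krawtchouk N p hp
  | hahn N a b ha hb => exact BD.isSolved_hahn N a b ha hb
  | dualHahn N a b ha hb => exact BD.isSolved_dualHahn N a b ha hb
  | racah N a b d _ hd ha hb => exact BD.isSolved_racah N a b d hd ha hb
  | affineQKrawtchouk N q p hq hp => exact BD.isSolved_affineQKrawtchouk N q p hq hp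
  | qKrawtchouk N q p hq hp => exact BD.isSolved_qKrawtchouk N q p hq hp
  | quantumQKrawtchouk N q p hq hp => exact BD.isSolved_quantumQKrawtchouk N q p hq hp
  | qHahn N q a b hq ha hb => exact BD.isSolved_qHahn N q a b hq ha hb
  | dualQHahn N q a b hq ha hb => exact BD.isSolved_dualQHahn N q a b hq ha hb
  | qRacah N q a b d hq _ hd ha hb => exact BD.isSolved_qRacah N q a b d hq hd ha hb
  | alSalamCarlitzII q a hq ha => exact BD.isSolved_alSalamCarlitzII hq ha
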